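/- Let $d\in\{2,3\}$, $\Omega=(0,1)^d$, $T>0$, and let $(\mathsf u,\mathsf p)$ be a solution of the time-dependent Stokes problem $$\mathsf u_t-\Delta \mathsf u+\nabla \mathsf p=f,\qquad \nabla\!\cdot\mathsf u=0 \ \text{ in }\Omega,\qquad \mathsf u|_{\partial\Omega}=0,$$ on $[0,T]$, with $f\in W^{2,\infty}(0,T;L^2(\Omega)^d)$ (for instance $f$ smooth). For $\tau>0$ let $B_\tau=\partial_{xxyy}$ if $d=2$ and $B_\tau=\partial_{xxyy}+\partial_{yyzz}+\partial_{zzxx}-\frac\tau2\partial_{xxyyzz}$ if $d=3$, with domain $D(B_\tau)=\{v\in H^1_0(\Omega)^d: B_\tau v\in L^2(\Omega)^d\}$ and the graph norm; let $Y$ be the space of zero-mean $q\in H^1(\Omega)$ with $\partial_{xy}q\in L^2(\Omega)$ if $d=2$, and with $\partial_{xy}q,\partial_{yz}q,\partial_{zx}q,\partial_{xyz}q\in L^2(\Omega)$ if $d=3$. Let $A=(1-\partial_{xx})(1-\partial_{yy})$ if $d=2$ and $A=(1-\partial_{xx})(1-\partial_{yy})(1-\partial_{zz})$ if $d=3$,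 acting on zero-mean functions, where each one-dimensional factor is taken with homogeneous Neumann conditions on the two faces orthogonal to its direction. Assume $$\mathsf u\in W^{2,\infty}(0,T;H^2(\Omega)^d),\qquad \mathsf u\in W^{1,\infty}(0,T;D(B_\tau))\ \text{ for all }\tau>0,\qquad \mathsf p\in W^{2,\infty}(0,T;Y).$$ Let $0<\chi\le 1$. For a time step $\tau>0$ put $t_k=k\tau$ and $f^{k+\frac12}=f(t_k+\frac\tau2)$, and consider the rotational direction-splitting scheme: $u^0=\mathsf u(0)$, $p^{-\frac12}=\mathsf p(0)$, $\phi^{-\frac12}=\phi^\star$ given, and for each $k\ge0$ with $t_{k+1}\le T$: 1. $p^{\star,k+\frac12}=p^{k-\frac12}+\phi^{k-\frac12}$. 2. If $d=2$, find $u^{k+\frac12},u^{k+1}$ with $$\tfrac{u^{k+\frac12}-u^k}{\tau/2}-\partial_{xx}u^{k+\frac12}-\partial_{yy}u^k+\nabla p^{\star,k+\frac12}=f^{k+\frac12},\quad u^{k+\frac12}|_{x=0,1}=0,$$ $$\tfrac{u^{k+1}-u^{k+\frac12}}{\tau/2}-\partial_{xx}u^{k+\frac12}-\partial_{yy}u^{k+1}+\nabla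 p^{\star,k+\frac12}=f^{k+\frac12},\quad u^{k+1}|_{y=0,1}=0.$$ If $d=3$, find $\xi^{k+1},\eta^{k+1},\zeta^{k+1},u^{k+1}$ with $$\tfrac{\xi^{k+1}-u^k}{\tau}-\Delta u^k+\nabla p^{\star,k+\frac12}=f^{k+\frac12},$$ $$\tfrac{\eta^{k+1}-\xi^{k+1}}{\tau}-\tfrac12\partial_{xx}(\eta^{k+1}-u^k)=0,\quad \eta^{k+1}|_{x=0,1}=0,$$ $$\tfrac{\zeta^{k+1}-\eta^{k+1}}{\tau}-\tfrac12\partial_{yy}(\zeta^{k+1}-u^k)=0,\quad \zeta^{k+1}|_{y=0,1}=0,$$ $$\tfrac{u^{k+1}-\zeta^{k+1}}{\tau}-\tfrac12\partial_{zz}(u^{k+1}-u^k)=0,\quad u^{k+1}|_{z=0,1}=0.$$ 3. $A\phi^{k+\frac12}=-\frac1\tau\nabla\!\cdot u^{k+1}$. 4. $p^{k+\frac12}=p^{k-\frac12}+\phi^{k+\frac12}-\chi\,\nabla\!\cdot\bar u^{k+\frac12}$, where $\bar u^{k+\frac12}=\frac12(u^{k+1}+u^k)$. The equations are understood in $L^2(\Omega)$,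 with weak derivatives. Then for every $C_0$ there is a constant $c$, independent of $\tau$, of $\phi^\star$ and of the discrete solution, such that for every $\tau>0$, every $\phi^\star$ with $\|\mathsf p(\frac\tau2)-p^{\star,\frac12}\|_{L^2}\le C_0\tau$, and every solution of the scheme, $$\max_{k\ge 0,\ t_{k+1}\le T}\ \bigl\|\nabla\bigl(\bar{\mathsf u}^{k+\frac12}-\bar u^{k+\frac12}\bigr)\bigr\|_{L^2}\le c\,\tau,\qquad \bar{\mathsf u}^{k+\frac12}=\tfrac12\bigl(\mathsf u(t_{k+1})+\mathsf u(t_k)\bigr),$$ and $\bar{\mathsf u}^{k+\frac12}-\bar u^{k+\frac12}\in H^1_0(\Omega)^d$; that is, $\|\bar{\mathsf u}_\tau-\bar u_\tau\|_{\ell^\infty(\mathbf H^1)}\le c\tau$. -/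

import Mathlib

open MeasureTheory Set
open scoped ContDiff

namespace DirSplit

noncomputable section

/-- The open unit cube `(0,1)^d`. -/
def cube (d : ℕ) : Set (Fin d → ℝ) := Set.pi univ fun _ => Ioo (0 : ℝ) 1

/-- `L²((0,1)^d)`; vector fields are `Fin d → L2 d`. -/
abbrev L2 (d : ℕ) := Lp ℝ 2 ((volume : Measure (Fin d → ℝ)).restrict (cube d))

/-- Classical partial derivative in the direction `i`. -/
def pd {d : ℕ} (i : Fin d) (φ : (Fin d → ℝ) → ℝ) : (Fin d → ℝ) → ℝ :=
  fun x => fderiv ℝ φ x (Pi.single i 1)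

/-- Iterated partial derivative along a list of directions. -/
def pds {d : ℕ} (l : List (Fin d)) (φ : (Fin d → ℝ) → ℝ) : (Fin d → ℝ) → ℝ :=
  l.foldr pd φ

/-- Test functions: `C^∞`, with compact support contained in the open cube. -/
def IsTest {d : ℕ} (φ : (Fin d → ℝ) → ℝ) : Prop :=
  ContDiff ℝ ∞ φ ∧ HasCompactSupport φ ∧ tsupport φ ⊆ cube d

/-- `g` is the weak derivative of `v` along the list `l` (e.g. `[0, 0]` for `∂_{xx}`). -/
def HasWeakDeriv {d : ℕ} (l : List (Fin d)) (v g : L2 d) : Prop :=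
  ∀ φ : (Fin d → ℝ) → ℝ, IsTest φ →
    ∫ x in cube d, v x * pds l φ x = (-1) ^ l.length * ∫ x in cube d, g x * φ x

/-- `g` is the weak derivative `∂_i v`, and `v` has zero trace on the two faces
`x_i = 0` and `x_i = 1`: Green's formula has no boundary term for any function `φ` that is
smooth up to the boundary of the cube. -/
def HasDerivZeroTrace {d : ℕ} (i : Fin d) (v g : L2 d) : Prop :=
  ∀ φ : (Fin d → ℝ) → ℝ, ContDiff ℝ ∞ φ → HasCompactSupport φ →
    ∫ x in cube d, v x * pd i φ x = - ∫ x in cube d, g x * φ x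

/-- `v|_{x_i = 0, 1} = 0`. -/
def ZeroOnFaces {d : ℕ} (i : Fin d) (v : L2 d) : Prop :=
  ∃ g, HasDerivZeroTrace i v g

/-- `v ∈ H¹₀`: weak gradient in `L²` and zero trace on the whole boundary. -/
def MemH10 {d : ℕ} (v : L2 d) : Prop := ∀ i, ZeroOnFaces i v

/-- `D = div v` in the weak sense. -/
def HasWeakDiv {d : ℕ} (v : Fin d → L2 d) (D : L2 d) : Prop :=
  ∀ φ : (Fin d → ℝ) → ℝ, IsTest φ →
    ∑ i, ∫ x in cube d, v i x * pd i φ x = - ∫ x in cube d, D x * φ x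

/-- `w = Δ v`, the sum of the weak derivatives `∂_{ii} v ∈ L²`. -/
def HasLaplacian {d : ℕ} (v w : L2 d) : Prop :=
  ∃ h : Fin d → L2 d, (∀ i, HasWeakDeriv [i, i] v (h i)) ∧ w = ∑ i, h i

/-! ### Function spaces in time -/

/-- `w ∈ W^{m,∞}((0,T); L²)`; for `m ≥ 1`, `w` is the representative that is the primitive of
its derivative at every point of `[0,T]`. -/
def TimeSobolev {d : ℕ} (T : ℝ) : ℕ → (ℝ → L2 d) → Prop
  | 0, w => MemLp w ⊤ (volume.restrict (Ioo 0 T))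
  | m + 1, w => ∃ w' : ℝ → L2 d, TimeSobolev T m w' ∧
      ∀ t ∈ Icc 0 T, w t = w 0 + ∫ s in (0 : ℝ)..t, w' s

/-- For every `l ∈ S`, the weak derivative of `v` along `l` exists in `L²` on `[0,T]` and belongs
to `W^{m,∞}((0,T); L²)`. -/
def TimeSobolevDerivs {d : ℕ} (T : ℝ) (m : ℕ) (S : Set (List (Fin d))) (v : ℝ → L2 d) : Prop :=
  ∀ l ∈ S, ∃ g : ℝ → L2 d,
    (∀ t ∈ Icc 0 T, HasWeakDeriv l (v t) (g t)) ∧ TimeSobolev T m g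

/-- `v ∈ W^{m,∞}((0,T); H²)`. -/
def TimeH2 {d : ℕ} (T : ℝ) (m : ℕ) (v : ℝ → L2 d) : Prop :=
  TimeSobolevDerivs T m {l | l.length ≤ 2} v

/-- `q ∈ W^{m,∞}((0,T); Y)`, where `Y` is the space of the zero-mean functions in `H¹` all of whose
mixed derivatives in pairwise distinct directions (`∂_{xy}` in 2D; `∂_{xy}`, `∂_{yz}`, `∂_{zx}`,
`∂_{xyz}` in 3D) are in `L²`. -/
def TimeY {d : ℕ} (T : ℝ) (m : ℕ) (q : ℝ → L2 d) : Prop :=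
  TimeSobolevDerivs T m {l | l.Nodup} q ∧ ∀ t ∈ Icc 0 T, ∫ x in cube d, q t x = 0

/-- The direction splitting velocity operator on smooth functions:
`∂_{xxyy}` in 2D and `∂_{xxyy} + ∂_{yyzz} + ∂_{zzxx} - (τ/2) ∂_{xxyyzz}` in 3D. -/
def splitB : (d : ℕ) → ℝ → ((Fin d → ℝ) → ℝ) → (Fin d → ℝ) → ℝ
  | 2, _, φ => pds [0, 0, 1, 1] φ
  | 3, τ, φ => fun x =>
      pds [0, 0, 1, 1] φ x + pds [1, 1, 2, 2] φ x + pds [2, 2, 0, 0] φ x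
        - τ / 2 * pds [0, 0, 1, 1, 2, 2] φ x
  | _, _, _ => 0

/-- `v ∈ D(B)` and `w = B v`: `v ∈ H¹₀` and `B v = w ∈ L²` in the sense of distributions (all
derivatives in `B` have even order, so `B` is formally symmetric). -/
def HasB {d : ℕ} (τ : ℝ) (v w : L2 d) : Prop :=
  MemH10 v ∧ ∀ φ : (Fin d → ℝ) → ℝ, IsTest φ →
    ∫ x in cube d, v x * splitB d τ φ x = ∫ x in cube d, w x * φ x

/-- `v ∈ W^{m,∞}((0,T); D(B))`, `D(B)` with the graph norm. -/
def TimeDB {d : ℕ} (T : ℝ) (m : ℕ) (τ : ℝ) (v : ℝ → L2 d) : Prop :=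
  TimeSobolev T m v ∧
    ∃ w : ℝ → L2 d, (∀ t ∈ Icc 0 T, HasB τ (v t) (w t)) ∧ TimeSobolev T m w

/-! ### The Stokes problem -/

/-- `(u, p)` solves the time-dependent Stokes problem on `[0,T]` with source `f` (and initial
velocity `u 0`). -/
structure IsStokesSolution {d : ℕ} (T : ℝ) (f u : ℝ → Fin d → L2 d) (p : ℝ → L2 d) : Prop where
  momentum : ∀ t ∈ Ioc 0 T, ∀ j, ∃ lap grad : L2 d,
    HasLaplacian (u t j) lap ∧ HasWeakDeriv [j] (p t) grad ∧
      HasDerivWithinAt (fun s => u s j) (f t j + lap - grad) (Icc 0 T) t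
  incompressible : ∀ t ∈ Icc 0 T, HasWeakDiv (u t) 0
  boundary : ∀ t ∈ Ioc 0 T, ∀ j, MemH10 (u t j)

/-! ### The scheme -/

/-- `h = ∂_{ii} ψ` with the Neumann condition `∂_i ψ|_{x_i = 0, 1} = 0`. -/
def HasNeumannD2 {d : ℕ} (i : Fin d) (ψ h : L2 d) : Prop :=
  ∃ r, HasWeakDeriv [i] ψ r ∧ HasDerivZeroTrace i r h

/-- `q ∈ D(A)` and `A q = g`, with `A = (1 - ∂_{xx})(1 - ∂_{yy})` in 2D and
`A = (1 - ∂_{xx})(1 - ∂_{yy})(1 - ∂_{zz})` in 3D. The factors are applied from the last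
direction to the first, each with its Neumann condition; `ψ` lists the intermediate functions. -/
def HasA {d : ℕ} (q g : L2 d) : Prop :=
  ∫ x in cube d, q x = 0 ∧
    ∃ ψ : Fin (d + 1) → L2 d, ψ (Fin.last d) = q ∧ ψ 0 = g ∧
      ∀ i : Fin d, ∃ h, HasNeumannD2 i (ψ i.succ) h ∧ ψ i.castSucc = ψ i.succ - h

/-- One velocity update `u ↦ u'` with predicted pressure `ps` and source value `F`.
In 2D: the Peaceman-Rachford splitting with the half-step velocity `uh`.
In 3D: the Douglas splitting with intermediate fields `ξ`, `η`, `ζ`; here `ξ` is given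
explicitly by its equation, so that no boundary condition is imposed on it. -/
def VelocityUpdate : (d : ℕ) → ℝ → (Fin d → L2 d) → L2 d → (Fin d → L2 d) → (Fin d → L2 d) → Prop
  | 2, τ, F, ps, u, u' =>
      ∃ uh : Fin 2 → L2 2, ∀ j, ∃ uhxx uyy uyy' grad : L2 2,
        HasWeakDeriv [0, 0] (uh j) uhxx ∧ HasWeakDeriv [1, 1] (u j) uyy ∧
        HasWeakDeriv [1, 1] (u' j) uyy' ∧ HasWeakDeriv [j] ps grad ∧
        ZeroOnFaces 0 (uh j) ∧ ZeroOnFaces 1 (u' j) ∧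
        (τ / 2)⁻¹ • (uh j - u j) - uhxx - uyy + grad = F j ∧
        (τ / 2)⁻¹ • (u' j - uh j) - uhxx - uyy' + grad = F j
  | 3, τ, F, ps, u, u' =>
      ∃ ξ η ζ : Fin 3 → L2 3, ∀ j, ∃ lap grad a b c : L2 3,
        HasLaplacian (u j) lap ∧ HasWeakDeriv [j] ps grad ∧
        HasWeakDeriv [0, 0] (η j - u j) a ∧ HasWeakDeriv [1, 1] (ζ j - u j) b ∧
        HasWeakDeriv [2, 2] (u' j - u j) c ∧
        ZeroOnFaces 0 (η j) ∧ ZeroOnFaces 1 (ζ j) ∧ ZeroOnFaces 2 (u' j) ∧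
        τ⁻¹ • (ξ j - u j) - lap + grad = F j ∧
        τ⁻¹ • (η j - ξ j) - (1 / 2 : ℝ) • a = 0 ∧
        τ⁻¹ • (ζ j - η j) - (1 / 2 : ℝ) • b = 0 ∧
        τ⁻¹ • (u' j - ζ j) - (1 / 2 : ℝ) • c = 0
  | _, _, _, _, _, _ => False

/-- The time average `(ψ^{k+1} + ψ^k)/2` of a sequence of vector fields. -/
def avg {d : ℕ} (ψ : ℕ → Fin d → L2 d) (k : ℕ) : Fin d → L2 d :=
  fun j => (1 / 2 : ℝ) • (ψ (k + 1) j + ψ k j)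

/-- The direction splitting scheme with time step `τ` and parameter `χ`, started from the velocity
`u₀`, the pressure `p₀` and the pressure correction `φs`, and run as long as `t_{k+1} ≤ T`.
`u k`, `p k`, `φ k` stand for `u^k`, `p^{k-1/2}`, `φ^{k-1/2}`. -/
structure IsScheme {d : ℕ} (T τ χ : ℝ) (f : ℝ → Fin d → L2 d) (u₀ : Fin d → L2 d) (p₀ φs : L2 d)
    (u : ℕ → Fin d → L2 d) (p φ : ℕ → L2 d) : Prop where
  init_u : u 0 = u₀
  init_p : p 0 = p₀
  init_φ : φ 0 = φs
  velocity : ∀ k : ℕ, (k + 1) * τ ≤ T →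
    VelocityUpdate d τ (f ((k + 1 / 2) * τ)) (p k + φ k) (u k) (u (k + 1))
  penalty : ∀ k : ℕ, (k + 1) * τ ≤ T →
    ∃ D, HasWeakDiv (u (k + 1)) D ∧ HasA (φ (k + 1)) (-(1 / τ) • D)
  pressure : ∀ k : ℕ, (k + 1) * τ ≤ T →
    ∃ D, HasWeakDiv (avg u k) D ∧ p (k + 1) = p k + φ (k + 1) - χ • D

/-- `v ∈ H¹₀` (componentwise) and `‖v‖_{H¹} = ‖∇v‖_{L²} ≤ C`. -/
def H10NormLE {d : ℕ} (v : Fin d → L2 d) (C : ℝ) : Prop :=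
  ∃ G : Fin d → Fin d → L2 d, (∀ i j, HasDerivZeroTrace i (v j) (G i j)) ∧
    Real.sqrt (∑ i, ∑ j, ‖G i j‖ ^ 2) ≤ C

end

end DirSplit

open DirSplit

/-! Each velocity step is a factorized perturbation of Crank-Nicolson. Eliminating the intermediate
fields leaves `τ⁻¹ ∏ᵢ (1 - τ/2 ∂ᵢᵢ)(u^{k+1} - u^k) - Δu^k + ∇p⋆ = f`. Expanding the product gives
the time difference, the averaged Laplacian and `τ/4 B (u^{k+1} - u^k)` with `B ≥ 0`. The boundary
conditions make this operator diagonal in products of sines and `A` diagonal in products of cosines,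
so all the analysis in space is done on Fourier coefficients.

Let `e` be the velocity error. The pressure error splits into `η - χ S`: `S` accumulates the
divergence of the averaged velocity errors, and `η` the increments `d` of the exact pressure minus
the corrections `φ`, which satisfy `A φ^{k+1} = τ⁻¹ div e^{k+1}`. Testing the momentum equation with
`2τ e^{k+1}` gives an energy inequality (`IsErrorSystem.levelEnergy_succ_le`). Two facts close it:
`‖div v‖ ≤ ‖∇v‖` with `χ ≤ 1` lets viscosity absorb the rotational term, and `A ≥ -Δ` lets the
velocity increments absorb the increments of `φ`.

With residuals `O(τ²)` and pressure increments `O(τ)`, the square root of the energy is `O(τ)`. The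
gradient carries a factor `τ` in the energy, so this alone loses half an order. But the time
increments of the errors solve the same system, with data that are essentially second differences,
and their energy norm is `O(τ²)` (`IsErrorSystem.levelNorm_increments_le`). A single momentum
equation tested with `(e^{k+1} + e^k)/2` then has `‖∇ē‖²` as its only term not already known to be
`O(τ²)` (`IsErrorSystem.sq_norm_grad_le`).

The initial pressure error is controlled in `L²` only, not in the form domain of `A`, so it cannot
be a part of `η`. By linearity it is carried by an auxiliary discrete solution with no other source.
The energy of that solution is created in the first step and never grows, which bounds its gradient
directly (`IsErrorSystem.norm_grad_le_of_initial`).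

What remains is consistency (`exists_truncation_bound`, `exists_pressure_lift`) and the check that
the errors live in the abstract spaces (`IsScheme.isStepRegular`, `IsScheme.h10NormLE`). -/

namespace DirSplit

open scoped InnerProductSpace

/-! ### Energy estimates for the abstract error equations -/

section Energy

variable {V H G K Q Y : Type*}
  [NormedAddCommGroup V] [InnerProductSpace ℝ V]
  [NormedAddCommGroup H] [InnerProductSpace ℝ H]
  [NormedAddCommGroup G] [InnerProductSpace ℝ G]
  [NormedAddCommGroup K] [InnerProductSpace ℝ K]
  [NormedAddCommGroup Q] [InnerProductSpace ℝ Q]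
  [NormedAddCommGroup Y] [InnerProductSpace ℝ Y]

/-- The operators of a splitting scheme: `ι` embeds the velocity space in `L²`, `D` is the
gradient, `β` the square root of the splitting operator, `dv` the divergence, and `j` embeds the
space of the pressure corrections in `L²`. -/
structure SplitForms (τ : ℝ) (ι : V →L[ℝ] H) (D : V →L[ℝ] G) (β : V →L[ℝ] K) (dv : V →L[ℝ] Q)
    (j : Y →L[ℝ] Q) : Prop where
  inner_eq : ∀ v w, ⟪v, w⟫_ℝ =
    τ⁻¹ * ⟪ι v, ι w⟫_ℝ + 1 / 2 * ⟪D v, D w⟫_ℝ + τ / 4 * ⟪β v, β w⟫_ℝ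
  div_le : ∀ v, ‖dv v‖ ≤ ‖D v‖
  pair_le : ∀ v ψ, ⟪dv v, j ψ⟫_ℝ ≤ ‖ι v‖ * ‖ψ‖

/-- The weak form of the error equations of the splitting scheme, up to the time level `N`. -/
structure IsErrorSystem (τ χ : ℝ) (ι : V →L[ℝ] H) (D : V →L[ℝ] G) (β : V →L[ℝ] K)
    (dv : V →L[ℝ] Q) (j : Y →L[ℝ] Q) (N : ℕ) (e : ℕ → V) (φ η d : ℕ → Y) (S Z : ℕ → Q)
    (R : ℕ → H) : Prop where
  e_zero : e 0 = 0
  φ_zero : φ 0 = 0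
  η_zero : η 0 = 0
  S_zero : S 0 = 0
  η_succ : ∀ k < N, η (k + 1) = η k + d (k + 1) - φ (k + 1)
  S_succ : ∀ k < N, S (k + 1) = S k + (1 / 2 : ℝ) • dv (e (k + 1) + e k)
  momentum : ∀ k < N, ∀ w, τ⁻¹ * ⟪ι (e (k + 1) - e k), ι w⟫_ℝ
    + 1 / 2 * ⟪D (e (k + 1) + e k), D w⟫_ℝ + τ / 4 * ⟪β (e (k + 1) - e k), β w⟫_ℝ
    - ⟪j (η k - φ k) - χ • S k + Z k, dv w⟫_ℝ = ⟪R k, ι w⟫_ℝ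
  penalty : ∀ k < N, ∀ ψ, ⟪dv (e (k + 1)), j ψ⟫_ℝ = τ * ⟪φ (k + 1), ψ⟫_ℝ

variable {τ χ : ℝ} {ι : V →L[ℝ] H} {D : V →L[ℝ] G} {β : V →L[ℝ] K} {dv : V →L[ℝ] Q}
  {j : Y →L[ℝ] Q} {N : ℕ} {e : ℕ → V} {φ η d : ℕ → Y} {S Z : ℕ → Q} {R : ℕ → H}

/-- The energy of one time level. -/
noncomputable def levelEnergy (τ χ : ℝ) (ι : V →L[ℝ] H) (D : V →L[ℝ] G) (β : V →L[ℝ] K) (dv : V →L[ℝ] Q)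
    (e : V) (η : Y) (S : Q) : ℝ :=
  ‖ι e‖ ^ 2 + τ / 2 * (‖D e‖ ^ 2 - χ * ‖dv e‖ ^ 2) + τ * χ * ‖S + (1 / 2 : ℝ) • dv e‖ ^ 2
    + τ ^ 2 / 4 * ‖β e‖ ^ 2 + τ ^ 2 * ‖η‖ ^ 2

theorem SplitForms.mul_div_sq_le (h : SplitForms τ ι D β dv j) (hχ' : χ ≤ 1) (v : V) :
    χ * ‖dv v‖ ^ 2 ≤ ‖D v‖ ^ 2 := by
  have h1 := h.div_le v
  have h2 : ‖dv v‖ ^ 2 ≤ ‖D v‖ ^ 2 := by gcongr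
  nlinarith [sq_nonneg ‖dv v‖]

/-- The first step is covered because both `e` and `φ` start from zero. In the application the
prescribed `φ⋆` is therefore not `φ 0` but a part of the initial perturbation `Z 0`. -/
theorem IsErrorSystem.penalty_sub (hs : IsErrorSystem τ χ ι D β dv j N e φ η d S Z R) {k : ℕ}
    (hk : k < N) (ψ : Y) :
    ⟪dv (e (k + 1) - e k), j ψ⟫_ℝ = τ * ⟪φ (k + 1) - φ k, ψ⟫_ℝ := by
  have h1 := hs.penalty k hk ψ
  rcases k with _ | k
  · simpa [hs.e_zero, hs.φ_zero] using h1
  · have h2 := hs.penalty k (by omega) ψ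
    rw [map_sub, inner_sub_left, inner_sub_left, h1, h2]; ring

/-- Test the differenced divergence equation with `φ^{k+1} - φ^k` itself and use `pair_le`. This is
how the extrapolated pressure is paid for by the increment `‖ι (e^{k+1} - e^k)‖²` of the implicit
time difference. -/
theorem IsErrorSystem.sq_penalty_le (h : SplitForms τ ι D β dv j)
    (hs : IsErrorSystem τ χ ι D β dv j N e φ η d S Z R) {k : ℕ} (hk : k < N) :
    τ ^ 2 * ‖φ (k + 1) - φ k‖ ^ 2 ≤ ‖ι (e (k + 1) - e k)‖ ^ 2 := by
  have h1 := hs.penalty_sub hk (φ (k + 1) - φ k)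
  have h2 := h.pair_le (e (k + 1) - e k) (φ (k + 1) - φ k)
  rw [h1, real_inner_self_eq_norm_sq] at h2
  set x := ‖φ (k + 1) - φ k‖
  set y := ‖ι (e (k + 1) - e k)‖
  have hx : 0 ≤ x := norm_nonneg _
  have hy : 0 ≤ y := norm_nonneg _
  rcases hx.eq_or_lt with h0 | h0
  · rw [← h0]; simp; positivity
  · have : τ * x ≤ y := by
      by_contra! hc
      nlinarith
    rcases le_or_gt 0 τ with ht | ht
    · nlinarith [mul_nonneg ht hx]
    · have h3 := hs.penalty_sub hk (-(φ (k + 1) - φ k))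
      have h4 := h.pair_le (e (k + 1) - e k) (-(φ (k + 1) - φ k))
      rw [h3, inner_neg_right, real_inner_self_eq_norm_sq, norm_neg] at h4
      have : -τ * x ≤ y := by
        by_contra! hc
        change τ * -(x ^ 2) ≤ y * x at h4
        nlinarith
      nlinarith [mul_nonneg (neg_nonneg.2 ht.le) hx]

/-- Test the momentum equation with `2τ e^{k+1}` and polarize every product. Writing `W = S + dv e /
2`, so that `W^{k+1} = W^k + dv e^{k+1}`, the term `2τχ ⟨S, dv e^{k+1}⟩` becomes the increment of
`τχ ‖W‖²` minus `τχ/2` times the increment of `‖dv e‖²`, minus `τχ/2 ‖dv (e^{k+1} + e^k)‖²`;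
viscosity pays for the last. The pressure term gives the increment of `τ² ‖η‖²` up to `-τ² ‖φ^{k+1}
- φ^k‖²`, which the time difference pays for. -/
theorem IsErrorSystem.levelEnergy_succ_le (hτ : 0 < τ) (hχ' : χ ≤ 1)
    (h : SplitForms τ ι D β dv j)
    (hs : IsErrorSystem τ χ ι D β dv j N e φ η d S Z R) {k : ℕ} (hk : k < N) :
    levelEnergy τ χ ι D β dv (e (k + 1)) (η (k + 1)) (S (k + 1))
      ≤ levelEnergy τ χ ι D β dv (e k) (η k) (S k) + 2 * τ * ⟪R k, ι (e (k + 1))⟫_ℝ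
        + 2 * τ ^ 2 * ⟪η (k + 1), d (k + 1)⟫_ℝ + 2 * τ * ⟪Z k, dv (e (k + 1))⟫_ℝ := by
  have hm := hs.momentum k hk (e (k + 1))
  have hp := hs.penalty k hk (η k - φ k)
  have hq := hs.sq_penalty_le h hk
  have hd := h.mul_div_sq_le hχ' (e (k + 1) + e k)
  have hφ := sq_nonneg ‖φ k‖
  have hb := sq_nonneg ‖β (e (k + 1) - e k)‖
  have hdd := sq_nonneg ‖d (k + 1)‖
  have hm' : 2 * ⟪ι (e (k + 1) - e k), ι (e (k + 1))⟫_ℝ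
      + τ * ⟪D (e (k + 1) + e k), D (e (k + 1))⟫_ℝ
      + τ ^ 2 / 2 * ⟪β (e (k + 1) - e k), β (e (k + 1))⟫_ℝ
      - 2 * τ * ⟪j (η k - φ k) - χ • S k + Z k, dv (e (k + 1))⟫_ℝ
      = 2 * τ * ⟪R k, ι (e (k + 1))⟫_ℝ := by
    rw [← hm]; field_simp; ring
  have hp' : 2 * τ * ⟪dv (e (k + 1)), j (η k - φ k)⟫_ℝ
      = 2 * τ ^ 2 * ⟪φ (k + 1), η k - φ k⟫_ℝ := by rw [hp]; ring
  have hd' : τ / 2 * (χ * ‖dv (e (k + 1) + e k)‖ ^ 2) ≤ τ / 2 * ‖D (e (k + 1) + e k)‖ ^ 2 := by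
    gcongr
  have hb' : 0 ≤ τ ^ 2 / 4 * ‖β (e (k + 1) - e k)‖ ^ 2 := by positivity
  have hφ' : 0 ≤ τ ^ 2 * ‖φ k‖ ^ 2 := by positivity
  have hdd' : 0 ≤ τ ^ 2 * ‖d (k + 1)‖ ^ 2 := by positivity
  clear hm hp hd hb hφ hdd
  unfold levelEnergy
  rw [hs.η_succ k hk, hs.S_succ k hk]
  clear hs h
  -- Once everything is expanded into scalar products of the values at levels `k` and `k + 1`, the
  -- claim is a linear combination of the tested equations and the collected inequalities.
  simp only [map_add, map_sub, ← real_inner_self_eq_norm_sq, inner_add_left, inner_sub_left,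
    inner_add_right, inner_sub_right, inner_smul_left, inner_smul_right, smul_add,
    RCLike.conj_to_real, real_inner_comm (ι (e k)) (ι (e (k + 1))),
    real_inner_comm (D (e k)) (D (e (k + 1))), real_inner_comm (β (e k)) (β (e (k + 1))),
    real_inner_comm (dv (e k)) (dv (e (k + 1))), real_inner_comm (dv (e k)) (S k),
    real_inner_comm (dv (e (k + 1))) (S k), real_inner_comm (φ k) (φ (k + 1)),
    real_inner_comm (η k) (φ (k + 1)), real_inner_comm (η k) (d (k + 1)),
    real_inner_comm (φ (k + 1)) (d (k + 1)), real_inner_comm (dv (e (k + 1))) (j (η k)),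
    real_inner_comm (dv (e (k + 1))) (j (φ k))] at *
  linarith

theorem le_add_of_sq_le {x y c : ℝ} (hy : 0 ≤ y) (hc : 0 ≤ c)
    (h : x ^ 2 ≤ y ^ 2 + 2 * c * x) : x ≤ y + 2 * c := by
  by_contra! hlt
  nlinarith [mul_nonneg hy hc]

section Bounds

variable {e' : V} {η' : Y} {S' : Q} (hτ : 0 < τ) (hχ : 0 < χ) (hχ' : χ ≤ 1)
  (h : SplitForms τ ι D β dv j)

/-- The square root of the energy of one time level. -/
noncomputable def levelNorm (τ χ : ℝ) (ι : V →L[ℝ] H) (D : V →L[ℝ] G) (β : V →L[ℝ] K)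
    (dv : V →L[ℝ] Q) (e : V) (η : Y) (S : Q) : ℝ :=
  √(levelEnergy τ χ ι D β dv e η S)

omit [InnerProductSpace ℝ Y] in
theorem levelNorm_nonneg : 0 ≤ levelNorm τ χ ι D β dv e' η' S' := Real.sqrt_nonneg _

include hτ hχ hχ' h

theorem levelEnergy_nonneg : 0 ≤ levelEnergy τ χ ι D β dv e' η' S' := by
  have := sub_nonneg.2 (h.mul_div_sq_le hχ' e')
  unfold levelEnergy
  positivity

theorem levelNorm_sq :
    levelNorm τ χ ι D β dv e' η' S' ^ 2 = levelEnergy τ χ ι D β dv e' η' S' :=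
  Real.sq_sqrt (levelEnergy_nonneg hτ hχ hχ' h)

theorem norm_le_levelNorm : ‖ι e'‖ ≤ levelNorm τ χ ι D β dv e' η' S' := by
  refine Real.le_sqrt_of_sq_le ?_
  have := sub_nonneg.2 (h.mul_div_sq_le hχ' e')
  have h1 : 0 ≤ τ / 2 * (‖D e'‖ ^ 2 - χ * ‖dv e'‖ ^ 2) := by positivity
  have h2 : 0 ≤ τ * χ * ‖S' + (1 / 2 : ℝ) • dv e'‖ ^ 2 := by positivity
  unfold levelEnergy
  nlinarith [mul_nonneg (sq_nonneg τ) (sq_nonneg ‖β e'‖), mul_nonneg (sq_nonneg τ) (sq_nonneg ‖η'‖)]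

theorem mul_norm_split_le_levelNorm :
    τ * ‖β e'‖ ≤ 2 * levelNorm τ χ ι D β dv e' η' S' := by
  have h0 : τ / 2 * ‖β e'‖ ≤ levelNorm τ χ ι D β dv e' η' S' := by
    refine Real.le_sqrt_of_sq_le ?_
    have := sub_nonneg.2 (h.mul_div_sq_le hχ' e')
    have h1 : 0 ≤ τ / 2 * (‖D e'‖ ^ 2 - χ * ‖dv e'‖ ^ 2) := by positivity
    have h2 : 0 ≤ τ * χ * ‖S' + (1 / 2 : ℝ) • dv e'‖ ^ 2 := by positivity
    unfold levelEnergy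
    nlinarith [sq_nonneg ‖ι e'‖, mul_nonneg (sq_nonneg τ) (sq_nonneg ‖η'‖)]
  linarith

theorem mul_norm_pressure_le_levelNorm :
    τ * ‖η'‖ ≤ levelNorm τ χ ι D β dv e' η' S' := by
  refine Real.le_sqrt_of_sq_le ?_
  have := sub_nonneg.2 (h.mul_div_sq_le hχ' e')
  have h1 : 0 ≤ τ / 2 * (‖D e'‖ ^ 2 - χ * ‖dv e'‖ ^ 2) := by positivity
  have h2 : 0 ≤ τ * χ * ‖S' + (1 / 2 : ℝ) • dv e'‖ ^ 2 := by positivity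
  unfold levelEnergy
  nlinarith [sq_nonneg ‖ι e'‖, mul_nonneg (sq_nonneg τ) (sq_nonneg ‖β e'‖)]

theorem mul_norm_div_le_levelNorm :
    √(τ * χ) * ‖S' + (1 / 2 : ℝ) • dv e'‖ ≤ levelNorm τ χ ι D β dv e' η' S' := by
  refine Real.le_sqrt_of_sq_le ?_
  have := sub_nonneg.2 (h.mul_div_sq_le hχ' e')
  have h1 : 0 ≤ τ / 2 * (‖D e'‖ ^ 2 - χ * ‖dv e'‖ ^ 2) := by positivity
  rw [mul_pow, Real.sq_sqrt (by positivity)]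
  unfold levelEnergy
  nlinarith [sq_nonneg ‖ι e'‖, mul_nonneg (sq_nonneg τ) (sq_nonneg ‖β e'‖),
    mul_nonneg (sq_nonneg τ) (sq_nonneg ‖η'‖)]

/-- The energy contains the gradient only with a factor `τ` and diminished by the divergence, so the
gradient is recovered after a separate bound for `dv`. -/
theorem mul_sq_grad_le_levelNorm :
    τ / 2 * ‖D e'‖ ^ 2 ≤ levelNorm τ χ ι D β dv e' η' S' ^ 2 + τ / 2 * (χ * ‖dv e'‖ ^ 2) := by
  rw [levelNorm_sq hτ hχ hχ' h]
  unfold levelEnergy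
  have h2 : 0 ≤ τ * χ * ‖S' + (1 / 2 : ℝ) • dv e'‖ ^ 2 := by positivity
  nlinarith [sq_nonneg ‖ι e'‖, mul_nonneg (sq_nonneg τ) (sq_nonneg ‖β e'‖),
    mul_nonneg (sq_nonneg τ) (sq_nonneg ‖η'‖)]

/-- The energy controls both `‖ι e‖` and `τ ‖η‖`, the quantities paired with the sources. Hence the
sources add up linearly in the square root of the energy, and no Gronwall factor appears. -/
theorem IsErrorSystem.levelNorm_succ_le
    (hs : IsErrorSystem τ χ ι D β dv j N e φ η d S Z R) {k : ℕ} (hk : k < N) (hZ : Z k = 0) :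
    levelNorm τ χ ι D β dv (e (k + 1)) (η (k + 1)) (S (k + 1))
      ≤ levelNorm τ χ ι D β dv (e k) (η k) (S k) + 2 * (τ * (‖R k‖ + ‖d (k + 1)‖)) := by
  refine le_add_of_sq_le levelNorm_nonneg (by positivity) ?_
  rw [levelNorm_sq hτ hχ hχ' h, levelNorm_sq hτ hχ hχ' h]
  refine (hs.levelEnergy_succ_le hτ hχ' h hk).trans ?_
  rw [hZ, inner_zero_left]
  have h1 := norm_le_levelNorm hτ hχ hχ' h (e' := e (k + 1)) (η' := η (k + 1)) (S' := S (k + 1))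
  have h2 := mul_norm_pressure_le_levelNorm hτ hχ hχ' h (e' := e (k + 1)) (η' := η (k + 1))
    (S' := S (k + 1))
  set L := levelNorm τ χ ι D β dv (e (k + 1)) (η (k + 1)) (S (k + 1))
  have h3 := real_inner_le_norm (R k) (ι (e (k + 1)))
  have h4 := real_inner_le_norm (η (k + 1)) (d (k + 1))
  have h5 : ‖R k‖ * ‖ι (e (k + 1))‖ ≤ ‖R k‖ * L := by gcongr
  have h6 : (τ * ‖η (k + 1)‖) * ‖d (k + 1)‖ ≤ L * ‖d (k + 1)‖ := by gcongr
  nlinarith [mul_le_mul_of_nonneg_left (h3.trans h5) hτ.le,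
    mul_le_mul_of_nonneg_left (mul_le_mul_of_nonneg_left h4 hτ.le) hτ.le,
    mul_le_mul_of_nonneg_left h6 hτ.le]

omit hτ hχ hχ' h in
theorem IsErrorSystem.levelNorm_zero
    (hs : IsErrorSystem τ χ ι D β dv j N e φ η d S Z R) :
    levelNorm τ χ ι D β dv (e 0) (η 0) (S 0) = 0 := by
  simp [levelNorm, levelEnergy, hs.e_zero, hs.η_zero, hs.S_zero]

theorem IsErrorSystem.levelNorm_le
    (hs : IsErrorSystem τ χ ι D β dv j N e φ η d S Z R) (hZ : ∀ k < N, Z k = 0) {k : ℕ}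
    (hk : k ≤ N) :
    levelNorm τ χ ι D β dv (e k) (η k) (S k)
      ≤ 2 * τ * ∑ i ∈ Finset.range k, (‖R i‖ + ‖d (i + 1)‖) := by
  induction k with
  | zero => simp [hs.levelNorm_zero]
  | succ k ih =>
    have h1 := hs.levelNorm_succ_le hτ hχ hχ' h (k := k) (by omega) (hZ k (by omega))
    have h2 := ih (by omega)
    rw [Finset.sum_range_succ]
    linarith

/-- The perturbation acts in the first step alone, where it is paired with `dv (e 1)`; the energy
bounds `√(τχ) ‖dv (e 1)‖`. Afterwards there is no source and the energy does not increase. -/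
theorem IsErrorSystem.levelNorm_le_of_initial
    (hs : IsErrorSystem τ χ ι D β dv j N e φ η 0 S Z 0) (hZ : ∀ k, Z (k + 1) = 0) {k : ℕ}
    (hk : k < N) :
    √(τ * χ) * levelNorm τ χ ι D β dv (e (k + 1)) (η (k + 1)) (S (k + 1)) ≤ 2 * τ * ‖Z 0‖ := by
  induction k with
  | zero =>
    have h1 := hs.levelEnergy_succ_le hτ hχ' h hk
    have h2 := mul_norm_div_le_levelNorm hτ hχ hχ' h (e' := e 1) (η' := η 1) (S' := S 1)
    -- Since `e 0 = 0`, the accumulated divergence at level one is exactly half of `dv (e 1)`.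
    have h3 : S 1 + (1 / 2 : ℝ) • dv (e 1) = dv (e 1) := by
      have := hs.S_succ 0 hk
      rw [hs.S_zero, hs.e_zero] at this
      simp only [zero_add, add_zero] at this
      rw [this, ← add_smul]; norm_num
    rw [h3] at h2
    rw [← levelNorm_sq hτ hχ hχ' h, ← levelNorm_sq hτ hχ hχ' h, hs.levelNorm_zero] at h1
    simp only [zero_add, Pi.zero_apply, inner_zero_left, inner_zero_right, mul_zero, add_zero,
      ne_eq, OfNat.ofNat_ne_zero, not_false_eq_true, zero_pow] at h1 h2 ⊢
    have h4 := real_inner_le_norm (Z 0) (dv (e 1))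
    set L := levelNorm τ χ ι D β dv (e 1) (η 1) (S 1)
    have hL : 0 ≤ L := levelNorm_nonneg
    have hr : 0 < √(τ * χ) := by positivity
    have h5 : √(τ * χ) * L ^ 2 ≤ 2 * τ * ‖Z 0‖ * L := by
      have : ‖Z 0‖ * (√(τ * χ) * ‖dv (e 1)‖) ≤ ‖Z 0‖ * L := by gcongr
      calc √(τ * χ) * L ^ 2 ≤ √(τ * χ) * (2 * τ * (‖Z 0‖ * ‖dv (e 1)‖)) := by
            gcongr; exact h1.trans (by gcongr)
        _ = 2 * τ * (‖Z 0‖ * (√(τ * χ) * ‖dv (e 1)‖)) := by ring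
        _ ≤ 2 * τ * (‖Z 0‖ * L) := by gcongr
        _ = _ := by ring
    rcases hL.eq_or_lt with h0 | h0
    · rw [← h0]; simp; positivity
    · by_contra! hc
      nlinarith
  | succ k ih =>
    have h1 := hs.levelNorm_succ_le hτ hχ hχ' h (k := k + 1) hk (hZ k)
    simp only [Pi.zero_apply, norm_zero, add_zero, mul_zero] at h1
    exact (mul_le_mul_of_nonneg_left h1 (Real.sqrt_nonneg _)).trans (ih (by omega))

-- The half-step shift turns the trapezoidal sums `S` into plain partial sums of divergences. So `dv
-- (e (k + 1))` is a difference of two consecutive quantities that the energy controls.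
omit hτ hχ hχ' h in
theorem IsErrorSystem.S_add_half_div
    (hs : IsErrorSystem τ χ ι D β dv j N e φ η d S Z R) {k : ℕ} (hk : k < N) :
    S (k + 1) + (1 / 2 : ℝ) • dv (e (k + 1))
      = S k + (1 / 2 : ℝ) • dv (e k) + dv (e (k + 1)) := by
  rw [hs.S_succ k hk, map_add]
  module

/-- Here the square of the energy norm is at most `4 (τ/χ) ‖Z 0‖²`, so its factor `τ` cancels the
one in front of the gradient and nothing is lost; the divergence is a difference of consecutive
partial sums. -/
theorem IsErrorSystem.norm_grad_le_of_initial
    (hs : IsErrorSystem τ χ ι D β dv j N e φ η 0 S Z 0) (hZ : ∀ k, Z (k + 1) = 0) {k : ℕ}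
    (hk : k ≤ N) : χ * ‖D (e k)‖ ≤ 5 * ‖Z 0‖ := by
  rcases k with _ | k
  · simp [hs.e_zero]
  have hr : 0 < √(τ * χ) := by positivity
  have hr2 : √(τ * χ) ^ 2 = τ * χ := Real.sq_sqrt (by positivity)
  have hW : ∀ k ≤ N, χ * ‖S k + (1 / 2 : ℝ) • dv (e k)‖ ≤ 2 * ‖Z 0‖ := by
    intro k hk
    rcases k with _ | k
    · simp [hs.e_zero, hs.S_zero]
    have h1 := hs.levelNorm_le_of_initial hτ hχ hχ' h hZ (k := k) (by omega)
    have h2 := mul_norm_div_le_levelNorm hτ hχ hχ' h (e' := e (k + 1)) (η' := η (k + 1))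
      (S' := S (k + 1))
    have h3 := (mul_le_mul_of_nonneg_left h2 hr.le).trans h1
    rw [← mul_assoc, ← sq, hr2] at h3
    nlinarith
  have hD : χ * ‖dv (e (k + 1))‖ ≤ 4 * ‖Z 0‖ := by
    have h1 := hW (k + 1) hk
    have h2 := hW k (by omega)
    have h3 : dv (e (k + 1)) = (S (k + 1) + (1 / 2 : ℝ) • dv (e (k + 1)))
        - (S k + (1 / 2 : ℝ) • dv (e k)) := by
      rw [hs.S_add_half_div (by omega)]; abel
    have h4 : ‖dv (e (k + 1))‖ ≤ ‖S (k + 1) + (1 / 2 : ℝ) • dv (e (k + 1))‖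
        + ‖S k + (1 / 2 : ℝ) • dv (e k)‖ := by
      conv_lhs => rw [h3]
      exact norm_sub_le _ _
    nlinarith [mul_le_mul_of_nonneg_left h4 hχ.le]
  have h1 := hs.levelNorm_le_of_initial hτ hχ hχ' h hZ (k := k) (by omega)
  have h2 := mul_sq_grad_le_levelNorm hτ hχ hχ' h (e' := e (k + 1)) (η' := η (k + 1))
      (S' := S (k + 1))
  set L := levelNorm τ χ ι D β dv (e (k + 1)) (η (k + 1)) (S (k + 1))
  have hL : 0 ≤ L := levelNorm_nonneg
  have h3 : τ * χ * L ^ 2 ≤ 4 * τ ^ 2 * ‖Z 0‖ ^ 2 := by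
    have : (√(τ * χ) * L) ^ 2 ≤ (2 * τ * ‖Z 0‖) ^ 2 := by gcongr
    rw [mul_pow, hr2] at this
    linarith
  have h4 : χ ^ 2 * ‖dv (e (k + 1))‖ ^ 2 ≤ 16 * ‖Z 0‖ ^ 2 := by
    have : (χ * ‖dv (e (k + 1))‖) ^ 2 ≤ (4 * ‖Z 0‖) ^ 2 := by gcongr
    linarith
  have h5 : χ * L ^ 2 ≤ 4 * τ * ‖Z 0‖ ^ 2 := by
    refine le_of_mul_le_mul_left ?_ hτ
    linarith
  -- The energy contributes `8χ` and the divergence `16χ`, and `24 ≤ 5²`.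
  have h6 : (χ * ‖D (e (k + 1))‖) ^ 2 ≤ (5 * ‖Z 0‖) ^ 2 := by
    have h7 := mul_le_mul_of_nonneg_left h2 (sq_nonneg χ)
    have h8 := mul_le_mul_of_nonneg_left h5 hχ.le
    have h9 := mul_le_mul_of_nonneg_left h4 hχ.le
    have h10 : χ * (τ * ‖Z 0‖ ^ 2) ≤ 1 * (τ * ‖Z 0‖ ^ 2) := by gcongr
    have h11 : χ * (‖Z 0‖ ^ 2) ≤ 1 * (‖Z 0‖ ^ 2) := by gcongr
    refine le_of_mul_le_mul_left ?_ hτ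
    nlinarith [mul_le_mul_of_nonneg_left h9 hτ.le, mul_le_mul_of_nonneg_left h11 hτ.le]
  exact abs_le_of_sq_le_sq' h6 (by positivity) |>.2

end Bounds

end Energy
end DirSplit

namespace DirSplit

open scoped InnerProductSpace

/-! ### Time increments of the errors and the gradient bound -/

section Increments

variable {V H G K Q Y : Type*}
  [NormedAddCommGroup V] [InnerProductSpace ℝ V] [NormedAddCommGroup H] [InnerProductSpace ℝ H]
  [NormedAddCommGroup G] [InnerProductSpace ℝ G] [NormedAddCommGroup K] [InnerProductSpace ℝ K]
  [NormedAddCommGroup Q] [InnerProductSpace ℝ Q] [NormedAddCommGroup Y] [InnerProductSpace ℝ Y]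
  {τ χ : ℝ} {ι : V →L[ℝ] H} {D : V →L[ℝ] G} {β : V →L[ℝ] K} {dv : V →L[ℝ] Q}
  {j : Y →L[ℝ] Q} {N : ℕ} {e e' : ℕ → V} {φ η d φ' η' d' : ℕ → Y} {S Z S' Z' : ℕ → Q}
  {R R' : ℕ → H}

/-- The backward increments of a sequence, starting with its first term. -/
def increments {M : Type*} [AddCommGroup M] (x : ℕ → M) : ℕ → M
  | 0 => x 0
  | k + 1 => x (k + 1) - x k

theorem IsErrorSystem.sub (hs : IsErrorSystem τ χ ι D β dv j N e φ η d S Z R)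
    (hs' : IsErrorSystem τ χ ι D β dv j N e' φ' η' d' S' Z' R') :
    IsErrorSystem τ χ ι D β dv j N (e - e') (φ - φ') (η - η') (d - d') (S - S') (Z - Z')
      (R - R') where
  e_zero := by simp [hs.e_zero, hs'.e_zero]
  φ_zero := by simp [hs.φ_zero, hs'.φ_zero]
  η_zero := by simp [hs.η_zero, hs'.η_zero]
  S_zero := by simp [hs.S_zero, hs'.S_zero]
  η_succ k hk := by
    simp only [Pi.sub_apply, hs.η_succ k hk, hs'.η_succ k hk]; abel
  S_succ k hk := by
    simp only [Pi.sub_apply, hs.S_succ k hk, hs'.S_succ k hk, map_add, map_sub]; module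
  momentum k hk w := by
    have h1 := hs.momentum k hk w
    have h2 := hs'.momentum k hk w
    simp only [Pi.sub_apply, map_add, map_sub, inner_add_left, inner_sub_left, inner_smul_left,
      RCLike.conj_to_real, smul_sub] at h1 h2 ⊢
    linarith
  penalty k hk ψ := by
    have h1 := hs.penalty k hk ψ
    have h2 := hs'.penalty k hk ψ
    simp only [Pi.sub_apply, map_sub, inner_sub_left] at h1 h2 ⊢
    linarith

/-- The system is linear with coefficients independent of the level. It starts from zero, so the
value before the first one may be taken as zero; `d 0 = 0` makes the first increment of `d` equal to
`d 1`. -/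
theorem IsErrorSystem.of_increments (hs : IsErrorSystem τ χ ι D β dv j N e φ η d S Z R)
    (hd : d 0 = 0) :
    IsErrorSystem τ χ ι D β dv j N (increments e) (increments φ) (increments η) (increments d)
      (increments S) (increments Z) (increments R) where
  e_zero := hs.e_zero
  φ_zero := hs.φ_zero
  η_zero := hs.η_zero
  S_zero := hs.S_zero
  η_succ k hk := by
    rcases k with _ | k
    · simp [increments, hs.η_succ 0 hk, hs.η_zero, hd, hs.φ_zero]
    · simp only [increments]
      rw [hs.η_succ (k + 1) hk, hs.η_succ k (by omega)]; abel
  S_succ k hk := by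
    rcases k with _ | k
    · simp [increments, hs.S_succ 0 hk, hs.S_zero, hs.e_zero]
    · simp only [increments]
      rw [hs.S_succ (k + 1) hk, hs.S_succ k (by omega)]
      simp only [map_add, map_sub]; module
  momentum k hk w := by
    rcases k with _ | k
    · simpa [increments, hs.S_zero, hs.e_zero, hs.η_zero, hs.φ_zero]
        using hs.momentum 0 hk w
    · have h1 := hs.momentum (k + 1) hk w
      have h2 := hs.momentum k (by omega) w
      simp only [increments, map_add, map_sub, inner_add_left, inner_sub_left,
        inner_smul_left, RCLike.conj_to_real, smul_sub] at h1 h2 ⊢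
      linarith
  penalty k hk ψ := hs.penalty_sub hk ψ

/-- The bilinear form of one implicit step is the inner product of `V`. Its Riesz representative is
written down with adjoints, so the solution is an explicit recursion and nothing has to be inverted.
-/
theorem exists_errorSystem [CompleteSpace V] [CompleteSpace H] [CompleteSpace G] [CompleteSpace K]
    [CompleteSpace Q] [CompleteSpace Y] (hτ : 0 < τ) (h : SplitForms τ ι D β dv j) (Z : ℕ → Q) :
    ∃ (e : ℕ → V) (φ η : ℕ → Y) (S : ℕ → Q),
      IsErrorSystem τ χ ι D β dv j N e φ η 0 S Z 0 := by
  let E : ℕ → V × Y × Y × Q → V := fun k s =>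
    τ⁻¹ • ι.adjoint (ι s.1) - (1 / 2 : ℝ) • D.adjoint (D s.1) + (τ / 4) • β.adjoint (β s.1)
      + dv.adjoint (j (s.2.2.1 - s.2.1) - χ • s.2.2.2 + Z k)
  let F : V → Y := fun v => τ⁻¹ • j.adjoint (dv v)
  let step : ℕ → V × Y × Y × Q → V × Y × Y × Q := fun k s =>
    (E k s, F (E k s), s.2.2.1 - F (E k s), s.2.2.2 + (1 / 2 : ℝ) • dv (E k s + s.1))
  let s : ℕ → V × Y × Y × Q := fun k => Nat.rec 0 step k
  refine ⟨fun k => (s k).1, fun k => (s k).2.1, fun k => (s k).2.2.1, fun k => (s k).2.2.2,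
    rfl, rfl, rfl, rfl, fun k _ => ?_, fun k _ => rfl, fun k _ w => ?_, fun k _ ψ => ?_⟩
  · change (s k).2.2.1 - F (E k (s k)) = (s k).2.2.1 + (0 : Y) - F (E k (s k))
    rw [add_zero]
  · change τ⁻¹ * ⟪ι (E k (s k) - (s k).1), ι w⟫_ℝ + 1 / 2 * ⟪D (E k (s k) + (s k).1), D w⟫_ℝ
      + τ / 4 * ⟪β (E k (s k) - (s k).1), β w⟫_ℝ
      - ⟪j ((s k).2.2.1 - (s k).2.1) - χ • (s k).2.2.2 + Z k, dv w⟫_ℝ = ⟪(0 : H), ι w⟫_ℝ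
    have h1 := h.inner_eq (E k (s k)) w
    have h2 : ⟪E k (s k), w⟫_ℝ = τ⁻¹ * ⟪ι (s k).1, ι w⟫_ℝ - 1 / 2 * ⟪D (s k).1, D w⟫_ℝ
        + τ / 4 * ⟪β (s k).1, β w⟫_ℝ
        + ⟪j ((s k).2.2.1 - (s k).2.1) - χ • (s k).2.2.2 + Z k, dv w⟫_ℝ := by
      simp only [E]
      rw [inner_add_left, inner_add_left, inner_sub_left, real_inner_smul_left,
        real_inner_smul_left, real_inner_smul_left, ContinuousLinearMap.adjoint_inner_left,
        ContinuousLinearMap.adjoint_inner_left, ContinuousLinearMap.adjoint_inner_left,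
        ContinuousLinearMap.adjoint_inner_left]
    generalize E k (s k) = b at h1 h2 ⊢
    rw [map_sub ι, map_add D, map_sub β, inner_sub_left (ι b), inner_add_left (D b),
      inner_sub_left (β b), inner_zero_left]
    linarith
  · change ⟪dv (E k (s k)), j ψ⟫_ℝ = τ * ⟪F (E k (s k)), ψ⟫_ℝ
    simp only [F]
    rw [real_inner_smul_left, ContinuousLinearMap.adjoint_inner_left, ← mul_assoc,
      mul_inv_cancel₀ hτ.ne', one_mul]

theorem norm_half_smul_add_le {F : Type*} [NormedAddCommGroup F] [NormedSpace ℝ F] {x y : F}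
    {C : ℝ} (hx : ‖x‖ ≤ C) (hy : ‖y‖ ≤ C) : ‖(1 / 2 : ℝ) • (x + y)‖ ≤ C := by
  rw [norm_smul]
  have := norm_add_le x y
  norm_num
  linarith

theorem sum_range_le_of_le {x : ℕ → ℝ} {C : ℝ} {k : ℕ} (h : ∀ i < k, x i ≤ C) :
    ∑ i ∈ Finset.range k, x i ≤ k * C := by
  simpa using Finset.sum_le_card_nsmul (Finset.range k) x C (by simpa using h)

/-- The constant in the error bound for consistent initial data. -/
def errorConst (T CR Cd : ℝ) : ℝ :=
  let K₁ := 2 * T * (CR * T + Cd)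
  let K₂ := 2 * (2 * T * CR + 3 * Cd + T * Cd)
  let K₃ := Cd + K₂
  2 * K₁ * K₂ + K₃ * (K₁ + K₃ * T) + (K₁ + K₂ * T) * K₂ + CR * K₁ * T

section

variable {T CR Cd : ℝ} (hτ : 0 < τ) (hχ : 0 < χ) (hχ' : χ ≤ 1) (h : SplitForms τ ι D β dv j)
  (hs : IsErrorSystem τ χ ι D β dv j N e φ η d S Z R) (hT : N * τ ≤ T)
  (hR : ∀ k < N, ‖R k‖ ≤ CR * τ ^ 2) (hd0 : d 0 = 0) (hd1 : ∀ k, ‖d k‖ ≤ Cd * τ)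
  (hd2 : ∀ k, ‖d (k + 3) - d (k + 2)‖ ≤ Cd * τ ^ 2) (hZ : ∀ k < N, Z k = 0)

include hτ hχ hχ' h hs hT hR hd1 hZ

theorem IsErrorSystem.levelNorm_le_of_bounds {k : ℕ} (hk : k ≤ N) (hN : 0 < N) :
    levelNorm τ χ ι D β dv (e k) (η k) (S k) ≤ 2 * T * (CR * T + Cd) * τ := by
  have h0 := hs.levelNorm_le hτ hχ hχ' h hZ hk
  have hN1 : (1 : ℝ) ≤ N := by exact_mod_cast hN
  have hτT : τ ≤ T := by nlinarith
  have hT0 : 0 ≤ T := hτ.le.trans hτT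
  have hCR : 0 ≤ CR := by
    have := (norm_nonneg _).trans (hR 0 hN)
    exact nonneg_of_mul_nonneg_left this (by positivity)
  have hCd : 0 ≤ Cd := nonneg_of_mul_nonneg_left ((norm_nonneg _).trans (hd1 0)) hτ
  have h1 := sum_range_le_of_le (k := k) (x := fun i => ‖R i‖ + ‖d (i + 1)‖)
    (C := CR * τ ^ 2 + Cd * τ) fun i hi => add_le_add (hR i (by omega)) (hd1 _)
  have h2 : (k : ℝ) * (CR * τ ^ 2 + Cd * τ) ≤ N * (CR * τ ^ 2 + Cd * τ) := by gcongr
  calc _ ≤ 2 * τ * (N * (CR * τ ^ 2 + Cd * τ)) :=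
        h0.trans (by gcongr; exact h1.trans h2)
    _ = 2 * (N * τ) * (CR * τ + Cd) * τ := by ring
    _ ≤ 2 * T * (CR * T + Cd) * τ := by gcongr

include hd0 hd2

/-- The residual is already `O(τ²)`, so the triangle inequality suffices for its increments. The
first two increments of `d` are only `O(τ)` and account for `3 Cd`; all later ones are `O(τ²)`. The
sum over at most `T / τ` levels is `O(τ)`, and the energy estimate supplies one more factor `τ`. -/
theorem IsErrorSystem.levelNorm_increments_le {k : ℕ} (hk : k ≤ N) (hN : 0 < N) :
    levelNorm τ χ ι D β dv (increments e k) (increments η k) (increments S k)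
      ≤ 2 * (2 * T * CR + 3 * Cd + T * Cd) * τ ^ 2 := by
  have hN1 : (1 : ℝ) ≤ N := by exact_mod_cast hN
  have hCR : 0 ≤ CR := by
    have := (norm_nonneg _).trans (hR 0 hN)
    exact nonneg_of_mul_nonneg_left this (by positivity)
  have hCd : 0 ≤ Cd := nonneg_of_mul_nonneg_left ((norm_nonneg _).trans (hd1 0)) hτ
  have hs' := hs.of_increments hd0
  have hZ' : ∀ k < N, increments Z k = 0 := by
    intro k hk
    rcases k with _ | k
    · exact hZ 0 hk
    · simp [increments, hZ (k + 1) hk, hZ k (by omega)]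
  have h0 := hs'.levelNorm_le hτ hχ hχ' h hZ' hk
  have hR' : ∀ i < k, ‖increments R i‖ ≤ 2 * CR * τ ^ 2 := by
    intro i hi
    rcases i with _ | i
    · have := hR 0 hN
      simp only [increments]
      nlinarith [mul_nonneg hCR (sq_nonneg τ)]
    · have h1 := hR i (by omega)
      have h2 := hR (i + 1) (by omega)
      exact (norm_sub_le _ _).trans (by linarith)
  have hd' : ∑ i ∈ Finset.range k, ‖increments d (i + 1)‖
      ≤ 3 * Cd * τ + k * (Cd * τ ^ 2) := by
    have h1 : ‖increments d 1‖ ≤ Cd * τ := by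
      simpa [increments, hd0] using hd1 1
    have h2 : ‖increments d 2‖ ≤ 2 * (Cd * τ) :=
      (norm_sub_le _ _).trans (by linarith [hd1 1, hd1 2])
    have h3 : ∀ k, ∑ i ∈ Finset.range (k + 2), ‖increments d (i + 1)‖
        ≤ 3 * Cd * τ + k * (Cd * τ ^ 2) := by
      intro k
      induction k with
      | zero => simp [Finset.sum_range_succ]; linarith
      | succ k ih =>
        rw [Finset.sum_range_succ]
        have := hd2 k
        push_cast
        simp only [increments] at *
        linarith
    have h4 := h3 k
    exact (Finset.sum_le_sum_of_subset_of_nonneg (Finset.range_mono (by omega))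
      fun _ _ _ => norm_nonneg _).trans h4
  have h1 := sum_range_le_of_le hR'
  have hk' : (k : ℝ) * τ ≤ T := le_trans (by gcongr) hT
  rw [Finset.sum_add_distrib] at h0
  calc _ ≤ 2 * τ * (k * (2 * CR * τ ^ 2) + (3 * Cd * τ + k * (Cd * τ ^ 2))) :=
        h0.trans (by gcongr)
    _ = 2 * (2 * (k * τ) * CR + 3 * Cd + (k * τ) * Cd) * τ ^ 2 := by ring
    _ ≤ _ := by gcongr

-- Test one momentum equation with the averaged error `v`. The constants are `K₁` for the energy
-- norm over `τ`, `K₂` for that of the increments over `τ²` and `K₃` for the corrections over `τ`.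
-- The summands of `errorConst` bound, in this order, the time difference together with the
-- splitting term, the pairing with `η - φ`, the rotational term and the residual.
set_option maxHeartbeats 1000000 in
theorem IsErrorSystem.sq_norm_grad_le {k : ℕ} (hk : k < N) :
    ‖D ((1 / 2 : ℝ) • (e (k + 1) + e k))‖ ^ 2 ≤ errorConst T CR Cd * τ ^ 2 := by
  have hN : 0 < N := by omega
  have hN1 : (1 : ℝ) ≤ N := by exact_mod_cast hN
  have hτT : τ ≤ T := by nlinarith
  have hT0 : 0 ≤ T := hτ.le.trans hτT
  have hCR : 0 ≤ CR := by
    have := (norm_nonneg _).trans (hR 0 hN)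
    exact nonneg_of_mul_nonneg_left this (by positivity)
  have hCd : 0 ≤ Cd := nonneg_of_mul_nonneg_left ((norm_nonneg _).trans (hd1 0)) hτ
  have hL := fun k (hk : k ≤ N) => hs.levelNorm_le_of_bounds hτ hχ hχ' h hT hR hd1 hZ hk hN
  have hI := fun k (hk : k ≤ N) => hs.levelNorm_increments_le hτ hχ hχ' h hT hR hd0 hd1 hd2 hZ hk hN
  unfold errorConst
  extract_lets K₁ K₂ K₃
  change ∀ k ≤ N, _ ≤ K₁ * τ at hL
  change ∀ k ≤ N, _ ≤ K₂ * τ ^ 2 at hI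
  have hK₁ : 0 ≤ K₁ := by positivity
  have hK₂ : 0 ≤ K₂ := by positivity
  have hK₃ : 0 ≤ K₃ := by positivity
  have hK₃' : K₃ = Cd + K₂ := rfl
  clear_value K₁ K₂ K₃
  have hr : 0 < √(τ * χ) := by positivity
  have hr2 : √(τ * χ) ^ 2 = τ * χ := Real.sq_sqrt (by positivity)
  have he : ∀ k ≤ N, ‖ι (e k)‖ ≤ K₁ * τ := fun k hk =>
    (norm_le_levelNorm hτ hχ hχ' h).trans (hL k hk)
  have hβ : ∀ k ≤ N, ‖β (e k)‖ ≤ 2 * K₁ := fun k hk => by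
    have := (mul_norm_split_le_levelNorm hτ hχ hχ' h (η' := η k) (S' := S k)).trans
      (mul_le_mul_of_nonneg_left (hL k hk) zero_le_two)
    exact le_of_mul_le_mul_left (this.trans_eq (by ring)) hτ
  have hη : ∀ k ≤ N, ‖η k‖ ≤ K₁ := fun k hk => by
    have := (mul_norm_pressure_le_levelNorm hτ hχ hχ' h (e' := e k) (S' := S k)).trans (hL k hk)
    exact le_of_mul_le_mul_left (this.trans_eq (by ring)) hτ
  have hW : ∀ k ≤ N, √(τ * χ) * ‖S k + (1 / 2 : ℝ) • dv (e k)‖ ≤ K₁ * τ := fun k hk =>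
    (mul_norm_div_le_levelNorm hτ hχ hχ' h).trans (hL k hk)
  have hδe : ‖ι (e (k + 1) - e k)‖ ≤ K₂ * τ ^ 2 :=
    (norm_le_levelNorm hτ hχ hχ' h).trans (hI (k + 1) hk)
  have hδβ : ‖β (e (k + 1) - e k)‖ ≤ 2 * K₂ * τ := by
    have := (mul_norm_split_le_levelNorm hτ hχ hχ' h (e' := increments e (k + 1))
      (η' := increments η (k + 1)) (S' := increments S (k + 1))).trans
      (mul_le_mul_of_nonneg_left (hI (k + 1) hk) zero_le_two)
    exact le_of_mul_le_mul_left (this.trans_eq (by ring)) hτ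
  have hφ : ∀ k ≤ N, ‖φ k‖ ≤ K₃ * τ := fun k hk => by
    rcases k with _ | k
    · rw [hs.φ_zero, norm_zero]; positivity
    have h1 := (mul_norm_pressure_le_levelNorm hτ hχ hχ' h (e' := increments e (k + 1))
      (η' := increments η (k + 1)) (S' := increments S (k + 1))).trans (hI (k + 1) hk)
    have h2 : ‖increments η (k + 1)‖ ≤ K₂ * τ :=
      le_of_mul_le_mul_left (h1.trans_eq (by ring)) hτ
    have h3 : φ (k + 1) = d (k + 1) - increments η (k + 1) := by
      simp only [increments]; rw [hs.η_succ k hk]; abel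
    rw [h3]
    refine (norm_sub_le _ _).trans ((add_le_add (hd1 _) h2).trans_eq ?_)
    rw [hK₃']; ring
  have hD : ∀ k ≤ N, √(τ * χ) * ‖dv (e k)‖ ≤ K₂ * τ ^ 2 := fun k hk => by
    rcases k with _ | k
    · rw [hs.e_zero]; simp; positivity
    have h1 := (mul_norm_div_le_levelNorm hτ hχ hχ' h (e' := increments e (k + 1))
      (η' := increments η (k + 1)) (S' := increments S (k + 1))).trans (hI (k + 1) hk)
    -- In the energy of the increments, the shifted accumulated divergence is the divergence of the
    -- full error. This gives `√(τχ) ‖dv e‖ = O(τ²)` without a bound on the gradient.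
    have h2 : increments S (k + 1) + (1 / 2 : ℝ) • dv (increments e (k + 1)) = dv (e (k + 1)) := by
      change S (k + 1) - S k + (1 / 2 : ℝ) • dv (e (k + 1) - e k) = _
      rw [hs.S_succ k hk, map_add, map_sub]
      module
    rwa [h2] at h1
  set v := (1 / 2 : ℝ) • (e (k + 1) + e k) with hv
  have hιv : ‖ι v‖ ≤ K₁ * τ := by
    rw [hv, map_smul, map_add]; exact norm_half_smul_add_le (he _ hk) (he _ hk.le)
  have hβv : ‖β v‖ ≤ 2 * K₁ := by
    rw [hv, map_smul, map_add]; exact norm_half_smul_add_le (hβ _ hk) (hβ _ hk.le)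
  have hDv : √(τ * χ) * ‖dv v‖ ≤ K₂ * τ ^ 2 := by
    have := norm_half_smul_add_le (x := √(τ * χ) • dv (e (k + 1))) (y := √(τ * χ) • dv (e k))
      (C := K₂ * τ ^ 2) (by rw [norm_smul, Real.norm_of_nonneg hr.le]; exact hD _ hk)
      (by rw [norm_smul, Real.norm_of_nonneg hr.le]; exact hD _ hk.le)
    rw [← smul_add, smul_comm, ← map_add, ← map_smul, norm_smul, Real.norm_of_nonneg hr.le] at this
    exact this
  have hS : √(τ * χ) * ‖S k‖ ≤ (K₁ + K₂ * T) * τ := by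
    have h1 := hW k hk.le
    have h2 := hD k hk.le
    have h3 : ‖S k‖ ≤ ‖S k + (1 / 2 : ℝ) • dv (e k)‖ + ‖dv (e k)‖ := by
      have : S k = (S k + (1 / 2 : ℝ) • dv (e k)) - (1 / 2 : ℝ) • dv (e k) := by abel
      conv_lhs => rw [this]
      refine (norm_sub_le _ _).trans ?_
      rw [norm_smul]
      norm_num
      linarith [norm_nonneg (dv (e k))]
    have h4 : K₂ * τ ^ 2 ≤ K₂ * T * τ := by
      nlinarith [mul_le_mul_of_nonneg_left hτT (mul_nonneg hK₂ hτ.le)]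
    nlinarith [mul_le_mul_of_nonneg_left h3 hr.le]
  have hm := hs.momentum k hk v
  rw [hZ k hk, add_zero, inner_sub_left, real_inner_smul_left] at hm
  have hDD : 1 / 2 * ⟪D (e (k + 1) + e k), D v⟫_ℝ = ‖D v‖ ^ 2 := by
    rw [← real_inner_self_eq_norm_sq]
    nth_rw 2 [hv]
    rw [map_smul, real_inner_smul_left]
  have hpen : ⟪j (η k - φ k), dv v⟫_ℝ = τ / 2 * ⟪φ (k + 1) + φ k, η k - φ k⟫_ℝ := by
    have h1 := hs.penalty k hk (η k - φ k)
    have h2 := hs.penalty_sub hk (η k - φ k)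
    rw [real_inner_comm, hv, map_smul, real_inner_smul_left]
    simp only [map_add, map_sub, inner_add_left, inner_sub_left] at h1 h2 ⊢
    linarith
  have b1 : -(τ⁻¹ * ⟪ι (e (k + 1) - e k), ι v⟫_ℝ) ≤ K₁ * K₂ * τ ^ 2 := by
    have := (abs_le.1 (abs_real_inner_le_norm (ι (e (k + 1) - e k)) (ι v))).1
    have h2 : ‖ι (e (k + 1) - e k)‖ * ‖ι v‖ ≤ (K₂ * τ ^ 2) * (K₁ * τ) := by gcongr
    calc _ = τ⁻¹ * (-⟪ι (e (k + 1) - e k), ι v⟫_ℝ) := by ring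
      _ ≤ τ⁻¹ * ((K₂ * τ ^ 2) * (K₁ * τ)) := by gcongr; linarith
      _ = _ := by field_simp
  have b2 : -(τ / 4 * ⟪β (e (k + 1) - e k), β v⟫_ℝ) ≤ K₁ * K₂ * τ ^ 2 := by
    have := (abs_le.1 (abs_real_inner_le_norm (β (e (k + 1) - e k)) (β v))).1
    have h2 : ‖β (e (k + 1) - e k)‖ * ‖β v‖ ≤ (2 * K₂ * τ) * (2 * K₁) := by gcongr
    calc _ = τ / 4 * (-⟪β (e (k + 1) - e k), β v⟫_ℝ) := by ring
      _ ≤ τ / 4 * ((2 * K₂ * τ) * (2 * K₁)) := by gcongr; linarith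
      _ = _ := by ring
  have b3 : τ / 2 * ⟪φ (k + 1) + φ k, η k - φ k⟫_ℝ ≤ K₃ * (K₁ + K₃ * T) * τ ^ 2 := by
    have h1 := real_inner_le_norm (φ (k + 1) + φ k) (η k - φ k)
    have h2 : ‖φ (k + 1) + φ k‖ ≤ 2 * K₃ * τ :=
      (norm_add_le _ _).trans (by linarith [hφ _ hk, hφ _ hk.le])
    have h3 : ‖η k - φ k‖ ≤ K₁ + K₃ * T :=
      (norm_sub_le _ _).trans (add_le_add (hη _ hk.le) ((hφ _ hk.le).trans (by gcongr)))
    have h4 : ‖φ (k + 1) + φ k‖ * ‖η k - φ k‖ ≤ (2 * K₃ * τ) * (K₁ + K₃ * T) := by gcongr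
    calc _ ≤ τ / 2 * ((2 * K₃ * τ) * (K₁ + K₃ * T)) := by gcongr; exact h1.trans h4
      _ = _ := by ring
  -- For fixed `χ`, `S` is only `O(τ^{1/2})`, but `dv v` is `O(τ^{3/2})`; distributing `τχ` evenly
  -- over the two factors gives `τ²`.
  have b4 : -(χ * ⟪S k, dv v⟫_ℝ) ≤ (K₁ + K₂ * T) * K₂ * τ ^ 2 := by
    have h1 := (abs_le.1 (abs_real_inner_le_norm (S k) (dv v))).1
    have h2 : (√(τ * χ) * ‖S k‖) * (√(τ * χ) * ‖dv v‖)
        ≤ ((K₁ + K₂ * T) * τ) * (K₂ * τ ^ 2) := by gcongr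
    have h3 : τ * (χ * (‖S k‖ * ‖dv v‖)) ≤ τ * ((K₁ + K₂ * T) * K₂ * τ ^ 2) := by
      calc _ = (√(τ * χ) * ‖S k‖) * (√(τ * χ) * ‖dv v‖) := by
            rw [mul_mul_mul_comm, ← sq, hr2]; ring
        _ ≤ _ := h2
        _ = _ := by ring
    have h4 := le_of_mul_le_mul_left h3 hτ
    nlinarith
  have b5 : ⟪R k, ι v⟫_ℝ ≤ CR * K₁ * T * τ ^ 2 := by
    have h1 := real_inner_le_norm (R k) (ι v)
    have h2 : ‖R k‖ * ‖ι v‖ ≤ (CR * τ ^ 2) * (K₁ * T) := by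
      have := hR k hk
      have h3 : ‖ι v‖ ≤ K₁ * T := hιv.trans (by gcongr)
      gcongr
    linarith
  rw [hDD, hpen] at hm
  linarith

end

/-- A solution of the error system is the sum of one driven by the residuals and one driven by the
initial pressure error; the two obey different energy bounds. -/
theorem IsErrorSystem.norm_grad_le [CompleteSpace V] [CompleteSpace H] [CompleteSpace G]
    [CompleteSpace K] [CompleteSpace Q] [CompleteSpace Y] {T CR Cd C₀ : ℝ} (hτ : 0 < τ)
    (hχ : 0 < χ) (hχ' : χ ≤ 1) (h : SplitForms τ ι D β dv j)
    (hs : IsErrorSystem τ χ ι D β dv j N e φ η d S Z R) (hT : N * τ ≤ T)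
    (hR : ∀ k < N, ‖R k‖ ≤ CR * τ ^ 2) (hd0 : d 0 = 0) (hd1 : ∀ k, ‖d k‖ ≤ Cd * τ)
    (hd2 : ∀ k, ‖d (k + 3) - d (k + 2)‖ ≤ Cd * τ ^ 2) (hZ : ∀ k, Z (k + 1) = 0)
    (hZ0 : ‖Z 0‖ ≤ C₀ * τ) {k : ℕ} (hk : k < N) :
    ‖D ((1 / 2 : ℝ) • (e (k + 1) + e k))‖ ≤ (√(errorConst T CR Cd) + 5 * C₀ / χ) * τ := by
  obtain ⟨b, ψ, ζ, W, hb⟩ := exists_errorSystem (N := N) (χ := χ) hτ h Z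
  have hg := hs.sub hb
  simp only [sub_self, sub_zero] at hg
  have h1 := hg.sq_norm_grad_le hτ hχ hχ' h hT hR hd0 hd1 hd2 (fun _ _ => rfl) hk
  have h2 : ‖D ((1 / 2 : ℝ) • ((e - b) (k + 1) + (e - b) k))‖ ≤ √(errorConst T CR Cd) * τ := by
    have h3 := Real.le_sqrt_of_sq_le h1
    rwa [Real.sqrt_mul' _ (sq_nonneg τ), Real.sqrt_sq hτ.le] at h3
  have h3 : ∀ k ≤ N, ‖D (b k)‖ ≤ 5 * C₀ / χ * τ := fun k hk => by
    have h4 := (hb.norm_grad_le_of_initial hτ hχ hχ' h hZ hk).trans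
      (mul_le_mul_of_nonneg_left hZ0 (by norm_num : (0 : ℝ) ≤ 5))
    rw [div_mul_eq_mul_div, le_div_iff₀ hχ]
    linarith
  have h4 : D ((1 / 2 : ℝ) • (e (k + 1) + e k)) =
      D ((1 / 2 : ℝ) • ((e - b) (k + 1) + (e - b) k)) + (1 / 2 : ℝ) • (D (b (k + 1)) + D (b k)) := by
    simp only [Pi.sub_apply, map_smul, map_add, map_sub]
    module
  have h5 : ‖(1 / 2 : ℝ) • (D (b (k + 1)) + D (b k))‖ ≤ 5 * C₀ / χ * τ := by
    exact norm_half_smul_add_le (h3 _ hk) (h3 _ hk.le)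
  rw [h4, add_mul]
  exact (norm_add_le _ _).trans (add_le_add h2 h5)

end Increments
end DirSplit

namespace DirSplit

open Filter Topology

/-! ### Tensor products of functions of one variable -/

section Tensor

variable {d : ℕ}

/-- The tensor product `x ↦ ∏ i, f i (x i)` of functions of one variable. -/
def tensor (f : Fin d → ℝ → ℝ) : (Fin d → ℝ) → ℝ := fun x => ∏ i, f i (x i)

theorem contDiff_tensor {f : Fin d → ℝ → ℝ} (hf : ∀ i, ContDiff ℝ ∞ (f i)) :
    ContDiff ℝ ∞ (tensor f) :=
  contDiff_prod fun i _ => (hf i).comp (contDiff_apply ℝ ℝ i)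

theorem tensor_eq_mul (f : Fin d → ℝ → ℝ) (i : Fin d) (x : Fin d → ℝ) :
    tensor f x = f i (x i) * ∏ k ∈ Finset.univ.erase i, f k (x k) :=
  (Finset.mul_prod_erase _ _ (Finset.mem_univ i)).symm

theorem tensor_update_left (f : Fin d → ℝ → ℝ) (i : Fin d) (g : ℝ → ℝ) (x : Fin d → ℝ) :
    tensor (Function.update f i g) x = g (x i) * ∏ k ∈ Finset.univ.erase i, f k (x k) := by
  rw [tensor_eq_mul _ i, Function.update_self]
  congr 1
  exact Finset.prod_congr rfl fun k hk => by rw [Function.update_of_ne (Finset.ne_of_mem_erase hk)]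

theorem hasDerivAt_pd {φ : (Fin d → ℝ) → ℝ} (x : Fin d → ℝ) (hφ : DifferentiableAt ℝ φ x)
    (i : Fin d) : HasDerivAt (fun t => φ (Function.update x i t)) (pd i φ x) (x i) := by
  have h1 := hasDerivAt_update x i (x i)
  have h2 : HasFDerivAt φ (fderiv ℝ φ x) (Function.update x i (x i)) := by
    rw [Function.update_eq_self]; exact hφ.hasFDerivAt
  exact h2.comp_hasDerivAt (x i) h1

theorem pd_tensor {f : Fin d → ℝ → ℝ} (hf : ∀ i, ContDiff ℝ ∞ (f i)) (i : Fin d) :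
    pd i (tensor f) = tensor (Function.update f i (deriv (f i))) := by
  funext x
  have h1 := hasDerivAt_pd x ((contDiff_tensor hf).differentiable (by simp) x) i
  have h2 : (fun t => tensor f (Function.update x i t))
      = fun t => f i t * ∏ k ∈ Finset.univ.erase i, f k (x k) := by
    funext t
    rw [tensor_eq_mul _ i, Function.update_self]
    congr 1
    exact Finset.prod_congr rfl fun k hk => by
      rw [Function.update_of_ne (Finset.ne_of_mem_erase hk)]
  rw [h2] at h1
  have h3 := (((hf i).differentiable (by simp)) (x i)).hasDerivAt.mul_const
    (∏ k ∈ Finset.univ.erase i, f k (x k))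
  rw [h1.unique h3, tensor_update_left]

theorem pds_tensor {f : Fin d → ℝ → ℝ} (hf : ∀ i, ContDiff ℝ ∞ (f i)) (l : List (Fin d)) :
    pds l (tensor f) = tensor fun i => deriv^[l.count i] (f i) := by
  induction l with
  | nil => rfl
  | cons a l ih =>
    change pd a (pds l (tensor f)) = _
    rw [ih, pd_tensor fun i => (hf i).iterate_deriv _]
    congr 1
    funext i
    rcases eq_or_ne i a with rfl | h
    · rw [Function.update_self, List.count_cons_self, Function.iterate_succ_apply']
    · rw [Function.update_of_ne h, List.count_cons_of_ne (Ne.symm h)]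

/-- Smooth functions of one variable with compact support in `(0,1)`. -/
def IsTestOne (f : ℝ → ℝ) : Prop := ContDiff ℝ ∞ f ∧ tsupport f ⊆ Ioo 0 1

theorem tsupport_tensor_subset (f : Fin d → ℝ → ℝ) :
    tsupport (tensor f) ⊆ Set.pi univ fun i => tsupport (f i) := by
  refine closure_minimal ?_ (isClosed_set_pi fun i _ => isClosed_tsupport _)
  intro x hx i _
  refine subset_tsupport _ fun h0 => hx ?_
  rw [tensor_eq_mul f i, h0, zero_mul]

theorem isTest_tensor {f : Fin d → ℝ → ℝ} (hf : ∀ i, IsTestOne (f i)) : IsTest (tensor f) := by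
  have h1 := tsupport_tensor_subset f
  refine ⟨contDiff_tensor fun i => (hf i).1, ?_, h1.trans (Set.pi_mono fun i _ => (hf i).2)⟩
  refine IsCompact.of_isClosed_subset (isCompact_univ_pi fun i => ?_) (isClosed_tsupport _) h1
  exact isCompact_Icc.of_isClosed_subset (isClosed_tsupport _) ((hf i).2.trans Ioo_subset_Icc_self)

theorem measurableSet_cube : MeasurableSet (cube d) :=
  MeasurableSet.univ_pi fun _ => measurableSet_Ioo

theorem volume_restrict_cube :
    (volume : Measure (Fin d → ℝ)).restrict (cube d)
      = Measure.pi fun _ => (volume : Measure ℝ).restrict (Ioo 0 1) := by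
  rw [volume_pi, cube, Measure.restrict_pi_pi]

instance isFiniteMeasure_cube : IsFiniteMeasure ((volume : Measure (Fin d → ℝ)).restrict (cube d)) := by
  rw [volume_restrict_cube]; infer_instance

theorem L2.integrable (v : L2 d) : Integrable v (volume.restrict (cube d)) :=
  (Lp.memLp v).integrable (by norm_num)

theorem L2.integrable_mul_of_bound (v : L2 d) {g : (Fin d → ℝ) → ℝ} (hg : Continuous g) {C : ℝ}
    (hC : ∀ x ∈ cube d, |g x| ≤ C) : IntegrableOn (fun x => v x * g x) (cube d) := by
  refine (L2.integrable v).mul_bdd (c := C) hg.aestronglyMeasurable ?_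
  exact (ae_restrict_iff' measurableSet_cube).2 (ae_of_all _ hC)

theorem exists_bound_on_cube {g : (Fin d → ℝ) → ℝ} (hg : Continuous g) :
    ∃ C, ∀ x ∈ cube d, |g x| ≤ C := by
  obtain ⟨C, hC⟩ := (isCompact_univ_pi fun _ : Fin d => isCompact_Icc (a := (0 : ℝ)) (b := 1)).exists_bound_of_continuousOn
    hg.continuousOn
  exact ⟨C, fun x hx => hC x fun i hi => Ioo_subset_Icc_self (hx i hi)⟩

theorem L2.integrable_mul (v : L2 d) {g : (Fin d → ℝ) → ℝ} (hg : Continuous g) :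
    IntegrableOn (fun x => v x * g x) (cube d) := by
  obtain ⟨C, hC⟩ := exists_bound_on_cube hg
  exact L2.integrable_mul_of_bound v hg hC

theorem continuous_tensor {f : Fin d → ℝ → ℝ} (hf : ∀ i, Continuous (f i)) :
    Continuous (tensor f) :=
  continuous_finsetProd _ fun i _ => (hf i).comp (continuous_apply i)

/-- Dominated convergence for integrals against tensor products. -/
theorem L2.tendsto_integral_tensor (v : L2 d) {F : ℕ → Fin d → ℝ → ℝ} {f : Fin d → ℝ → ℝ}
    (hF : ∀ m i, Continuous (F m i)) (hb : ∀ i, ∃ C, ∀ m, ∀ x ∈ Ioo (0 : ℝ) 1, |F m i x| ≤ C)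
    (hl : ∀ i, ∀ x ∈ Ioo (0 : ℝ) 1, Tendsto (fun m => F m i x) atTop (𝓝 (f i x))) :
    Tendsto (fun m => ∫ x in cube d, v x * tensor (F m) x) atTop
      (𝓝 (∫ x in cube d, v x * tensor f x)) := by
  choose C hC using hb
  refine tendsto_integral_of_dominated_convergence (fun x => |v x| * ∏ i, C i) ?_ ?_ ?_ ?_
  · exact fun m => (L2.integrable v).aestronglyMeasurable.mul
      (continuous_tensor (hF m)).aestronglyMeasurable
  · exact (L2.integrable v).abs.mul_const _
  · refine fun m => (ae_restrict_iff' measurableSet_cube).2 (ae_of_all _ fun x hx => ?_)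
    rw [Real.norm_eq_abs, abs_mul]
    refine mul_le_mul_of_nonneg_left ?_ (abs_nonneg _)
    rw [tensor, Finset.abs_prod]
    exact Finset.prod_le_prod (fun _ _ => abs_nonneg _) fun i _ => hC i m _ (hx i trivial)
  · refine (ae_restrict_iff' measurableSet_cube).2 (ae_of_all _ fun x hx => ?_)
    exact (tendsto_finsetProd _ fun i _ => hl i _ (hx i trivial)).const_mul _

end Tensor

/-! ### Cutoffs near the ends of the unit interval -/

section Cutoff

/-- The derivative is supported in `[0,1]`. The weight `t + 1` becomes `(m + 1) x` at the argument
`t = (m + 1) x - 1` of the cutoff. -/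
theorem exists_bound_deriv_smoothTransition :
    ∃ B, 0 ≤ B ∧ ∀ t, |deriv Real.smoothTransition t| * |t + 1| ≤ B := by
  have hc : Continuous fun t => deriv Real.smoothTransition t * (t + 1) :=
    ((Real.smoothTransition.contDiff (n := ⊤)).continuous_deriv (by simp)).mul (by fun_prop)
  obtain ⟨B, hB⟩ := isCompact_Icc (a := (0 : ℝ)) (b := 1) |>.exists_bound_of_continuousOn
    hc.continuousOn
  refine ⟨|B|, abs_nonneg B, fun t => ?_⟩
  rw [← abs_mul]
  by_cases ht : t ∈ Icc (0 : ℝ) 1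
  · exact (hB t ht).trans (le_abs_self B)
  have h0 : deriv Real.smoothTransition t = 0 := by
    rw [mem_Icc, not_and_or, not_le, not_le] at ht
    rcases ht with ht | ht
    · have : Real.smoothTransition =ᶠ[𝓝 t] fun _ => 0 := by
        filter_upwards [Iio_mem_nhds ht] with x hx
        exact Real.smoothTransition.zero_of_nonpos (le_of_lt hx)
      rw [this.deriv_eq]; simp
    · have : Real.smoothTransition =ᶠ[𝓝 t] fun _ => 1 := by
        filter_upwards [Ioi_mem_nhds ht] with x hx
        exact Real.smoothTransition.one_of_one_le (le_of_lt hx)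
      rw [this.deriv_eq]; simp
  rw [h0]; simp

/-- A cutoff function that vanishes within distance `1/(m+1)` of `0` and of `1`. -/
noncomputable def cutoff (m : ℕ) (x : ℝ) : ℝ :=
  Real.smoothTransition ((m + 1) * x - 1) * Real.smoothTransition ((m + 1) * (1 - x) - 1)

theorem contDiff_cutoff (m : ℕ) : ContDiff ℝ ∞ (cutoff m) := by
  unfold cutoff
  exact (Real.smoothTransition.contDiff.comp (by fun_prop)).mul
    (Real.smoothTransition.contDiff.comp (by fun_prop))

theorem abs_cutoff_le (m : ℕ) (x : ℝ) : |cutoff m x| ≤ 1 := by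
  rw [cutoff, abs_mul, abs_of_nonneg (Real.smoothTransition.nonneg _),
    abs_of_nonneg (Real.smoothTransition.nonneg _)]
  exact mul_le_one₀ (Real.smoothTransition.le_one _) (Real.smoothTransition.nonneg _)
    (Real.smoothTransition.le_one _)

theorem tsupport_cutoff_subset (m : ℕ) : tsupport (cutoff m) ⊆ Ioo 0 1 := by
  have hm : (0 : ℝ) < m + 1 := by positivity
  have h1 : tsupport (cutoff m) ⊆ Icc (1 / (m + 1 : ℝ)) (1 - 1 / (m + 1 : ℝ)) := by
    refine closure_minimal (fun x hx => ?_) isClosed_Icc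
    rw [Function.mem_support, cutoff, mul_ne_zero_iff] at hx
    constructor
    · by_contra! hc
      refine hx.1 (Real.smoothTransition.zero_of_nonpos ?_)
      rw [lt_div_iff₀ hm] at hc
      linarith
    · by_contra! hc
      refine hx.2 (Real.smoothTransition.zero_of_nonpos ?_)
      have : 1 - x < 1 / (m + 1 : ℝ) := by linarith
      rw [lt_div_iff₀ hm] at this
      linarith
  have h2 : 0 < 1 / (m + 1 : ℝ) := by positivity
  exact h1.trans fun x hx => ⟨by linarith [hx.1], by linarith [hx.2]⟩

theorem cutoff_eventually_one {x : ℝ} (hx : x ∈ Ioo (0 : ℝ) 1) :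
    ∀ᶠ m : ℕ in atTop, cutoff m =ᶠ[𝓝 x] fun _ => 1 := by
  have h1 : Tendsto (fun m : ℕ => (m + 1 : ℝ)) atTop atTop :=
    tendsto_atTop_add_const_right _ _ tendsto_natCast_atTop_atTop
  filter_upwards [h1.eventually_gt_atTop (2 / x), h1.eventually_gt_atTop (2 / (1 - x))] with m h2 h3
  rw [div_lt_iff₀ hx.1] at h2
  rw [div_lt_iff₀ (by linarith [hx.2])] at h3
  have e1 : ∀ᶠ y in 𝓝 x, 2 < (m + 1 : ℝ) * y :=
    (continuous_const.mul continuous_id).continuousAt.eventually (lt_mem_nhds h2)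
  have e2 : ∀ᶠ y in 𝓝 x, 2 < (m + 1 : ℝ) * (1 - y) :=
    (by fun_prop : Continuous fun y : ℝ => (m + 1 : ℝ) * (1 - y)).continuousAt.eventually
      (lt_mem_nhds h3)
  filter_upwards [e1, e2] with y h4 h5
  rw [cutoff, Real.smoothTransition.one_of_one_le (by linarith),
    Real.smoothTransition.one_of_one_le (by linarith), one_mul]

/-- The derivative has size `m + 1` only at distance about `1/(m+1)` from an end, where `x (1 - x)`
is of the inverse size. -/
theorem exists_bound_deriv_cutoff :
    ∃ B, ∀ m, ∀ x ∈ Ioo (0 : ℝ) 1, |deriv (cutoff m) x| * (x * (1 - x)) ≤ B := by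
  obtain ⟨B, hB0, hB⟩ := exists_bound_deriv_smoothTransition
  refine ⟨2 * B, fun m x hx => ?_⟩
  have hm : (0 : ℝ) < m + 1 := by positivity
  have hS : Differentiable ℝ Real.smoothTransition :=
    (Real.smoothTransition.contDiff (n := ⊤)).differentiable (by simp)
  have d1 : HasDerivAt (fun x : ℝ => Real.smoothTransition ((m + 1) * x - 1))
      (deriv Real.smoothTransition ((m + 1) * x - 1) * (m + 1)) x := by
    refine (hS _).hasDerivAt.comp x ?_
    simpa using ((hasDerivAt_id x).const_mul (m + 1 : ℝ)).sub_const 1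
  have d2 : HasDerivAt (fun x : ℝ => Real.smoothTransition ((m + 1) * (1 - x) - 1))
      (deriv Real.smoothTransition ((m + 1) * (1 - x) - 1) * -(m + 1)) x := by
    refine (hS _).hasDerivAt.comp x ?_
    simpa using (((hasDerivAt_id x).const_sub 1).const_mul (m + 1 : ℝ)).sub_const 1
  have h3 : deriv (cutoff m) x = _ := (d1.mul d2).deriv
  rw [h3]
  have b1 := hB ((m + 1) * x - 1)
  have b2 := hB ((m + 1) * (1 - x) - 1)
  rw [sub_add_cancel, abs_of_pos (mul_pos hm hx.1)] at b1
  rw [sub_add_cancel, abs_of_pos (mul_pos hm (by linarith [hx.2]))] at b2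
  set p := deriv Real.smoothTransition ((m + 1) * x - 1)
  set q := deriv Real.smoothTransition ((m + 1) * (1 - x) - 1)
  set r := Real.smoothTransition ((m + 1) * x - 1)
  set s := Real.smoothTransition ((m + 1) * (1 - x) - 1)
  have hr : |r| ≤ 1 := by
    rw [abs_of_nonneg (Real.smoothTransition.nonneg _)]; exact Real.smoothTransition.le_one _
  have hs : |s| ≤ 1 := by
    rw [abs_of_nonneg (Real.smoothTransition.nonneg _)]; exact Real.smoothTransition.le_one _
  have h4 : |p * (m + 1) * s + r * (q * -(m + 1))| ≤ |p| * (m + 1) + |q| * (m + 1) := by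
    refine (abs_add_le _ _).trans (add_le_add ?_ ?_)
    · rw [abs_mul, abs_mul, abs_of_pos hm]
      exact mul_le_of_le_one_right (by positivity) hs
    · rw [abs_mul, abs_mul, abs_neg, abs_of_pos hm]
      exact mul_le_of_le_one_left (by positivity) hr
  have hx1 : 0 ≤ 1 - x := by linarith [hx.2]
  calc _ ≤ (|p| * (m + 1) + |q| * (m + 1)) * (x * (1 - x)) := by
        gcongr; exact mul_nonneg hx.1.le hx1
    _ = (|p| * ((m + 1) * x)) * (1 - x) + (|q| * ((m + 1) * (1 - x))) * x := by ring
    _ ≤ B * 1 + B * 1 := by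
        gcongr
        · linarith [hx.1]
        · exact hx.1.le
        · exact hx.2.le
    _ = 2 * B := by ring

theorem exists_abs_le_of_zero_boundary {f : ℝ → ℝ} (hf : ContDiff ℝ ∞ f) (h0 : f 0 = 0)
    (h1 : f 1 = 0) : ∃ L, ∀ x ∈ Ioo (0 : ℝ) 1, |f x| ≤ L * (x * (1 - x)) := by
  obtain ⟨L, hL⟩ := isCompact_Icc (a := (0 : ℝ)) (b := 1) |>.exists_bound_of_continuousOn
    (hf.continuous_deriv (by simp)).continuousOn
  have hd : ∀ x ∈ Icc (0 : ℝ) 1, DifferentiableAt ℝ f x := fun x _ => hf.differentiable (by simp) x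
  refine ⟨2 * L, fun x hx => ?_⟩
  have hx' := Ioo_subset_Icc_self hx
  have b0 := Convex.norm_image_sub_le_of_norm_deriv_le hd hL (convex_Icc _ _)
    (left_mem_Icc.2 zero_le_one) hx'
  have b1 := Convex.norm_image_sub_le_of_norm_deriv_le hd hL (convex_Icc _ _)
    (right_mem_Icc.2 zero_le_one) hx'
  rw [h0, sub_zero, sub_zero, Real.norm_eq_abs, Real.norm_eq_abs, abs_of_pos hx.1] at b0
  rw [h1, sub_zero, Real.norm_eq_abs, Real.norm_eq_abs,
    abs_sub_comm x 1, abs_of_pos (sub_pos.2 hx.2)] at b1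
  have hL0 : 0 ≤ L := (norm_nonneg _).trans (hL 0 (left_mem_Icc.2 zero_le_one))
  nlinarith [mul_le_mul_of_nonneg_right b0 (by linarith [hx.2] : 0 ≤ 1 - x),
    mul_le_mul_of_nonneg_right b1 hx.1.le]

theorem isTestOne_mul_cutoff {f : ℝ → ℝ} (hf : ContDiff ℝ ∞ f) (m : ℕ) :
    IsTestOne fun x => f x * cutoff m x :=
  ⟨hf.mul (contDiff_cutoff m), (closure_mono (Function.support_mul_subset_right _ _)).trans
    (tsupport_cutoff_subset m)⟩

theorem tendsto_mul_cutoff (f : ℝ → ℝ) {x : ℝ} (hx : x ∈ Ioo (0 : ℝ) 1) :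
    Tendsto (fun m => f x * cutoff m x) atTop (𝓝 (f x)) := by
  refine tendsto_const_nhds.congr' ?_
  filter_upwards [cutoff_eventually_one hx] with m hm
  rw [hm.self_of_nhds, mul_one]

theorem tendsto_deriv_mul_cutoff (f : ℝ → ℝ) {x : ℝ} (hx : x ∈ Ioo (0 : ℝ) 1) :
    Tendsto (fun m => deriv (fun x => f x * cutoff m x) x) atTop (𝓝 (deriv f x)) := by
  refine tendsto_const_nhds.congr' ?_
  filter_upwards [cutoff_eventually_one hx] with m hm
  refine Filter.EventuallyEq.deriv_eq ?_
  filter_upwards [hm] with y hy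
  rw [hy, mul_one]

theorem exists_bound_mul_cutoff {f : ℝ → ℝ} (hf : Continuous f) :
    ∃ C, ∀ m, ∀ x ∈ Ioo (0 : ℝ) 1, |f x * cutoff m x| ≤ C := by
  obtain ⟨C, hC⟩ := isCompact_Icc (a := (0 : ℝ)) (b := 1) |>.exists_bound_of_continuousOn
    hf.continuousOn
  refine ⟨C, fun m x hx => ?_⟩
  rw [abs_mul]
  exact (mul_le_of_le_one_right (abs_nonneg _) (abs_cutoff_le m x)).trans
    (hC x (Ioo_subset_Icc_self hx))

/-- A smooth function vanishing at both ends is `O(x (1 - x))`, which compensates the growth of one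
derivative of the cutoff. Dominated convergence thus applies to first derivatives; a second
derivative would not be bounded in general. -/
theorem exists_bound_deriv_mul_cutoff {f : ℝ → ℝ} (hf : ContDiff ℝ ∞ f) (h0 : f 0 = 0)
    (h1 : f 1 = 0) :
    ∃ C, ∀ m, ∀ x ∈ Ioo (0 : ℝ) 1, |deriv (fun x => f x * cutoff m x) x| ≤ C := by
  obtain ⟨C, hC⟩ := exists_bound_mul_cutoff (hf.continuous_deriv (by simp))
  obtain ⟨L, hL⟩ := exists_abs_le_of_zero_boundary hf h0 h1
  obtain ⟨B, hB⟩ := exists_bound_deriv_cutoff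
  refine ⟨C + |L| * B, fun m x hx => ?_⟩
  have hd := ((hf.differentiable (by simp) x).hasDerivAt.mul
    ((contDiff_cutoff m).differentiable (by simp) x).hasDerivAt).deriv
  have hd' : deriv (fun x => f x * cutoff m x) x
      = deriv f x * cutoff m x + f x * deriv (cutoff m) x := hd
  rw [hd']
  refine (abs_add_le _ _).trans (add_le_add (hC m x hx) ?_)
  rw [abs_mul]
  have hp : 0 ≤ x * (1 - x) := mul_nonneg hx.1.le (by linarith [hx.2])
  calc |f x| * |deriv (cutoff m) x| ≤ (|L| * (x * (1 - x))) * |deriv (cutoff m) x| := by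
        gcongr
        exact (hL x hx).trans (by gcongr; exact le_abs_self L)
    _ = |L| * (|deriv (cutoff m) x| * (x * (1 - x))) := by ring
    _ ≤ |L| * B := by gcongr; exact hB m x hx

end Cutoff

end DirSplit

namespace DirSplit

open Filter Topology

/-! ### Sines and cosines on the unit interval -/

section Trig

/-- `sin (n π x)` or `cos (n π x)`. -/
noncomputable def rawTrig (s : Bool) (n : ℕ) (x : ℝ) : ℝ :=
  if s then Real.sin (n * Real.pi * x) else Real.cos (n * Real.pi * x)

/-- The sine and cosine functions of frequency `n`, normalized in `L²(0,1)`. -/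
noncomputable def trig (s : Bool) (n : ℕ) (x : ℝ) : ℝ :=
  (if n = 0 then 1 else √2) * rawTrig s n x

theorem contDiff_rawTrig (s : Bool) (n : ℕ) : ContDiff ℝ ∞ (rawTrig s n) := by
  cases s
  · change ContDiff ℝ ∞ fun x => Real.cos (n * Real.pi * x)
    fun_prop
  · change ContDiff ℝ ∞ fun x => Real.sin (n * Real.pi * x)
    fun_prop

theorem contDiff_trig (s : Bool) (n : ℕ) : ContDiff ℝ ∞ (trig s n) :=
  contDiff_const.mul (contDiff_rawTrig s n)

theorem deriv_trig_true (n : ℕ) : deriv (trig true n) = fun x => n * Real.pi * trig false n x := by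
  funext x
  have h : HasDerivAt (fun x : ℝ => n * Real.pi * x) (n * Real.pi) x := by
    simpa using (hasDerivAt_id x).const_mul (n * Real.pi)
  have h1 := (h.sin.const_mul (if n = 0 then 1 else √2)).deriv
  have h2 : deriv (trig true n) x = _ := h1
  rw [h2]
  simp only [trig, rawTrig, Bool.false_eq_true, if_false]
  ring

theorem deriv_trig_false (n : ℕ) :
    deriv (trig false n) = fun x => -(n * Real.pi) * trig true n x := by
  funext x
  have h : HasDerivAt (fun x : ℝ => n * Real.pi * x) (n * Real.pi) x := by
    simpa using (hasDerivAt_id x).const_mul (n * Real.pi)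
  have h1 := (h.cos.const_mul (if n = 0 then 1 else √2)).deriv
  have h2 : deriv (trig false n) x = _ := h1
  rw [h2]
  simp only [trig, rawTrig, if_true]
  ring

theorem trig_true_zero (n : ℕ) : trig true n 0 = 0 := by simp [trig, rawTrig]

theorem trig_true_one (n : ℕ) : trig true n 1 = 0 := by
  simp [trig, rawTrig, Real.sin_nat_mul_pi]

theorem trig_true_freq_zero (x : ℝ) : trig true 0 x = 0 := by simp [trig, rawTrig]

theorem integral_cos_int (k : ℤ) :
    ∫ x in Ioo (0 : ℝ) 1, Real.cos (k * Real.pi * x) = if k = 0 then 1 else 0 := by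
  rw [← integral_Ioc_eq_integral_Ioo, ← intervalIntegral.integral_of_le zero_le_one]
  split_ifs with h
  · simp [h]
  · have hk : (k : ℝ) * Real.pi ≠ 0 := mul_ne_zero (by exact_mod_cast h) Real.pi_ne_zero
    rw [intervalIntegral.integral_comp_mul_left (fun x => Real.cos x) hk, integral_cos]
    simp [Real.sin_int_mul_pi]

theorem integrableOn_Ioo_of_continuous {g : ℝ → ℝ} (hg : Continuous g) :
    IntegrableOn g (Ioo (0 : ℝ) 1) :=
  (hg.continuousOn.integrableOn_Icc).mono_set Ioo_subset_Icc_self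

theorem integral_rawTrig_mul (s : Bool) (n m : ℕ) :
    ∫ x in Ioo (0 : ℝ) 1, rawTrig s n x * rawTrig s m x
      = ((if n = m then 1 else 0) + (if s then -1 else 1) * (if n = 0 ∧ m = 0 then 1 else 0)) / 2 := by
  have h : ∀ x, rawTrig s n x * rawTrig s m x =
      1 / 2 * Real.cos (((n : ℤ) - (m : ℤ) : ℤ) * Real.pi * x)
        + (if s then -1 else 1) * (1 / 2) * Real.cos (((n : ℤ) + (m : ℤ) : ℤ) * Real.pi * x) := by
    intro x
    have e1 : (((n : ℤ) - (m : ℤ) : ℤ) : ℝ) * Real.pi * x = n * Real.pi * x - m * Real.pi * x := by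
      push_cast; ring
    have e2 : (((n : ℤ) + (m : ℤ) : ℤ) : ℝ) * Real.pi * x = n * Real.pi * x + m * Real.pi * x := by
      push_cast; ring
    rw [e1, e2, Real.cos_sub, Real.cos_add]
    cases s <;> simp [rawTrig] <;> ring
  simp only [h]
  rw [integral_add, integral_const_mul, integral_const_mul, integral_cos_int, integral_cos_int]
  · have h1 : ((n : ℤ) - (m : ℤ) = 0) ↔ n = m := by omega
    have h2 : ((n : ℤ) + (m : ℤ) = 0) ↔ (n = 0 ∧ m = 0) := by omega
    simp only [h1, h2]
    ring
  · exact integrableOn_Ioo_of_continuous (by fun_prop)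
  · exact integrableOn_Ioo_of_continuous (by fun_prop)

theorem integral_trig_mul_of_ne (s : Bool) {n m : ℕ} (h : n ≠ m) :
    ∫ x in Ioo (0 : ℝ) 1, trig s n x * trig s m x = 0 := by
  have e : ∀ x, trig s n x * trig s m x = ((if n = 0 then 1 else √2) * (if m = 0 then 1 else √2))
      * (rawTrig s n x * rawTrig s m x) := fun x => by simp only [trig]; ring
  simp only [e]
  rw [integral_const_mul, integral_rawTrig_mul, if_neg h,
    if_neg (fun h' : n = 0 ∧ m = 0 => h (h'.1.trans h'.2.symm))]
  simp

theorem integral_trig_mul_self (s : Bool) {n : ℕ} (h : s = true → n ≠ 0) :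
    ∫ x in Ioo (0 : ℝ) 1, trig s n x * trig s n x = 1 := by
  have e : ∀ x, trig s n x * trig s n x = ((if n = 0 then 1 else √2) * (if n = 0 then 1 else √2))
      * (rawTrig s n x * rawTrig s n x) := fun x => by simp only [trig]; ring
  simp only [e]
  rw [integral_const_mul, integral_rawTrig_mul]
  by_cases hn : n = 0
  · cases s
    · simp [hn]
    · exact absurd hn (h rfl)
  · simp [hn]

theorem rawTrig_mem_span (s : Bool) (n : ℕ) :
    rawTrig s n ∈ Submodule.span ℝ (range (trig s)) := by
  have h : rawTrig s n = (if n = 0 then 1 else √2 : ℝ)⁻¹ • trig s n := by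
    funext x
    have : (if n = 0 then 1 else √2 : ℝ) ≠ 0 := by split_ifs <;> positivity
    simp only [Pi.smul_apply, smul_eq_mul, trig]
    rw [inv_mul_cancel_left₀ this]
  rw [h]
  exact Submodule.smul_mem _ _ (Submodule.subset_span ⟨n, rfl⟩)

theorem cos_mul_rawTrig_mem_span (s : Bool) (n : ℕ) :
    (fun x => Real.cos (Real.pi * x) * rawTrig s n x) ∈ Submodule.span ℝ (range (trig s)) := by
  rcases n with _ | n
  · cases s
    · convert rawTrig_mem_span false 1 using 1
      funext x
      simp [rawTrig]
    · convert Submodule.zero_mem _ using 1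
      funext x
      simp [rawTrig]
  · have h : (fun x => Real.cos (Real.pi * x) * rawTrig s (n + 1) x)
        = (1 / 2 : ℝ) • (rawTrig s (n + 2) + rawTrig s n) := by
      funext x
      have e1 : ((n + 2 : ℕ) : ℝ) * Real.pi * x = (n + 1 : ℕ) * Real.pi * x + Real.pi * x := by
        push_cast; ring
      have e2 : (n : ℝ) * Real.pi * x = (n + 1 : ℕ) * Real.pi * x - Real.pi * x := by
        push_cast; ring
      simp only [Pi.smul_apply, Pi.add_apply, smul_eq_mul, rawTrig]
      rw [e1, e2, Real.cos_add, Real.cos_sub, Real.sin_add, Real.sin_sub]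
      split_ifs <;> ring
    rw [h]
    exact Submodule.smul_mem _ _ (Submodule.add_mem _ (rawTrig_mem_span _ _) (rawTrig_mem_span _ _))

theorem cos_mul_mem_span (s : Bool) {g : ℝ → ℝ} (hg : g ∈ Submodule.span ℝ (range (trig s))) :
    (fun x => Real.cos (Real.pi * x) * g x) ∈ Submodule.span ℝ (range (trig s)) := by
  induction hg using Submodule.span_induction with
  | mem g hg =>
    obtain ⟨n, rfl⟩ := hg
    have : (fun x => Real.cos (Real.pi * x) * trig s n x) = (if n = 0 then 1 else √2 : ℝ) •
        fun x => Real.cos (Real.pi * x) * rawTrig s n x := by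
      funext x
      simp only [Pi.smul_apply, smul_eq_mul, trig]
      ring
    rw [this]
    exact Submodule.smul_mem _ _ (cos_mul_rawTrig_mem_span s n)
  | zero =>
    convert Submodule.zero_mem (Submodule.span ℝ (range (trig s))) using 1
    funext x
    simp
  | add f g _ _ hf hg =>
    convert Submodule.add_mem _ hf hg using 1
    funext x
    simp [mul_add]
  | smul a g _ hg =>
    convert Submodule.smul_mem _ a hg using 1
    funext x
    simp only [Pi.smul_apply, smul_eq_mul]
    ring

/-- The lowest sine function or the constant function. -/
noncomputable def baseTrig (s : Bool) (x : ℝ) : ℝ := if s then Real.sin (Real.pi * x) else 1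

/-- By the product formulas, multiplication by `cos (π x)` preserves the span of either system. The
span therefore contains the lowest function times every polynomial in `cos (π x)`, the form in which
Stone-Weierstrass is applied. -/
theorem baseTrig_mul_cos_pow_mem_span (s : Bool) (k : ℕ) :
    (fun x => baseTrig s x * Real.cos (Real.pi * x) ^ k) ∈ Submodule.span ℝ (range (trig s)) := by
  induction k with
  | zero =>
    cases s
    · convert rawTrig_mem_span false 0 using 1
      funext x
      simp [rawTrig, baseTrig]
    · convert rawTrig_mem_span true 1 using 1
      funext x
      simp [rawTrig, baseTrig]
  | succ k ih =>
    convert cos_mul_mem_span s ih using 1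
    funext x
    ring

theorem baseTrig_ne_zero (s : Bool) {x : ℝ} (hx : x ∈ Ioo (0 : ℝ) 1) : baseTrig s x ≠ 0 := by
  cases s
  · simp [baseTrig]
  · have h1 : 0 < Real.pi * x := mul_pos Real.pi_pos hx.1
    have h2 : Real.pi * x < Real.pi := by nlinarith [Real.pi_pos, hx.2]
    simpa [baseTrig] using (Real.sin_pos_of_pos_of_lt_pi h1 h2).ne'

end Trig

/-! ### Mixed sine-cosine Hilbert bases of the cube -/

section Coefficients

variable {d : ℕ}

/-- The product of one-dimensional sine (`σ i = true`) and cosine (`σ i = false`) functions. -/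
noncomputable def mode (σ : Fin d → Bool) (n : Fin d → ℕ) : (Fin d → ℝ) → ℝ :=
  tensor fun i => trig (σ i) (n i)

/-- The coefficient of `v` in the trigonometric system `σ`. -/
noncomputable def coef (σ : Fin d → Bool) (n : Fin d → ℕ) (v : L2 d) : ℝ :=
  ∫ x in cube d, v x * mode σ n x

theorem contDiff_mode (σ : Fin d → Bool) (n : Fin d → ℕ) : ContDiff ℝ ∞ (mode σ n) :=
  contDiff_tensor fun i => contDiff_trig (σ i) (n i)

theorem continuous_mode (σ : Fin d → Bool) (n : Fin d → ℕ) : Continuous (mode σ n) :=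
  (contDiff_mode σ n).continuous

theorem memLp_of_continuous {g : (Fin d → ℝ) → ℝ} (hg : Continuous g) :
    MemLp g 2 (volume.restrict (cube d)) := by
  obtain ⟨C, hC⟩ := exists_bound_on_cube hg
  exact MemLp.of_bound hg.aestronglyMeasurable C
    ((ae_restrict_iff' measurableSet_cube).2 (ae_of_all _ hC))

/-- A continuous function as an element of `L²((0,1)^d)`. -/
noncomputable def toL2 {g : (Fin d → ℝ) → ℝ} (hg : Continuous g) : L2 d :=
  (memLp_of_continuous hg).toLp g

theorem coeFn_toL2 {g : (Fin d → ℝ) → ℝ} (hg : Continuous g) :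
    toL2 hg =ᵐ[volume.restrict (cube d)] g := MemLp.coeFn_toLp _

theorem inner_eq_integral (v w : L2 d) : inner ℝ v w = ∫ x in cube d, v x * w x := by
  rw [MeasureTheory.L2.inner_def]
  simp [mul_comm]

theorem inner_toL2 (v : L2 d) {g : (Fin d → ℝ) → ℝ} (hg : Continuous g) :
    inner ℝ v (toL2 hg) = ∫ x in cube d, v x * g x := by
  rw [inner_eq_integral]
  refine integral_congr_ae ?_
  filter_upwards [coeFn_toL2 hg] with x hx
  rw [hx]

theorem inner_toL2_toL2 {g h : (Fin d → ℝ) → ℝ} (hg : Continuous g) (hh : Continuous h) :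
    inner ℝ (toL2 hg) (toL2 hh) = ∫ x in cube d, g x * h x := by
  rw [inner_toL2]
  refine integral_congr_ae ?_
  filter_upwards [coeFn_toL2 hg] with x hx
  rw [hx]

theorem coef_eq_inner (σ : Fin d → Bool) (n : Fin d → ℕ) (v : L2 d) :
    coef σ n v = inner ℝ v (toL2 (continuous_mode σ n)) := (inner_toL2 v _).symm

theorem coef_add (σ : Fin d → Bool) (n : Fin d → ℕ) (v w : L2 d) :
    coef σ n (v + w) = coef σ n v + coef σ n w := by
  simp only [coef_eq_inner, inner_add_left]

theorem coef_sub (σ : Fin d → Bool) (n : Fin d → ℕ) (v w : L2 d) :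
    coef σ n (v - w) = coef σ n v - coef σ n w := by
  simp only [coef_eq_inner, inner_sub_left]

theorem coef_smul (σ : Fin d → Bool) (n : Fin d → ℕ) (a : ℝ) (v : L2 d) :
    coef σ n (a • v) = a * coef σ n v := by
  simp only [coef_eq_inner, real_inner_smul_left]

theorem coef_zero (σ : Fin d → Bool) (n : Fin d → ℕ) : coef σ n (0 : L2 d) = 0 := by
  simp only [coef_eq_inner, inner_zero_left]

theorem coef_sum {ι : Type*} (σ : Fin d → Bool) (n : Fin d → ℕ) (s : Finset ι) (v : ι → L2 d) :
    coef σ n (∑ i ∈ s, v i) = ∑ i ∈ s, coef σ n (v i) := by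
  simp only [coef_eq_inner, sum_inner]

theorem mode_eq_zero {σ : Fin d → Bool} {n : Fin d → ℕ} {i : Fin d} (h : σ i = true)
    (hn : n i = 0) : mode σ n = 0 := by
  funext x
  rw [mode, tensor_eq_mul _ i, h, hn, trig_true_freq_zero, zero_mul, Pi.zero_apply]

/-- Allows sums over all multi-indices, whatever the system: the indices that carry no mode
contribute zero. -/
theorem coef_eq_zero {σ : Fin d → Bool} {n : Fin d → ℕ} {i : Fin d} (h : σ i = true)
    (hn : n i = 0) (v : L2 d) : coef σ n v = 0 := by
  rw [coef, mode_eq_zero h hn]; simp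

theorem integral_tensor_mul_tensor (f g : Fin d → ℝ → ℝ) :
    ∫ x in cube d, tensor f x * tensor g x = ∏ i, ∫ x in Ioo (0 : ℝ) 1, f i x * g i x := by
  rw [volume_restrict_cube, ← integral_fintype_prod_eq_prod]
  simp only [tensor, Finset.prod_mul_distrib]

/-- The frequencies of the nonzero modes of the system `σ`. -/
abbrev ModeIndex (σ : Fin d → Bool) := {n : Fin d → ℕ // ∀ i, σ i = true → n i ≠ 0}

theorem orthonormal_mode (σ : Fin d → Bool) :
    Orthonormal ℝ fun n : ModeIndex σ => toL2 (continuous_mode σ n.1) := by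
  classical
  rw [orthonormal_iff_ite]
  intro n m
  rw [inner_toL2_toL2, mode, mode, integral_tensor_mul_tensor]
  split_ifs with h
  · subst h
    exact Finset.prod_eq_one fun i _ => integral_trig_mul_self _ (n.2 i)
  · have : n.1 ≠ m.1 := fun h' => h (Subtype.ext h')
    obtain ⟨i, hi⟩ := Function.ne_iff.1 this
    exact Finset.prod_eq_zero (Finset.mem_univ i) (integral_trig_mul_of_ne _ hi)

theorem integral_mul_tensor_eq_zero {σ : Fin d → Bool} {v : L2 d} (hv : ∀ n, coef σ n v = 0)
    {f : Fin d → ℝ → ℝ} (hf : ∀ i, f i ∈ Submodule.span ℝ (range (trig (σ i)))) :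
    ∫ x in cube d, v x * tensor f x = 0 := by
  have hf' := fun i => (Finsupp.mem_span_range_iff_exists_finsupp).1 (hf i)
  choose c hc using hf'
  have h : ∀ x, v x * tensor f x = ∑ p ∈ Fintype.piFinset fun i => (c i).support,
      (∏ i, c i (p i)) * (v x * mode σ p x) := by
    intro x
    have h1 : tensor f x = ∏ i, ∑ n ∈ (c i).support, c i n * trig (σ i) n (x i) := by
      refine Finset.prod_congr rfl fun i _ => ?_
      conv_lhs => rw [← hc i]
      simp [Finsupp.sum]
    rw [h1, Finset.prod_univ_sum, Finset.mul_sum]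
    refine Finset.sum_congr rfl fun p _ => ?_
    rw [Finset.prod_mul_distrib, mode, tensor]
    ring
  simp only [h]
  rw [integral_finsetSum]
  · refine Finset.sum_eq_zero fun p _ => ?_
    rw [integral_const_mul]
    have := hv p
    rw [coef] at this
    rw [this, mul_zero]
  · exact fun p _ => (L2.integrable_mul v (continuous_mode σ p)).const_mul _

/-- Stone-Weierstrass on the closed cube: the functions `cos (π xᵢ)` separate points because cosine
is injective on `[0, π]`. -/
theorem exists_polynomial_cos_near {g : (Fin d → ℝ) → ℝ} (hg : Continuous g) {ε : ℝ} (hε : 0 < ε) :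
    ∃ p : MvPolynomial (Fin d) ℝ, ∀ x ∈ cube d,
      |g x - MvPolynomial.eval (fun i => Real.cos (Real.pi * x i)) p| ≤ ε := by
  let K : Set (Fin d → ℝ) := Set.pi univ fun _ => Icc 0 1
  have : CompactSpace K := isCompact_iff_compactSpace.1 (isCompact_univ_pi fun _ => isCompact_Icc)
  let c : Fin d → C(K, ℝ) := fun i => ⟨fun x => Real.cos (Real.pi * x.1 i),
    Real.continuous_cos.comp (continuous_const.mul
      ((continuous_apply i).comp continuous_subtype_val))⟩
  let A : Subalgebra ℝ C(K, ℝ) := Algebra.adjoin ℝ (range c)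
  have hA : A.SeparatesPoints := by
    intro x y hxy
    obtain ⟨i, hi⟩ := Function.ne_iff.1 (fun h => hxy (Subtype.ext h))
    refine ⟨c i, ⟨c i, Algebra.subset_adjoin ⟨i, rfl⟩, rfl⟩, fun h => hi ?_⟩
    have hm : ∀ z : K, Real.pi * z.1 i ∈ Icc 0 Real.pi := fun z => by
      have := z.2 i trivial
      exact ⟨mul_nonneg Real.pi_pos.le this.1, mul_le_of_le_one_right Real.pi_pos.le this.2⟩
    exact mul_left_cancel₀ Real.pi_ne_zero (Real.injOn_cos (hm x) (hm y) h)
  have hT := ContinuousMap.subalgebra_topologicalClosure_eq_top_of_separatesPoints A hA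
  have hg' : (⟨fun x : K => g x.1, by fun_prop⟩ : C(K, ℝ)) ∈ A.topologicalClosure := by
    rw [hT]; trivial
  rw [← SetLike.mem_coe, Subalgebra.topologicalClosure_coe, Metric.mem_closure_iff] at hg'
  obtain ⟨a, ha, hd⟩ := hg' ε hε
  change a ∈ Algebra.adjoin ℝ (range c) at ha
  rw [Algebra.adjoin_range_eq_range_aeval] at ha
  obtain ⟨p, rfl⟩ := ha
  refine ⟨p, fun x hx => ?_⟩
  have hxK : x ∈ K := fun i hi => Ioo_subset_Icc_self (hx i hi)
  have h1 := (ContinuousMap.dist_apply_le_dist (⟨x, hxK⟩ : K)).trans hd.le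
  rw [Real.dist_eq] at h1
  have h2 : ∀ p : MvPolynomial (Fin d) ℝ, (MvPolynomial.aeval c p : C(K, ℝ)) ⟨x, hxK⟩
      = MvPolynomial.eval (fun i => Real.cos (Real.pi * x i)) p := by
    intro p
    induction p using MvPolynomial.induction_on with
    | C a => simp
    | add p q hp hq => simp [hp, hq]
    | mul_X p i hp => simp [hp, c]
  rw [← h2 p]
  exact h1

theorem continuous_baseTrig (s : Bool) : Continuous (baseTrig s) := by
  cases s
  · exact continuous_const
  · change Continuous fun x => Real.sin (Real.pi * x)
    fun_prop

/-- Completeness of the trigonometric systems. -/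
theorem eq_zero_of_coef_eq_zero {σ : Fin d → Bool} {v : L2 d} (hv : ∀ n, coef σ n v = 0) :
    v = 0 := by
  -- The lowest mode `w` times a polynomial in the cosines lies in the span of the modes. Hence `v
  -- w` is orthogonal to all continuous functions and vanishes almost everywhere; `w` has no zero in
  -- the open cube.
  let w : (Fin d → ℝ) → ℝ := tensor fun i => baseTrig (σ i)
  have hw : Continuous w := continuous_tensor fun i => continuous_baseTrig _
  have hvw : IntegrableOn (fun x => v x * w x) (cube d) := L2.integrable_mul v hw
  have hP : ∀ p : MvPolynomial (Fin d) ℝ, ∫ x in cube d,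
      (v x * w x) * MvPolynomial.eval (fun i => Real.cos (Real.pi * x i)) p = 0 := by
    intro p
    have h : ∀ x, (v x * w x) * MvPolynomial.eval (fun i => Real.cos (Real.pi * x i)) p
        = ∑ k ∈ p.support, p.coeff k *
          (v x * tensor (fun i t => baseTrig (σ i) t * Real.cos (Real.pi * t) ^ k i) x) := by
      intro x
      rw [MvPolynomial.eval_eq', Finset.mul_sum]
      refine Finset.sum_congr rfl fun k _ => ?_
      simp only [w, tensor, Finset.prod_mul_distrib]
      ring
    simp only [h]
    rw [integral_finsetSum]
    · refine Finset.sum_eq_zero fun k _ => ?_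
      rw [integral_const_mul, integral_mul_tensor_eq_zero hv
        fun i => baseTrig_mul_cos_pow_mem_span (σ i) (k i), mul_zero]
    · refine fun k _ => (L2.integrable_mul v (continuous_tensor fun i => ?_)).const_mul _
      exact (continuous_baseTrig _).mul (by fun_prop)
  have hG : ∀ g : (Fin d → ℝ) → ℝ, Continuous g → ∫ x in cube d, g x • (v x * w x) = 0 := by
    intro g hg
    have hI : 0 ≤ ∫ x in cube d, |v x * w x| := integral_nonneg fun _ => abs_nonneg _
    have key : ∀ ε > 0, |∫ x in cube d, g x • (v x * w x)| ≤ ε * ∫ x in cube d, |v x * w x| := by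
      intro ε hε
      obtain ⟨p, hp⟩ := exists_polynomial_cos_near hg hε
      have hpc : Continuous fun x : Fin d → ℝ =>
          MvPolynomial.eval (fun i => Real.cos (Real.pi * x i)) p := by
        simp only [MvPolynomial.eval_eq']
        fun_prop
      have hint : ∀ h : (Fin d → ℝ) → ℝ, Continuous h →
          IntegrableOn (fun x => (v x * w x) * h x) (cube d) := fun h hh => by
        simpa only [mul_assoc, Pi.mul_apply] using L2.integrable_mul v (hw.mul hh)
      have e : ∫ x in cube d, g x • (v x * w x) = ∫ x in cube d, (v x * w x) *
          (g x - MvPolynomial.eval (fun i => Real.cos (Real.pi * x i)) p) := by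
        simp only [mul_sub]
        rw [integral_sub (hint g hg) (hint _ hpc), hP p, sub_zero]
        simp only [smul_eq_mul, mul_comm]
      rw [e, ← integral_const_mul]
      refine (abs_integral_le_integral_abs).trans ?_
      refine setIntegral_mono_on (hint _ (hg.sub hpc)).abs (hvw.abs.const_mul _)
        measurableSet_cube fun x hx => ?_
      rw [abs_mul, mul_comm ε]
      exact mul_le_mul_of_nonneg_left (hp x hx) (abs_nonneg _)
    have : |∫ x in cube d, g x • (v x * w x)| ≤ 0 := by
      refine le_of_forall_pos_le_add fun δ hδ => ?_
      have := key (δ / ((∫ x in cube d, |v x * w x|) + 1)) (by positivity)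
      refine this.trans ?_
      rw [zero_add, div_mul_eq_mul_div, div_le_iff₀ (by positivity)]
      nlinarith
    exact abs_nonpos_iff.1 this
  have h0 := ae_eq_zero_of_integral_contDiff_smul_eq_zero (μ := volume.restrict (cube d))
    hvw.locallyIntegrable fun g hg _ => hG g hg.continuous
  rw [Lp.eq_zero_iff_ae_eq_zero]
  filter_upwards [h0, ae_restrict_mem measurableSet_cube] with x hx hxc
  refine (mul_eq_zero.1 hx).resolve_right ?_
  exact Finset.prod_ne_zero_iff.2 fun i _ => baseTrig_ne_zero _ (hxc i trivial)

/-- The trigonometric system `σ` as a Hilbert basis. -/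
noncomputable def modeBasis (σ : Fin d → Bool) : HilbertBasis (ModeIndex σ) ℝ (L2 d) :=
  HilbertBasis.mkOfOrthogonalEqBot (orthonormal_mode σ) <| by
    rw [Submodule.eq_bot_iff]
    intro v hv
    refine eq_zero_of_coef_eq_zero (σ := σ) fun n => ?_
    by_cases hn : ∀ i, σ i = true → n i ≠ 0
    · rw [coef_eq_inner, real_inner_comm]
      exact hv _ (Submodule.subset_span ⟨⟨n, hn⟩, rfl⟩)
    · push Not at hn
      obtain ⟨i, h1, h2⟩ := hn
      exact coef_eq_zero h1 h2 v

theorem modeBasis_apply (σ : Fin d → Bool) (n : ModeIndex σ) :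
    modeBasis σ n = toL2 (continuous_mode σ n.1) := by
  rw [modeBasis, HilbertBasis.coe_mkOfOrthogonalEqBot]

theorem support_coef_subset (σ : Fin d → Bool) (v : L2 d) (g : (Fin d → ℕ) → ℝ) :
    Function.support (fun n => coef σ n v * g n) ⊆ {n | ∀ i, σ i = true → n i ≠ 0} := by
  intro n hn i h1 h2
  exact hn (by simp [coef_eq_zero h1 h2])

/-- Parseval's identity. -/
theorem hasSum_coef_mul_coef (σ : Fin d → Bool) (v w : L2 d) :
    HasSum (fun n => coef σ n v * coef σ n w) (inner ℝ v w) := by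
  rw [← hasSum_subtype_iff_of_support_subset (support_coef_subset σ v _)]
  refine ((modeBasis σ).hasSum_inner_mul_inner v w).congr_fun ?_
  intro n
  rw [modeBasis_apply, real_inner_comm w, ← coef_eq_inner, ← coef_eq_inner]
  rfl

theorem hasSum_coef_sq (σ : Fin d → Bool) (v : L2 d) :
    HasSum (fun n => coef σ n v ^ 2) (‖v‖ ^ 2) := by
  rw [← real_inner_self_eq_norm_sq]
  simpa only [sq] using hasSum_coef_mul_coef σ v v

theorem eq_of_coef_eq {σ : Fin d → Bool} {v w : L2 d} (h : ∀ n, coef σ n v = coef σ n w) :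
    v = w :=
  sub_eq_zero.1 (eq_zero_of_coef_eq_zero (σ := σ) fun n => by rw [coef_sub, h, sub_self])

/-- Square summable sequences are sequences of coefficients. -/
theorem exists_coef_eq (σ : Fin d → Bool) {a : (Fin d → ℕ) → ℝ} (ha : Summable fun n => a n ^ 2)
    (h0 : ∀ n i, σ i = true → n i = 0 → a n = 0) : ∃ v : L2 d, ∀ n, coef σ n v = a n := by
  have hm : Memℓp (fun n : ModeIndex σ => a n.1) 2 := by
    refine memℓp_gen ?_
    have : Summable fun n : ModeIndex σ => a n.1 ^ 2 := ha.comp_injective Subtype.val_injective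
    simpa using this
  refine ⟨(modeBasis σ).repr.symm ⟨_, hm⟩, fun n => ?_⟩
  by_cases hn : ∀ i, σ i = true → n i ≠ 0
  · have h1 := (modeBasis σ).repr_apply_apply ((modeBasis σ).repr.symm ⟨_, hm⟩) ⟨n, hn⟩
    rw [LinearIsometryEquiv.apply_symm_apply, modeBasis_apply, real_inner_comm,
      ← coef_eq_inner] at h1
    exact h1.symm
  · push Not at hn
    obtain ⟨i, h1, h2⟩ := hn
    rw [coef_eq_zero h1 h2, h0 n i h1 h2]

end Coefficients

end DirSplit

namespace DirSplit

open Filter Topology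

/-! ### Weak derivatives and boundary conditions in terms of coefficients -/

section WeakDerivatives

variable {d : ℕ}

/-- Multiply every factor by a cutoff and pass to the limit. Each direction is differentiated at
most once, and where it is, the factor vanishes at the ends, so the derivatives stay bounded. -/
theorem HasWeakDeriv.integral_tensor {l : List (Fin d)} (hl : l.Nodup) {v g : L2 d}
    (h : HasWeakDeriv l v g) {f : Fin d → ℝ → ℝ} (hf : ∀ i, ContDiff ℝ ∞ (f i))
    (hz : ∀ i ∈ l, f i 0 = 0 ∧ f i 1 = 0) :
    ∫ x in cube d, v x * tensor (fun i => if i ∈ l then deriv (f i) else f i) x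
      = (-1) ^ l.length * ∫ x in cube d, g x * tensor f x := by
  let F : ℕ → Fin d → ℝ → ℝ := fun m i x => f i x * cutoff m x
  have hF : ∀ m i, ContDiff ℝ ∞ (F m i) := fun m i => (hf i).mul (contDiff_cutoff m)
  have h1 : ∀ m, ∫ x in cube d, v x * tensor (fun i => if i ∈ l then deriv (F m i) else F m i) x
      = (-1) ^ l.length * ∫ x in cube d, g x * tensor (F m) x := by
    intro m
    have e : (fun i => if i ∈ l then deriv (F m i) else F m i)
        = fun i => deriv^[l.count i] (F m i) := by
      funext i
      split_ifs with hi
      · rw [List.count_eq_one_of_mem hl hi, Function.iterate_one]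
      · rw [List.count_eq_zero_of_not_mem hi, Function.iterate_zero, id]
    rw [← h _ (isTest_tensor fun i => isTestOne_mul_cutoff (hf i) m), pds_tensor (hF m), e]
  have h2 := L2.tendsto_integral_tensor v (F := fun m i => if i ∈ l then deriv (F m i) else F m i)
    (f := fun i => if i ∈ l then deriv (f i) else f i) (fun m i => by
      split_ifs
      · exact (hF m i).continuous_deriv (by simp)
      · exact (hF m i).continuous) (fun i => by
      by_cases hi : i ∈ l
      · simp only [if_pos hi]
        exact exists_bound_deriv_mul_cutoff (hf i) (hz i hi).1 (hz i hi).2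
      · simp only [if_neg hi]
        exact exists_bound_mul_cutoff (hf i).continuous) (fun i x hx => by
      by_cases hi : i ∈ l
      · simp only [if_pos hi]
        exact tendsto_deriv_mul_cutoff _ hx
      · simp only [if_neg hi]
        exact tendsto_mul_cutoff _ hx)
  have h3 := L2.tendsto_integral_tensor g (F := F) (f := f) (fun m i => (hF m i).continuous)
    (fun i => exists_bound_mul_cutoff (hf i).continuous) (fun i x hx => tendsto_mul_cutoff _ hx)
  simp only [h1] at h2
  exact tendsto_nhds_unique h2 (h3.const_mul _)

/-- Sines vanish on the faces, so they may be used as test functions without any boundary condition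
on `v`; differentiating them turns sine coefficients of `g` into cosine coefficients of `v`. -/
theorem HasWeakDeriv.coef_eq {l : List (Fin d)} (hl : l.Nodup) {v g : L2 d}
    (h : HasWeakDeriv l v g) {σ : Fin d → Bool} (hσ : ∀ i ∈ l, σ i = true) (n : Fin d → ℕ) :
    coef σ n g = (-1) ^ l.length * ((∏ i ∈ l.toFinset, (n i * Real.pi))
      * coef (fun i => if i ∈ l then false else σ i) n v) := by
  have h1 := h.integral_tensor hl (f := fun i => trig (σ i) (n i))
    (fun i => contDiff_trig _ _) fun i hi => by
      rw [hσ i hi]; exact ⟨trig_true_zero _, trig_true_one _⟩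
  have h2 : tensor (fun i => if i ∈ l then deriv (trig (σ i) (n i)) else trig (σ i) (n i))
      = fun x => (∏ i ∈ l.toFinset, (n i * Real.pi))
        * mode (fun i => if i ∈ l then false else σ i) n x := by
    funext x
    simp only [mode, tensor]
    have h3 : ∏ i ∈ l.toFinset, ((n i : ℝ) * Real.pi) = ∏ i, if i ∈ l then n i * Real.pi else 1 := by
      rw [Finset.prod_ite, Finset.prod_const_one, mul_one]
      congr 1
      ext i
      simp
    rw [h3, ← Finset.prod_mul_distrib]
    refine Finset.prod_congr rfl fun i _ => ?_
    by_cases hi : i ∈ l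
    · simp only [if_pos hi, hσ i hi, deriv_trig_true]
    · simp only [if_neg hi, one_mul]
  rw [h2] at h1
  have h4 : ∫ x in cube d, v x * ((∏ i ∈ l.toFinset, (n i * Real.pi))
        * mode (fun i => if i ∈ l then false else σ i) n x)
      = (∏ i ∈ l.toFinset, (n i * Real.pi)) * coef (fun i => if i ∈ l then false else σ i) n v := by
    rw [coef, ← integral_const_mul]
    congr 1
    funext x
    ring
  rw [h4] at h1
  rw [h1, ← mul_assoc, ← mul_pow]
  change coef σ n g = _ * coef σ n g
  norm_num

theorem HasWeakDeriv.coef_eq_single {i : Fin d} {v g : L2 d} (h : HasWeakDeriv [i] v g)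
    {σ : Fin d → Bool} (hσ : σ i = true) (n : Fin d → ℕ) :
    coef σ n g = -(n i * Real.pi * coef (Function.update σ i false) n v) := by
  have h1 := h.coef_eq (List.nodup_singleton i) (σ := σ) (by simpa using hσ) n
  rw [h1]
  have h2 : (fun k => if k ∈ [i] then false else σ k) = Function.update σ i false := by
    funext k
    by_cases hk : k = i
    · subst hk; simp
    · simp [hk]
  rw [h2]
  simp

theorem L2.eq_of_integral_test {g g' : L2 d}
    (h : ∀ φ, IsTest φ → ∫ x in cube d, g x * φ x = ∫ x in cube d, g' x * φ x) : g = g' := by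
  have h1 : HasWeakDeriv [] g g' := fun φ hφ => by simpa [pds] using h φ hφ
  refine eq_of_coef_eq (σ := fun _ => true) fun n => ?_
  have := h1.coef_eq List.nodup_nil (σ := fun _ => true) (by simp) n
  simpa using this.symm

theorem HasWeakDeriv.unique {l : List (Fin d)} {v g g' : L2 d} (h : HasWeakDeriv l v g)
    (h' : HasWeakDeriv l v g') : g = g' := by
  refine L2.eq_of_integral_test fun φ hφ => ?_
  have h1 := (h φ hφ).symm.trans (h' φ hφ)
  exact mul_left_cancel₀ (pow_ne_zero _ (by norm_num)) h1

theorem contDiff_pd {φ : (Fin d → ℝ) → ℝ} (hφ : ContDiff ℝ ∞ φ) (i : Fin d) :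
    ContDiff ℝ ∞ (pd i φ) :=
  (hφ.fderiv_right (by simp)).clm_apply contDiff_const

theorem contDiff_pds {φ : (Fin d → ℝ) → ℝ} (hφ : ContDiff ℝ ∞ φ) (l : List (Fin d)) :
    ContDiff ℝ ∞ (pds l φ) := by
  induction l with
  | nil => exact hφ
  | cons i l ih => exact contDiff_pd ih i

theorem hasCompactSupport_pd {φ : (Fin d → ℝ) → ℝ} (hφ : HasCompactSupport φ) (i : Fin d) :
    HasCompactSupport (pd i φ) := hφ.fderiv_apply ℝ _

theorem HasWeakDeriv.sub {l : List (Fin d)} {v g v' g' : L2 d} (h : HasWeakDeriv l v g)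
    (h' : HasWeakDeriv l v' g') : HasWeakDeriv l (v - v') (g - g') := by
  intro φ hφ
  have h1 := h φ hφ
  have h2 := h' φ hφ
  rw [← inner_toL2 _ (contDiff_pds hφ.1 l).continuous, ← inner_toL2 _ hφ.1.continuous] at h1 h2 ⊢
  rw [inner_sub_left, inner_sub_left, h1, h2]
  ring

theorem HasWeakDeriv.hasWeakDiv {v g : Fin d → L2 d} (h : ∀ i, HasWeakDeriv [i] (v i) (g i)) :
    HasWeakDiv v (∑ i, g i) := by
  intro φ hφ
  have h1 : ∀ i, ∫ x in cube d, v i x * pd i φ x = -∫ x in cube d, g i x * φ x := fun i => by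
    simpa [pds] using h i φ hφ
  simp only [h1]
  rw [← inner_toL2 _ hφ.1.continuous, sum_inner, ← Finset.sum_neg_distrib]
  exact Finset.sum_congr rfl fun i _ => by rw [inner_toL2 _ hφ.1.continuous]

theorem HasWeakDiv.unique {v : Fin d → L2 d} {g g' : L2 d} (h : HasWeakDiv v g)
    (h' : HasWeakDiv v g') : g = g' :=
  L2.eq_of_integral_test fun φ hφ => neg_injective ((h φ hφ).symm.trans (h' φ hφ))

theorem HasDerivZeroTrace.hasWeakDeriv {i : Fin d} {v g : L2 d} (h : HasDerivZeroTrace i v g) :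
    HasWeakDeriv [i] v g := fun φ hφ => by
  simpa [pds] using h φ hφ.1 hφ.2.1

theorem HasDerivZeroTrace.hasWeakDeriv_of_second {i : Fin d} {v g h : L2 d}
    (hv : HasDerivZeroTrace i v g) (h2 : HasWeakDeriv [i, i] v h) : HasWeakDeriv [i] g h := by
  intro φ hφ
  have h3 := h2 φ hφ
  have h4 := hv (pd i φ) (contDiff_pd hφ.1 i) (hasCompactSupport_pd hφ.2.1 i)
  simp only [pds, List.foldr_cons, List.foldr_nil, List.length_cons, List.length_nil] at h3 ⊢
  rw [h3] at h4
  norm_num at h4 ⊢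
  linarith

/-- A smooth function of one variable with compact support that is `1` near `[0,1]`. -/
noncomputable def plateau : ContDiffBump (1 / 2 : ℝ) := ⟨1, 2, one_pos, one_lt_two⟩

theorem plateau_eventually_one {x : ℝ} (hx : x ∈ Ioo (0 : ℝ) 1) : ⇑plateau =ᶠ[𝓝 x] 1 := by
  filter_upwards [isOpen_Ioo.mem_nhds hx] with y hy
  refine plateau.one_of_mem_closedBall ?_
  rw [Metric.mem_closedBall, Real.dist_eq]
  change |y - 1 / 2| ≤ 1
  rw [abs_le]
  exact ⟨by linarith [hy.1], by linarith [hy.2]⟩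

/-- The plateau supplies the compact support demanded of test functions and changes nothing inside
the cube. -/
theorem HasDerivZeroTrace.integral_tensor {i : Fin d} {v g : L2 d} (h : HasDerivZeroTrace i v g)
    {f : Fin d → ℝ → ℝ} (hf : ∀ i, ContDiff ℝ ∞ (f i)) :
    ∫ x in cube d, v x * tensor (Function.update f i (deriv (f i))) x
      = -∫ x in cube d, g x * tensor f x := by
  let F : Fin d → ℝ → ℝ := fun k x => f k x * plateau x
  have hF : ∀ k, ContDiff ℝ ∞ (F k) := fun k => (hf k).mul plateau.contDiff
  have hc : HasCompactSupport (tensor F) := by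
    refine IsCompact.of_isClosed_subset (isCompact_univ_pi fun k => ?_) (isClosed_tsupport _)
      (tsupport_tensor_subset F)
    exact HasCompactSupport.mul_left plateau.hasCompactSupport
  have h1 := h _ (contDiff_tensor hF) hc
  rw [pd_tensor hF] at h1
  have hFf : ∀ k, ∀ x ∈ Ioo (0 : ℝ) 1, F k =ᶠ[𝓝 x] f k := fun k x hx => by
    filter_upwards [plateau_eventually_one hx] with y hy
    simp only [F, hy, Pi.one_apply, mul_one]
  have e1 : ∫ x in cube d, v x * tensor (Function.update F i (deriv (F i))) x
      = ∫ x in cube d, v x * tensor (Function.update f i (deriv (f i))) x := by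
    refine setIntegral_congr_fun measurableSet_cube fun x hx => ?_
    simp only [tensor_update_left]
    rw [(hFf i _ (hx i trivial)).deriv_eq]
    congr 2
    exact Finset.prod_congr rfl fun k _ => (hFf k _ (hx k trivial)).self_of_nhds
  have e2 : ∫ x in cube d, g x * tensor F x = ∫ x in cube d, g x * tensor f x := by
    refine setIntegral_congr_fun measurableSet_cube fun x hx => ?_
    simp only [tensor]
    congr 1
    exact Finset.prod_congr rfl fun k _ => (hFf k _ (hx k trivial)).self_of_nhds
  rw [← e1, ← e2, h1]

/-- Testing with cosines, which do not vanish on the faces, is where the zero trace is used. -/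
theorem HasDerivZeroTrace.coef_eq {i : Fin d} {v g : L2 d} (h : HasDerivZeroTrace i v g)
    {σ : Fin d → Bool} (hσ : σ i = true) (n : Fin d → ℕ) :
    coef (Function.update σ i false) n g = n i * Real.pi * coef σ n v := by
  have h1 := h.integral_tensor (f := fun k => trig (Function.update σ i false k) (n k))
    fun k => contDiff_trig _ _
  have h2 : tensor (Function.update (fun k => trig (Function.update σ i false k) (n k)) i
      (deriv (trig (Function.update σ i false i) (n i))))
      = fun x => -(n i * Real.pi) * mode σ n x := by
    funext x
    rw [tensor_update_left, mode, tensor_eq_mul _ i, Function.update_self, deriv_trig_false, hσ,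
      ← mul_assoc]
    congr 1
    exact Finset.prod_congr rfl fun k hk => by
      rw [Function.update_of_ne (Finset.ne_of_mem_erase hk)]
  rw [h2] at h1
  have h3 : ∫ x in cube d, v x * (-(n i * Real.pi) * mode σ n x)
      = -(n i * Real.pi) * coef σ n v := by
    rw [coef, ← integral_const_mul]
    congr 1
    funext x
    ring
  rw [h3] at h1
  change _ = -coef (Function.update σ i false) n g at h1
  linarith

theorem HasDerivZeroTrace.coef_second_eq {i : Fin d} {v g h : L2 d}
    (hv : HasDerivZeroTrace i v g) (h2 : HasWeakDeriv [i, i] v h) {σ : Fin d → Bool}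
    (hσ : σ i = true) (n : Fin d → ℕ) : coef σ n h = -((n i * Real.pi) ^ 2 * coef σ n v) := by
  rw [(hv.hasWeakDeriv_of_second h2).coef_eq_single hσ, hv.coef_eq hσ]
  ring

theorem integral_toL2_mul {g h : (Fin d → ℝ) → ℝ} (hg : Continuous g) (hh : tsupport h ⊆ cube d) :
    ∫ x in cube d, toL2 hg x * h x = ∫ x, g x * h x := by
  have : ∫ x in cube d, toL2 hg x * h x = ∫ x in cube d, g x * h x := by
    refine integral_congr_ae ?_
    filter_upwards [coeFn_toL2 hg] with x hx
    rw [hx]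
  rw [this]
  refine setIntegral_eq_integral_of_forall_compl_eq_zero fun x hx => ?_
  rw [image_eq_zero_of_notMem_tsupport fun hx' => hx (hh hx'), mul_zero]

theorem integral_mul_pd {φ θ : (Fin d → ℝ) → ℝ} (hφ : ContDiff ℝ ∞ φ) (hθ : ContDiff ℝ ∞ θ)
    (hc : HasCompactSupport θ) (i : Fin d) :
    ∫ x, φ x * pd i θ x = -∫ x, pd i φ x * θ x := by
  have hcs := hasCompactSupport_pd hc i
  have h1 : Integrable fun x => pd i φ x * θ x :=
    ((contDiff_pd hφ i).continuous.mul hθ.continuous).integrable_of_hasCompactSupport hc.mul_left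
  have h2 : Integrable fun x => φ x * pd i θ x :=
    (hφ.continuous.mul (contDiff_pd hθ i).continuous).integrable_of_hasCompactSupport hcs.mul_left
  have h3 : Integrable fun x => φ x * θ x :=
    (hφ.continuous.mul hθ.continuous).integrable_of_hasCompactSupport hc.mul_left
  exact integral_mul_fderiv_eq_neg_fderiv_mul_of_integrable h1 h2 h3
    (fun x _ => hφ.differentiable (by simp) x) (fun x _ => hθ.differentiable (by simp) x)

theorem tsupport_pd_subset (θ : (Fin d → ℝ) → ℝ) (i : Fin d) : tsupport (pd i θ) ⊆ tsupport θ :=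
  tsupport_fderiv_apply_subset ℝ _

theorem hasWeakDeriv_toL2 {φ : (Fin d → ℝ) → ℝ} (hφ : ContDiff ℝ ∞ φ) (i : Fin d) :
    HasWeakDeriv [i] (toL2 hφ.continuous) (toL2 (contDiff_pd hφ i).continuous) := by
  intro θ hθ
  have hs : tsupport (pd i θ) ⊆ cube d := (tsupport_pd_subset θ i).trans hθ.2.2
  have h1 := integral_toL2_mul hφ.continuous hs
  have h2 := integral_toL2_mul (contDiff_pd hφ i).continuous hθ.2.2
  rw [List.length_singleton, pow_one, neg_one_mul, h2, ← integral_mul_pd hφ hθ.1 hθ.2.1 i]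
  exact h1

/-- Parseval on both sides, with sines in direction `i` on the left and cosines on the right: the
two series agree up to sign term by term, each side contributing the same factor `n i π`. -/
theorem HasDerivZeroTrace.inner_eq {i : Fin d} {v g w h : L2 d} (hv : HasDerivZeroTrace i v g)
    (hw : HasWeakDeriv [i] w h) : inner ℝ v h = -inner ℝ g w := by
  have h1 := hasSum_coef_mul_coef (fun _ : Fin d => true) v h
  have h2 := (hasSum_coef_mul_coef (Function.update (fun _ : Fin d => true) i false) g w).neg
  refine h1.unique (h2.congr_fun fun n => ?_)
  rw [hv.coef_eq (σ := fun _ => true) rfl, hw.coef_eq_single (σ := fun _ => true) rfl]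
  ring

/-- The sine-cosine relation in a single system characterizes derivative and zero trace together,
because a smooth test function satisfies the companion relation for weak derivatives and Parseval
does the rest. -/
theorem hasDerivZeroTrace_of_coef {i : Fin d} {v g : L2 d} {σ : Fin d → Bool} (hσ : σ i = true)
    (h : ∀ n, coef (Function.update σ i false) n g = n i * Real.pi * coef σ n v) :
    HasDerivZeroTrace i v g := by
  intro φ hφ _
  rw [← inner_toL2 _ (contDiff_pd hφ i).continuous, ← inner_toL2 _ hφ.continuous]
  have h1 := hasSum_coef_mul_coef σ v (toL2 (contDiff_pd hφ i).continuous)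
  have h2 := (hasSum_coef_mul_coef (Function.update σ i false) g (toL2 hφ.continuous)).neg
  refine h1.unique (h2.congr_fun fun n => ?_)
  rw [h, (hasWeakDeriv_toL2 hφ i).coef_eq_single hσ]
  ring

end WeakDerivatives

end DirSplit

namespace DirSplit

open Filter Topology

/-! ### Symbols of the Laplacian and of the splitting operator -/

section Symbols

variable {d : ℕ}

/-- The symbol `(n i π)²` of `-∂_{ii}`. -/
noncomputable def freqSq (n : Fin d → ℕ) (i : Fin d) : ℝ := (n i * Real.pi) ^ 2

/-- The symbol of `-Δ`. -/
noncomputable def lapSymbol (n : Fin d → ℕ) : ℝ := ∑ i, freqSq n i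

/-- The symbol of the splitting operator `B`. -/
noncomputable def splitSymbol (τ : ℝ) (n : Fin d → ℕ) : ℝ :=
  4 / τ ^ 2 * (∏ i, (1 + τ / 2 * freqSq n i) - 1 - τ / 2 * lapSymbol n)

theorem freqSq_nonneg (n : Fin d → ℕ) (i : Fin d) : 0 ≤ freqSq n i := sq_nonneg _

theorem lapSymbol_nonneg (n : Fin d → ℕ) : 0 ≤ lapSymbol n :=
  Finset.sum_nonneg fun i _ => freqSq_nonneg n i

theorem one_add_sum_le_prod_one_add {ι : Type*} (s : Finset ι) {x : ι → ℝ} (hx : ∀ i, 0 ≤ x i) :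
    1 + ∑ i ∈ s, x i ≤ ∏ i ∈ s, (1 + x i) := by
  classical
  induction s using Finset.induction_on with
  | empty => simp
  | insert i s hi ih =>
    rw [Finset.sum_insert hi, Finset.prod_insert hi]
    have h1 : 0 ≤ ∑ i ∈ s, x i := Finset.sum_nonneg fun i _ => hx i
    nlinarith [hx i, mul_le_mul_of_nonneg_left ih (hx i), mul_nonneg (hx i) h1]

theorem splitSymbol_nonneg {τ : ℝ} (hτ : 0 < τ) (n : Fin d → ℕ) : 0 ≤ splitSymbol τ n := by
  refine mul_nonneg (by positivity) ?_
  have h := one_add_sum_le_prod_one_add Finset.univ (x := fun i => τ / 2 * freqSq n i) fun i => by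
    have := freqSq_nonneg n i
    positivity
  rw [← Finset.mul_sum] at h
  change 1 + τ / 2 * lapSymbol n ≤ _ at h
  linarith

theorem splitSymbol_two {τ : ℝ} (hτ : τ ≠ 0) (n : Fin 2 → ℕ) :
    splitSymbol τ n = freqSq n 0 * freqSq n 1 := by
  simp only [splitSymbol, lapSymbol, Fin.prod_univ_two, Fin.sum_univ_two]
  field_simp
  ring

theorem splitSymbol_three {τ : ℝ} (hτ : τ ≠ 0) (n : Fin 3 → ℕ) :
    splitSymbol τ n = freqSq n 0 * freqSq n 1 + freqSq n 1 * freqSq n 2 + freqSq n 2 * freqSq n 0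
      + τ / 2 * (freqSq n 0 * freqSq n 1 * freqSq n 2) := by
  simp only [splitSymbol, lapSymbol, Fin.prod_univ_three, Fin.sum_univ_three]
  field_simp
  ring

theorem iterate_deriv_two_trig_true (n : ℕ) :
    deriv^[2] (trig true n) = fun x => -(n * Real.pi) ^ 2 * trig true n x := by
  have h1 : deriv (fun x => n * Real.pi * trig false n x)
      = fun x => n * Real.pi * deriv (trig false n) x := by
    funext x
    exact deriv_const_mul _ ((contDiff_trig false n).differentiable (by simp) x)
  rw [Function.iterate_succ_apply', Function.iterate_one, deriv_trig_true, h1, deriv_trig_false]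
  funext x
  ring

theorem splitB_mode (hd : d = 2 ∨ d = 3) {τ : ℝ} (hτ : τ ≠ 0) (n : Fin d → ℕ) :
    splitB d τ (mode (fun _ => true) n)
      = fun x => splitSymbol τ n * mode (fun _ => true) n x := by
  have h := fun l : List (Fin d) => pds_tensor (f := fun i => trig true (n i))
    (fun i => contDiff_trig _ _) l
  rcases hd with rfl | rfl
  · funext x
    have h1 := congrFun (h [0, 0, 1, 1]) x
    simp only [List.count, List.countP_cons, List.countP_nil, tensor, Fin.prod_univ_two] at h1
    simp only [Fin.isValue, BEq.rfl, if_true, zero_add, Fin.reduceBEq, Bool.false_eq_true, if_false,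
      add_zero, Nat.reduceAdd, iterate_deriv_two_trig_true] at h1
    rw [splitSymbol_two hτ]
    change pds [0, 0, 1, 1] (tensor fun i => trig true (n i)) x = _
    simp only [mode, tensor, Fin.prod_univ_two, freqSq]
    rw [h1]
    ring
  · funext x
    have h1 := congrFun (h [0, 0, 1, 1]) x
    have h2 := congrFun (h [1, 1, 2, 2]) x
    have h3 := congrFun (h [2, 2, 0, 0]) x
    have h4 := congrFun (h [0, 0, 1, 1, 2, 2]) x
    simp only [List.count, List.countP_cons, List.countP_nil, tensor, Fin.prod_univ_three]
      at h1 h2 h3 h4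
    simp only [Fin.isValue, BEq.rfl, if_true, zero_add, Fin.reduceBEq, Bool.false_eq_true, if_false,
      add_zero, Nat.reduceAdd, iterate_deriv_two_trig_true, Function.iterate_zero, id]
      at h1 h2 h3 h4
    rw [splitSymbol_three hτ]
    change pds [0, 0, 1, 1] (tensor fun i => trig true (n i)) x
      + pds [1, 1, 2, 2] (tensor fun i => trig true (n i)) x
      + pds [2, 2, 0, 0] (tensor fun i => trig true (n i)) x
      - τ / 2 * pds [0, 0, 1, 1, 2, 2] (tensor fun i => trig true (n i)) x = _
    simp only [mode, tensor, Fin.prod_univ_three, freqSq]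
    rw [h1, h2, h3, h4]
    ring

/-- Two derivatives of `f i` times the cutoff are not uniformly bounded. The zero trace of `v`
allows one of them to be moved onto `v`, and the remaining one is bounded because `f i` vanishes at
the ends. -/
theorem HasDerivZeroTrace.tendsto_integral_pds {i : Fin d} {v g : L2 d}
    (hv : HasDerivZeroTrace i v g) {f : Fin d → ℝ → ℝ} (hf : ∀ i, ContDiff ℝ ∞ (f i))
    (h0 : f i 0 = 0) (h1 : f i 1 = 0) {l : List (Fin d)} (hl : l.count i = 0 ∨ l.count i = 2) :
    Tendsto (fun m => ∫ x in cube d,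
        v x * pds l (tensor (Function.update f i fun x => f i x * cutoff m x)) x) atTop
      (𝓝 (∫ x in cube d, v x * pds l (tensor f) x)) := by
  let F : ℕ → ℝ → ℝ := fun m x => f i x * cutoff m x
  have hF : ∀ m, ContDiff ℝ ∞ (F m) := fun m => (hf i).mul (contDiff_cutoff m)
  let G : Fin d → ℝ → ℝ := fun k => deriv^[l.count k] (f k)
  have hG : ∀ k, ContDiff ℝ ∞ (G k) := fun k => (hf k).iterate_deriv _
  have hu : ∀ m k, ContDiff ℝ ∞ (Function.update f i (F m) k) := fun m k => by
    rcases eq_or_ne k i with rfl | h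
    · rw [Function.update_self]; exact hF m
    · rw [Function.update_of_ne h]; exact hf k
  have e1 : ∀ m, pds l (tensor (Function.update f i (F m)))
      = tensor (Function.update G i (deriv^[l.count i] (F m))) := fun m => by
    rw [pds_tensor (hu m)]
    congr 1
    funext k
    rcases eq_or_ne k i with rfl | h
    · rw [Function.update_self, Function.update_self]
    · rw [Function.update_of_ne h, Function.update_of_ne h]
  have e2 : pds l (tensor f) = tensor (Function.update G i (deriv^[l.count i] (f i))) := by
    rw [pds_tensor hf]
    congr 1
    exact (Function.update_eq_self i G).symm
  have key : ∀ (w : L2 d) (P : ℕ → ℝ → ℝ) (p : ℝ → ℝ), (∀ m, Continuous (P m)) →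
      (∃ C, ∀ m, ∀ x ∈ Ioo (0 : ℝ) 1, |P m x| ≤ C) →
      (∀ x ∈ Ioo (0 : ℝ) 1, Tendsto (fun m => P m x) atTop (𝓝 (p x))) →
      Tendsto (fun m => ∫ x in cube d, w x * tensor (Function.update G i (P m)) x) atTop
        (𝓝 (∫ x in cube d, w x * tensor (Function.update G i p) x)) := by
    intro w P p hP hb ht
    refine L2.tendsto_integral_tensor w (fun m k => ?_) (fun k => ?_) (fun k x hx => ?_)
    · rcases eq_or_ne k i with rfl | h
      · rw [Function.update_self]; exact hP m
      · rw [Function.update_of_ne h]; exact (hG k).continuous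
    · rcases eq_or_ne k i with rfl | h
      · simpa only [Function.update_self] using hb
      · simp only [Function.update_of_ne h]
        obtain ⟨C, hC⟩ := isCompact_Icc (a := (0 : ℝ)) (b := 1) |>.exists_bound_of_continuousOn
          (hG k).continuous.continuousOn
        exact ⟨C, fun _ x hx => hC x (Ioo_subset_Icc_self hx)⟩
    · rcases eq_or_ne k i with rfl | h
      · simpa only [Function.update_self] using ht x hx
      · simp only [Function.update_of_ne h]
        exact tendsto_const_nhds
  simp only [e2]
  change Tendsto (fun m => ∫ x in cube d, v x * pds l (tensor (Function.update f i (F m))) x) _ _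
  simp only [e1]
  rcases hl with hl | hl
  · simp only [hl, Function.iterate_zero, id]
    exact key v F (f i) (fun m => (hF m).continuous) (exists_bound_mul_cutoff (hf i).continuous)
      fun x hx => tendsto_mul_cutoff _ hx
  · have e3 : ∀ p : ℝ → ℝ, ContDiff ℝ ∞ p →
        ∫ x in cube d, v x * tensor (Function.update G i (deriv^[2] p)) x
          = -∫ x in cube d, g x * tensor (Function.update G i (deriv p)) x := by
      intro p hp
      have hp' : ∀ k, ContDiff ℝ ∞ (Function.update G i (deriv p) k) := fun k => by
        rcases eq_or_ne k i with rfl | h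
        · rw [Function.update_self]; exact hp.iterate_deriv 1
        · rw [Function.update_of_ne h]; exact hG k
      have := hv.integral_tensor hp'
      rwa [Function.update_self, Function.update_idem] at this
    rw [hl]
    rw [e3 _ (hf i)]
    simp only [e3 _ (hF _)]
    exact (key g _ _ (fun m => (hF m).continuous_deriv (by simp))
      (exists_bound_deriv_mul_cutoff (hf i) h0 h1) fun x hx => tendsto_deriv_mul_cutoff _ hx).neg

theorem integral_mul_splitB_three (τ : ℝ) (v : L2 3) {φ : (Fin 3 → ℝ) → ℝ}
    (hφ : ContDiff ℝ ∞ φ) :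
    ∫ x in cube 3, v x * splitB 3 τ φ x = (∫ x in cube 3, v x * pds [0, 0, 1, 1] φ x)
      + (∫ x in cube 3, v x * pds [1, 1, 2, 2] φ x) + (∫ x in cube 3, v x * pds [2, 2, 0, 0] φ x)
      - τ / 2 * ∫ x in cube 3, v x * pds [0, 0, 1, 1, 2, 2] φ x := by
  have hi := fun l => L2.integrable_mul v (contDiff_pds hφ l).continuous
  have e : ∀ x, v x * splitB 3 τ φ x = v x * pds [0, 0, 1, 1] φ x + v x * pds [1, 1, 2, 2] φ x
      + v x * pds [2, 2, 0, 0] φ x - τ / 2 * (v x * pds [0, 0, 1, 1, 2, 2] φ x) := fun x => by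
    simp only [splitB]; ring
  simp only [e]
  rw [integral_sub, integral_add, integral_add (hi _) (hi _), integral_const_mul]
  · exact (hi _).add (hi _)
  · exact hi _
  · exact ((hi _).add (hi _)).add (hi _)
  · exact (hi _).const_mul _

theorem HasDerivZeroTrace.tendsto_integral_splitB (hd : d = 2 ∨ d = 3) (τ : ℝ) {i : Fin d}
    {v g : L2 d} (hv : HasDerivZeroTrace i v g) {f : Fin d → ℝ → ℝ}
    (hf : ∀ i, ContDiff ℝ ∞ (f i)) (h0 : f i 0 = 0) (h1 : f i 1 = 0) :
    Tendsto (fun m => ∫ x in cube d,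
        v x * splitB d τ (tensor (Function.update f i fun x => f i x * cutoff m x)) x) atTop
      (𝓝 (∫ x in cube d, v x * splitB d τ (tensor f) x)) := by
  rcases hd with rfl | rfl
  · exact hv.tendsto_integral_pds hf h0 h1 (by fin_cases i <;> simp)
  · have hu : ∀ m, ContDiff ℝ ∞ (tensor (Function.update f i fun x => f i x * cutoff m x)) :=
      fun m => contDiff_tensor fun k => by
        rcases eq_or_ne k i with rfl | h
        · rw [Function.update_self]; exact (hf k).mul (contDiff_cutoff m)
        · rw [Function.update_of_ne h]; exact hf k
    simp only [integral_mul_splitB_three τ v (hu _),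
      integral_mul_splitB_three τ v (contDiff_tensor hf)]
    refine (((hv.tendsto_integral_pds hf h0 h1 ?_).add (hv.tendsto_integral_pds hf h0 h1 ?_)).add
      (hv.tendsto_integral_pds hf h0 h1 ?_)).sub
      ((hv.tendsto_integral_pds hf h0 h1 ?_).const_mul _) <;> fin_cases i <;> simp

/-- On functions vanishing on the boundary, the distributional equation `B v = w` may be tested
with tensor products that only vanish on the boundary. -/
theorem HasB.integral_tensor (hd : d = 2 ∨ d = 3) {τ : ℝ} {v w : L2 d} (h : HasB τ v w)
    {f : Fin d → ℝ → ℝ} (hf : ∀ i, ContDiff ℝ ∞ (f i)) (h0 : ∀ i, f i 0 = 0)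
    (h1 : ∀ i, f i 1 = 0) :
    ∫ x in cube d, v x * splitB d τ (tensor f) x = ∫ x in cube d, w x * tensor f x := by
  -- Induction on a set `s` containing all directions where `f` is not yet compactly supported. The
  -- cutoffs are removed one direction at a time, since each limit uses an integration by parts in
  -- its own direction.
  have key : ∀ s : Finset (Fin d), ∀ f : Fin d → ℝ → ℝ, (∀ i, ContDiff ℝ ∞ (f i)) →
      (∀ i, f i 0 = 0) → (∀ i, f i 1 = 0) → (∀ i ∉ s, IsTestOne (f i)) →
      ∫ x in cube d, v x * splitB d τ (tensor f) x = ∫ x in cube d, w x * tensor f x := by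
    intro s
    induction s using Finset.induction_on with
    | empty => exact fun f _ _ _ ht => h.2 _ (isTest_tensor fun i => ht i (by simp))
    | insert i s _ ih =>
      intro f hf h0 h1 ht
      obtain ⟨g, hg⟩ := h.1 i
      have t1 := hg.tendsto_integral_splitB hd τ hf (h0 i) (h1 i)
      have t2 : Tendsto (fun m => ∫ x in cube d,
          w x * tensor (Function.update f i fun x => f i x * cutoff m x) x) atTop
          (𝓝 (∫ x in cube d, w x * tensor f x)) := by
        refine L2.tendsto_integral_tensor w (fun m k => ?_) (fun k => ?_) (fun k x hx => ?_)
        · rcases eq_or_ne k i with rfl | h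
          · rw [Function.update_self]; exact ((hf k).mul (contDiff_cutoff m)).continuous
          · rw [Function.update_of_ne h]; exact (hf k).continuous
        · rcases eq_or_ne k i with rfl | h
          · simpa only [Function.update_self] using exists_bound_mul_cutoff (hf k).continuous
          · simp only [Function.update_of_ne h]
            obtain ⟨C, hC⟩ := isCompact_Icc (a := (0 : ℝ)) (b := 1) |>.exists_bound_of_continuousOn
              (hf k).continuous.continuousOn
            exact ⟨C, fun _ x hx => hC x (Ioo_subset_Icc_self hx)⟩
        · rcases eq_or_ne k i with rfl | h
          · simpa only [Function.update_self] using tendsto_mul_cutoff _ hx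
          · simp only [Function.update_of_ne h]
            exact tendsto_const_nhds
      refine tendsto_nhds_unique (t1.congr fun m => ?_) t2
      refine ih _ (fun k => ?_) (fun k => ?_) (fun k => ?_) (fun k hk => ?_)
      · rcases eq_or_ne k i with rfl | h
        · rw [Function.update_self]; exact (hf k).mul (contDiff_cutoff m)
        · rw [Function.update_of_ne h]; exact hf k
      · rcases eq_or_ne k i with rfl | h
        · rw [Function.update_self, h0, zero_mul]
        · rw [Function.update_of_ne h, h0]
      · rcases eq_or_ne k i with rfl | h
        · rw [Function.update_self, h1, zero_mul]
        · rw [Function.update_of_ne h, h1]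
      · rcases eq_or_ne k i with rfl | h
        · rw [Function.update_self]; exact isTestOne_mul_cutoff (hf k) m
        · rw [Function.update_of_ne h]; exact ht k (by simp [h, hk])
  exact key Finset.univ f hf h0 h1 (by simp)

theorem HasB.coef_eq (hd : d = 2 ∨ d = 3) {τ : ℝ} (hτ : τ ≠ 0) {v w : L2 d} (h : HasB τ v w)
    (n : Fin d → ℕ) :
    coef (fun _ => true) n w = splitSymbol τ n * coef (fun _ => true) n v := by
  have h1 := h.integral_tensor hd (f := fun i => trig true (n i)) (fun i => contDiff_trig _ _)
    (fun i => trig_true_zero _) fun i => trig_true_one _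
  have h2 := splitB_mode hd hτ n
  change ∫ x in cube d, v x * splitB d τ (mode (fun _ => true) n) x
    = coef (fun _ => true) n w at h1
  rw [h2] at h1
  rw [← h1, coef, ← integral_const_mul]
  congr 1
  funext x
  ring

end Symbols

end DirSplit

namespace DirSplit

/-! ### Fourier multipliers and the concrete operators -/

section Multipliers

variable {d : ℕ}

/-- A multiplier may map one trigonometric system to another, as differentiation does. The last
hypothesis guarantees that the prescribed coefficients vanish wherever the target system has no
mode. -/
theorem exists_multiplier (σ σ' : Fin d → Bool) {m : (Fin d → ℕ) → ℝ} {C : ℝ}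
    (hm : ∀ n, |m n| ≤ C) (h0 : ∀ n i, σ' i = true → n i = 0 → σ i = true ∨ m n = 0) :
    ∃ M : L2 d →L[ℝ] L2 d, ∀ v n, coef σ' n (M v) = m n * coef σ n v := by
  have hb : ∀ (v : L2 d) n, (m n * coef σ n v) ^ 2 ≤ C ^ 2 * coef σ n v ^ 2 := fun v n => by
    rw [mul_pow]
    refine mul_le_mul_of_nonneg_right ?_ (sq_nonneg _)
    rw [← sq_abs]
    exact pow_le_pow_left₀ (abs_nonneg _) (hm n) 2
  have hs : ∀ v : L2 d, Summable fun n => (m n * coef σ n v) ^ 2 := fun v =>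
    Summable.of_nonneg_of_le (fun _ => sq_nonneg _) (hb v)
      ((hasSum_coef_sq σ v).summable.mul_left _)
  choose f hf using fun v : L2 d => exists_coef_eq σ' (hs v) fun n i h1 h2 => by
    rcases h0 n i h1 h2 with h | h
    · rw [coef_eq_zero h h2, mul_zero]
    · rw [h, zero_mul]
  have hC : 0 ≤ C := (abs_nonneg _).trans (hm 0)
  let L : L2 d →ₗ[ℝ] L2 d :=
    { toFun := f
      map_add' := fun v w => eq_of_coef_eq (σ := σ') fun n => by
        rw [coef_add, hf, hf, hf, coef_add, mul_add]
      map_smul' := fun a v => eq_of_coef_eq (σ := σ') fun n => by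
        rw [RingHom.id_apply, coef_smul, hf, hf, coef_smul]; ring }
  refine ⟨L.mkContinuous C fun v => ?_, hf⟩
  have h1 := hasSum_coef_sq σ' (f v)
  have h2 := (hasSum_coef_sq σ v).mul_left (C ^ 2)
  have h3 : ‖f v‖ ^ 2 ≤ (C * ‖v‖) ^ 2 := by
    rw [mul_pow]
    exact hasSum_le (fun n => by rw [hf]; exact hb v n) h1 h2
  exact abs_le_of_sq_le_sq' h3 (by positivity) |>.2

/-- The symbol `τ⁻¹ ∏ (1 + τ/2 (n i π)²)` of the operator inverted in one velocity step. -/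
noncomputable def stepSymbol (τ : ℝ) (n : Fin d → ℕ) : ℝ := τ⁻¹ * ∏ i, (1 + τ / 2 * freqSq n i)

theorem stepSymbol_eq {τ : ℝ} (hτ : τ ≠ 0) (n : Fin d → ℕ) :
    stepSymbol τ n = τ⁻¹ + 1 / 2 * lapSymbol n + τ / 4 * splitSymbol τ n := by
  rw [stepSymbol, splitSymbol]
  field_simp
  ring

theorem stepSymbol_pos {τ : ℝ} (hτ : 0 < τ) (n : Fin d → ℕ) : 0 < stepSymbol τ n := by
  refine mul_pos (by positivity) (Finset.prod_pos fun i _ => ?_)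
  have := freqSq_nonneg n i
  positivity

theorem inv_le_stepSymbol {τ : ℝ} (hτ : 0 < τ) (n : Fin d → ℕ) : τ⁻¹ ≤ stepSymbol τ n := by
  rw [stepSymbol_eq hτ.ne']
  have h1 := lapSymbol_nonneg n
  have h2 := splitSymbol_nonneg hτ n
  have : 0 ≤ τ / 4 * splitSymbol τ n := by positivity
  linarith

theorem lapSymbol_le_stepSymbol {τ : ℝ} (hτ : 0 < τ) (n : Fin d → ℕ) :
    lapSymbol n ≤ 2 * stepSymbol τ n := by
  rw [stepSymbol_eq hτ.ne']
  have h2 := splitSymbol_nonneg hτ n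
  have : 0 ≤ τ / 4 * splitSymbol τ n := by positivity
  have : 0 < τ⁻¹ := by positivity
  linarith

theorem splitSymbol_le_stepSymbol {τ : ℝ} (hτ : 0 < τ) (n : Fin d → ℕ) :
    splitSymbol τ n ≤ 4 / τ * stepSymbol τ n := by
  rw [stepSymbol_eq hτ.ne']
  have h1 := lapSymbol_nonneg n
  have h3 : 4 / τ * (τ / 4 * splitSymbol τ n) = splitSymbol τ n := by field_simp
  have h4 : 0 ≤ 4 / τ * (τ⁻¹ + 1 / 2 * lapSymbol n) := by positivity
  linarith

theorem freqSq_le_lapSymbol (n : Fin d → ℕ) (i : Fin d) : freqSq n i ≤ lapSymbol n :=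
  Finset.single_le_sum (fun k _ => freqSq_nonneg n k) (Finset.mem_univ i)

theorem prod_subset_le_prod_one_add {ι : Type*} {s t : Finset ι} (hst : t ⊆ s) {x : ι → ℝ}
    (hx : ∀ i, 0 ≤ x i) : ∏ i ∈ t, x i ≤ ∏ i ∈ s, (1 + x i) := by
  rw [Finset.prod_one_add]
  exact Finset.single_le_sum (f := fun t => ∏ i ∈ t, x i)
    (fun t _ => Finset.prod_nonneg fun i _ => hx i) (Finset.mem_powerset.2 hst)

/-- The step operator contains the mixed products of the splitting, so the velocity space controls
mixed second derivatives, with a constant depending on `τ`. Only their existence matters below. -/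
theorem freqSq_mul_freqSq_le {τ : ℝ} (hτ : 0 < τ) (n : Fin d → ℕ) {i k : Fin d} (hik : i ≠ k) :
    freqSq n i * freqSq n k ≤ 4 / τ * stepSymbol τ n := by
  have h := prod_subset_le_prod_one_add (Finset.subset_univ {i, k})
    (x := fun i => τ / 2 * freqSq n i) fun i => by
      have := freqSq_nonneg n i
      positivity
  rw [Finset.prod_pair hik] at h
  rw [stepSymbol]
  have e : 4 / τ * (τ⁻¹ * ∏ i, (1 + τ / 2 * freqSq n i))
      = 4 / τ ^ 2 * ∏ i, (1 + τ / 2 * freqSq n i) := by field_simp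
  rw [e]
  refine le_trans (le_of_eq ?_) (mul_le_mul_of_nonneg_left h (by positivity))
  field_simp
  ring

/-- The symbol `∏ (1 + (n i π)²)` of the operator `A`. -/
noncomputable def pressSymbol (n : Fin d → ℕ) : ℝ := ∏ i, (1 + freqSq n i)

theorem one_add_lapSymbol_le (n : Fin d → ℕ) : 1 + lapSymbol n ≤ pressSymbol n :=
  one_add_sum_le_prod_one_add Finset.univ (freqSq_nonneg n)

theorem pressSymbol_pos (n : Fin d → ℕ) : 0 < pressSymbol n := by
  linarith [one_add_lapSymbol_le n, lapSymbol_nonneg n]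

theorem abs_mul_inv_sqrt_le {a s C : ℝ} (hs : 0 < s) (hC : 0 ≤ C) (h : a ^ 2 ≤ C ^ 2 * s) :
    |a * (√s)⁻¹| ≤ C := by
  have hs' : 0 < √s := Real.sqrt_pos.2 hs
  rw [abs_mul, abs_of_pos (inv_pos.2 hs'), ← div_eq_mul_inv, div_le_iff₀ hs']
  refine abs_le_of_sq_le_sq ?_ (by positivity)
  rwa [mul_pow, Real.sq_sqrt hs.le]

/-- Velocity fields. -/
abbrev VelSpace (d : ℕ) := PiLp 2 fun _ : Fin d => L2 d

/-- Gradients of velocity fields. -/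
abbrev GradSpace (d : ℕ) := PiLp 2 fun _ : Fin d × Fin d => L2 d

/-- The operators of the direction splitting scheme, diagonal in trigonometric systems. The velocity
space is parametrized by `L²`, through the square root of the operator inverted in one velocity
step, and so is the space of pressure corrections, through the square root of `A`. -/
structure SplitOperators (d : ℕ) (τ : ℝ) where
  ι : VelSpace d →L[ℝ] VelSpace d
  D : VelSpace d →L[ℝ] GradSpace d
  β : VelSpace d →L[ℝ] VelSpace d
  j : L2 d →L[ℝ] L2 d
  coef_ι : ∀ w k n, coef (fun _ => true) n (ι w k)
    = (√(stepSymbol τ n))⁻¹ * coef (fun _ => true) n (w k)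
  coef_D : ∀ w i k n, coef (Function.update (fun _ => true) i false) n (D w (i, k))
    = n i * Real.pi * (√(stepSymbol τ n))⁻¹ * coef (fun _ => true) n (w k)
  coef_β : ∀ w k n, coef (fun _ => true) n (β w k)
    = √(splitSymbol τ n) * (√(stepSymbol τ n))⁻¹ * coef (fun _ => true) n (w k)
  coef_j : ∀ ψ n, coef (fun _ => false) n (j ψ)
    = (√(pressSymbol n))⁻¹ * coef (fun _ => false) n ψ

theorem SplitOperators.nonempty (d : ℕ) {τ : ℝ} (hτ : 0 < τ) : Nonempty (SplitOperators d τ) := by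
  obtain ⟨Mι, hι⟩ := exists_multiplier (d := d) (fun _ => true) (fun _ => true)
    (m := fun n => (√(stepSymbol τ n))⁻¹) (C := √τ) (fun n => by
      have := abs_mul_inv_sqrt_le (a := 1) (stepSymbol_pos hτ n) (Real.sqrt_nonneg τ) (by
        rw [Real.sq_sqrt hτ.le, one_pow]
        have := mul_le_mul_of_nonneg_left (inv_le_stepSymbol hτ n) hτ.le
        rwa [mul_inv_cancel₀ hτ.ne'] at this)
      rwa [one_mul] at this) (fun _ _ _ _ => Or.inl rfl)
  have hDi := fun i : Fin d => exists_multiplier (fun _ => true)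
    (Function.update (fun _ => true) i false)
    (m := fun n => n i * Real.pi * (√(stepSymbol τ n))⁻¹) (C := √2) (fun n =>
      abs_mul_inv_sqrt_le (stepSymbol_pos hτ n) (Real.sqrt_nonneg 2) (by
        rw [Real.sq_sqrt zero_le_two]
        exact (freqSq_le_lapSymbol n i).trans (lapSymbol_le_stepSymbol hτ n)))
    (fun _ _ _ _ => Or.inl rfl)
  choose MD hD using hDi
  obtain ⟨Mβ, hβ⟩ := exists_multiplier (d := d) (fun _ => true) (fun _ => true)
    (m := fun n => √(splitSymbol τ n) * (√(stepSymbol τ n))⁻¹) (C := √(4 / τ)) (fun n =>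
      abs_mul_inv_sqrt_le (stepSymbol_pos hτ n) (Real.sqrt_nonneg _) (by
        rw [Real.sq_sqrt (splitSymbol_nonneg hτ n), Real.sq_sqrt (by positivity : (0 : ℝ) ≤ 4 / τ)]
        exact splitSymbol_le_stepSymbol hτ n)) (fun _ _ _ _ => Or.inl rfl)
  obtain ⟨Mj, hj⟩ := exists_multiplier (d := d) (fun _ => false) (fun _ => false)
    (m := fun n => (√(pressSymbol n))⁻¹) (C := 1) (fun n => by
      have := abs_mul_inv_sqrt_le (a := 1) (pressSymbol_pos n) zero_le_one (by
        linarith [one_add_lapSymbol_le n, lapSymbol_nonneg n])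
      rwa [one_mul] at this) (fun _ _ h _ => by simp at h)
  exact ⟨{
    ι := (PiLp.continuousLinearEquiv 2 ℝ fun _ : Fin d => L2 d).symm.toContinuousLinearMap ∘L
      ContinuousLinearMap.pi fun k => Mι ∘L PiLp.proj 2 (fun _ : Fin d => L2 d) k
    D := (PiLp.continuousLinearEquiv 2 ℝ fun _ : Fin d × Fin d => L2 d).symm.toContinuousLinearMap ∘L
      ContinuousLinearMap.pi fun p => MD p.1 ∘L PiLp.proj 2 (fun _ : Fin d => L2 d) p.2
    β := (PiLp.continuousLinearEquiv 2 ℝ fun _ : Fin d => L2 d).symm.toContinuousLinearMap ∘L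
      ContinuousLinearMap.pi fun k => Mβ ∘L PiLp.proj 2 (fun _ : Fin d => L2 d) k
    j := Mj
    coef_ι := fun w k n => hι (w k) n
    coef_D := fun w i k n => hD i (w k) n
    coef_β := fun w k n => hβ (w k) n
    coef_j := hj }⟩

namespace SplitOperators

variable {τ : ℝ} (O : SplitOperators d τ)

/-- The divergence of a velocity field. -/
noncomputable def dv : VelSpace d →L[ℝ] L2 d :=
  ∑ i, PiLp.proj 2 (fun _ : Fin d × Fin d => L2 d) (i, i) ∘L O.D

theorem dv_apply (w : VelSpace d) : O.dv w = ∑ i, O.D w (i, i) := by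
  simp [dv]

theorem hasDerivZeroTrace (w : VelSpace d) (i k : Fin d) :
    HasDerivZeroTrace i (O.ι w k) (O.D w (i, k)) :=
  hasDerivZeroTrace_of_coef (σ := fun _ => true) rfl fun n => by
    rw [O.coef_D, O.coef_ι]; ring

/-- Integrate by parts twice through the mixed derivative `∂ᵢ∂ₖ wᵢ = M (w i)`. It is in `L²` by the
control of mixed derivatives in the velocity space, and the zero traces remove the boundary terms.
-/
theorem inner_D_comm (hτ : 0 < τ) (w : VelSpace d) (i k : Fin d) :
    inner ℝ (O.D w (i, i)) (O.D w (k, k)) = inner ℝ (O.D w (k, i)) (O.D w (i, k)) := by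
  rcases eq_or_ne i k with rfl | hik
  · rfl
  obtain ⟨M, hM⟩ := exists_multiplier (d := d) (fun _ => true)
    (Function.update (Function.update (fun _ => true) i false) k false)
    (m := fun n => (n i * Real.pi * (n k * Real.pi)) * (√(stepSymbol τ n))⁻¹) (C := √(4 / τ))
    (fun n => abs_mul_inv_sqrt_le (stepSymbol_pos hτ n) (Real.sqrt_nonneg _) (by
        rw [Real.sq_sqrt (by positivity), mul_pow]
        exact freqSq_mul_freqSq_le hτ n hik)) (fun _ _ _ _ => Or.inl rfl)
  have h1 : HasDerivZeroTrace k (O.D w (i, i)) (M (w i)) := by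
    refine hasDerivZeroTrace_of_coef (σ := Function.update (fun _ => true) i false)
      (by rw [Function.update_of_ne hik.symm]) fun n => ?_
    rw [hM, O.coef_D]; ring
  have h2 : HasDerivZeroTrace i (O.D w (k, i)) (M (w i)) := by
    refine hasDerivZeroTrace_of_coef (σ := Function.update (fun _ => true) k false)
      (by rw [Function.update_of_ne hik]) fun n => ?_
    rw [Function.update_comm hik.symm, hM, O.coef_D]; ring
  rw [h1.inner_eq (O.hasDerivZeroTrace w k k).hasWeakDeriv,
    h2.inner_eq (O.hasDerivZeroTrace w i k).hasWeakDeriv]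

/-- Expanding the square of the divergence, each product of diagonal derivatives equals a product of
transposed ones, and Young's inequality with constant one loses nothing after summation. -/
theorem norm_dv_le (hτ : 0 < τ) (w : VelSpace d) : ‖O.dv w‖ ≤ ‖O.D w‖ := by
  refine abs_le_of_sq_le_sq' ?_ (norm_nonneg _) |>.2
  rw [PiLp.norm_sq_eq_of_L2, Fintype.sum_prod_type, O.dv_apply, ← real_inner_self_eq_norm_sq,
    sum_inner]
  simp only [inner_sum]
  have h : ∀ i k, inner ℝ (O.D w (i, i)) (O.D w (k, k))
      ≤ 1 / 2 * ‖O.D w (k, i)‖ ^ 2 + 1 / 2 * ‖O.D w (i, k)‖ ^ 2 := fun i k => by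
    rw [O.inner_D_comm hτ]
    have := real_inner_le_norm (O.D w (k, i)) (O.D w (i, k))
    nlinarith [sq_nonneg (‖O.D w (k, i)‖ - ‖O.D w (i, k)‖)]
  refine (Finset.sum_le_sum fun i _ => Finset.sum_le_sum fun k _ => h i k).trans ?_
  simp only [Finset.sum_add_distrib]
  rw [Finset.sum_comm]
  simp only [← Finset.mul_sum]
  linarith

theorem inner_component (hτ : 0 < τ) (v w : VelSpace d) (k : Fin d) :
    inner ℝ (v k) (w k) = τ⁻¹ * inner ℝ (O.ι v k) (O.ι w k)
      + 1 / 2 * ∑ i, inner ℝ (O.D v (i, k)) (O.D w (i, k))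
      + τ / 4 * inner ℝ (O.β v k) (O.β w k) := by
  have h1 := (hasSum_coef_mul_coef (fun _ => true) (O.ι v k) (O.ι w k)).mul_left τ⁻¹
  have h2 := (hasSum_sum fun i (_ : i ∈ Finset.univ) =>
    hasSum_coef_mul_coef (Function.update (fun _ => true) i false) (O.D v (i, k))
      (O.D w (i, k))).mul_left (1 / 2)
  have h3 := (hasSum_coef_mul_coef (fun _ => true) (O.β v k) (O.β w k)).mul_left (τ / 4)
  refine (hasSum_coef_mul_coef (fun _ => true) (v k) (w k)).unique
    (((h1.add h2).add h3).congr_fun fun n => ?_)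
  simp only [O.coef_D, O.coef_ι, O.coef_β]
  have hs := stepSymbol_pos hτ n
  have hs' : 0 < √(stepSymbol τ n) := Real.sqrt_pos.2 hs
  have e1 : (√(stepSymbol τ n))⁻¹ ^ 2 = (stepSymbol τ n)⁻¹ := by
    rw [inv_pow, Real.sq_sqrt hs.le]
  have e2 : √(splitSymbol τ n) ^ 2 = splitSymbol τ n := Real.sq_sqrt (splitSymbol_nonneg hτ n)
  have e3 : ∑ i, n i * Real.pi * (√(stepSymbol τ n))⁻¹ * coef (fun _ => true) n (v k)
        * (n i * Real.pi * (√(stepSymbol τ n))⁻¹ * coef (fun _ => true) n (w k))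
      = lapSymbol n * ((√(stepSymbol τ n))⁻¹ ^ 2 * (coef (fun _ => true) n (v k)
        * coef (fun _ => true) n (w k))) := by
    rw [lapSymbol, Finset.sum_mul]
    refine Finset.sum_congr rfl fun i _ => ?_
    rw [freqSq]; ring
  rw [e3]
  calc coef (fun _ => true) n (v k) * coef (fun _ => true) n (w k)
      = (stepSymbol τ n * (stepSymbol τ n)⁻¹) *
        (coef (fun _ => true) n (v k) * coef (fun _ => true) n (w k)) := by
        rw [mul_inv_cancel₀ hs.ne', one_mul]
    _ = (τ⁻¹ + 1 / 2 * lapSymbol n + τ / 4 * √(splitSymbol τ n) ^ 2) * (√(stepSymbol τ n))⁻¹ ^ 2 *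
        (coef (fun _ => true) n (v k) * coef (fun _ => true) n (w k)) := by
        rw [e1, e2, ← stepSymbol_eq hτ.ne']
    _ = _ := by ring

/-- The derivative is defined by coefficients in a mixed system, while the pairing with pressures
needs those in the pure cosine system; the zero trace connects the two. -/
theorem coef_D_cos (w : VelSpace d) (i : Fin d) (n : Fin d → ℕ) :
    coef (fun _ => false) n (O.D w (i, i))
      = n i * Real.pi * coef (Function.update (fun _ => false) i true) n (O.ι w i) := by
  have h := (O.hasDerivZeroTrace w i i).coef_eq
    (σ := Function.update (fun _ => false) i true) (by simp) n
  rwa [Function.update_idem, Function.update_eq_self i (fun _ : Fin d => false)] at h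

/-- After integration by parts, `r i ψ` is `-∂ᵢ A^{-1/2} ψ`. Its norms sum to at most `‖ψ‖²` since
the symbol of `-Δ` is below that of `A`. -/
theorem inner_dv_j_le (w : VelSpace d) (ψ : L2 d) :
    inner ℝ (O.dv w) (O.j ψ) ≤ ‖O.ι w‖ * ‖ψ‖ := by
  have hr := fun i : Fin d => exists_multiplier (fun _ => false)
    (Function.update (fun _ => false) i true)
    (m := fun n => n i * Real.pi * (√(pressSymbol n))⁻¹) (C := 1) (fun n =>
      abs_mul_inv_sqrt_le (pressSymbol_pos n) zero_le_one (by
        have h1 := freqSq_le_lapSymbol n i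
        have h2 := one_add_lapSymbol_le n
        rw [freqSq] at h1
        linarith))
    (fun n k h hk => by
      rcases eq_or_ne k i with rfl | hki
      · right; simp [hk]
      · rw [Function.update_of_ne hki] at h
        simp at h)
  choose r hr using hr
  let R : VelSpace d := WithLp.toLp 2 fun i => r i ψ
  have h1 : inner ℝ (O.dv w) (O.j ψ) = inner ℝ (O.ι w) R := by
    rw [O.dv_apply, sum_inner, PiLp.inner_apply]
    refine Finset.sum_congr rfl fun i _ => ?_
    refine (hasSum_coef_mul_coef (fun _ => false) (O.D w (i, i)) (O.j ψ)).unique ?_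
    refine (hasSum_coef_mul_coef (Function.update (fun _ => false) i true) (O.ι w i)
      (r i ψ)).congr_fun fun n => ?_
    rw [O.coef_D_cos, O.coef_j, hr]
    ring
  have h2 : ‖R‖ ≤ ‖ψ‖ := by
    refine abs_le_of_sq_le_sq' ?_ (norm_nonneg _) |>.2
    rw [PiLp.norm_sq_eq_of_L2]
    refine hasSum_le (fun n => ?_) (hasSum_sum fun i (_ : i ∈ Finset.univ) =>
      hasSum_coef_sq (Function.update (fun _ => false) i true) (r i ψ))
      (hasSum_coef_sq (fun _ => false) ψ)
    have hp := pressSymbol_pos n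
    have e : ∑ i, coef (Function.update (fun _ => false) i true) n (r i ψ) ^ 2
        = lapSymbol n / pressSymbol n * coef (fun _ => false) n ψ ^ 2 := by
      rw [lapSymbol, Finset.sum_div, Finset.sum_mul]
      refine Finset.sum_congr rfl fun i _ => ?_
      rw [hr, mul_pow, mul_pow, inv_pow, Real.sq_sqrt hp.le, freqSq]
      ring
    rw [e]
    refine mul_le_of_le_one_left (sq_nonneg _) ((div_le_one hp).2 ?_)
    linarith [one_add_lapSymbol_le n]
  rw [h1]
  exact (real_inner_le_norm _ _).trans (mul_le_mul_of_nonneg_left h2 (norm_nonneg _))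

theorem splitForms (hτ : 0 < τ) : SplitForms τ O.ι O.D O.β O.dv O.j where
  inner_eq v w := by
    simp only [PiLp.inner_apply]
    rw [Fintype.sum_prod_type, Finset.sum_comm, Finset.mul_sum, Finset.mul_sum, Finset.mul_sum,
      ← Finset.sum_add_distrib, ← Finset.sum_add_distrib]
    exact Finset.sum_congr rfl fun k _ => O.inner_component hτ v w k
  div_le := O.norm_dv_le hτ
  pair_le := O.inner_dv_j_le

end SplitOperators

end Multipliers

end DirSplit

namespace DirSplit

/-! ### Lifting exact and discrete fields to the abstract spaces -/

section Lifts

variable {d : ℕ}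

theorem HasDerivZeroTrace.sub {i : Fin d} {v g v' g' : L2 d} (h : HasDerivZeroTrace i v g)
    (h' : HasDerivZeroTrace i v' g') : HasDerivZeroTrace i (v - v') (g - g') :=
  hasDerivZeroTrace_of_coef (σ := fun _ => true) rfl fun n => by
    rw [coef_sub, coef_sub, h.coef_eq (σ := fun _ => true) rfl,
      h'.coef_eq (σ := fun _ => true) rfl]
    ring

theorem HasWeakDiv.sub {v v' : Fin d → L2 d} {g g' : L2 d} (h : HasWeakDiv v g)
    (h' : HasWeakDiv v' g') : HasWeakDiv (v - v') (g - g') := by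
  intro φ hφ
  have h1 := h φ hφ
  have h2 := h' φ hφ
  have e : ∀ (w : L2 d) i, ∫ x in cube d, w x * pd i φ x
      = inner ℝ w (toL2 (contDiff_pd hφ.1 i).continuous) := fun w i => (inner_toL2 _ _).symm
  simp only [e] at h1 h2 ⊢
  rw [← inner_toL2 _ hφ.1.continuous] at h1 h2 ⊢
  simp only [Pi.sub_apply, inner_sub_left, Finset.sum_sub_distrib]
  rw [h1, h2]
  ring

theorem HasWeakDiv.midpoint {v v' : Fin d → L2 d} {g g' : L2 d} (h : HasWeakDiv v g)
    (h' : HasWeakDiv v' g') :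
    HasWeakDiv (fun j => (1 / 2 : ℝ) • (v j + v' j)) ((1 / 2 : ℝ) • (g + g')) := by
  intro φ hφ
  have h1 := h φ hφ
  have h2 := h' φ hφ
  have e : ∀ (w : L2 d) i, ∫ x in cube d, w x * pd i φ x
      = inner ℝ w (toL2 (contDiff_pd hφ.1 i).continuous) := fun w i => (inner_toL2 _ _).symm
  simp only [e] at h1 h2 ⊢
  rw [← inner_toL2 _ hφ.1.continuous] at h1 h2 ⊢
  simp only [inner_smul_left, inner_add_left, ← Finset.mul_sum, Finset.sum_add_distrib,
    conj_trivial]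
  rw [h1, h2]
  ring

theorem HasLaplacian.coef_eq {v w : L2 d} (hv : MemH10 v) (h : HasLaplacian v w)
    (n : Fin d → ℕ) :
    coef (fun _ => true) n w = -(lapSymbol n * coef (fun _ => true) n v) := by
  obtain ⟨g, hg, rfl⟩ := h
  rw [coef_sum, lapSymbol, Finset.sum_mul, ← Finset.sum_neg_distrib]
  refine Finset.sum_congr rfl fun i _ => ?_
  obtain ⟨r, hr⟩ := hv i
  exact hr.coef_second_eq (hg i) rfl n

theorem HasNeumannD2.coef_eq {i : Fin d} {ψ h : L2 d} (hψ : HasNeumannD2 i ψ h) (n : Fin d → ℕ) :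
    coef (fun _ => false) n h = -(freqSq n i * coef (fun _ => false) n ψ) := by
  obtain ⟨r, h1, h2⟩ := hψ
  have h3 := h2.coef_eq (σ := Function.update (fun _ => false) i true) (by simp) n
  rw [h1.coef_eq_single (by simp), Function.update_idem,
    Function.update_eq_self i (fun _ : Fin d => false)] at h3
  rw [h3, freqSq]
  ring

theorem HasA.coef_eq (hd : d = 2 ∨ d = 3) {q g : L2 d} (h : HasA q g) (n : Fin d → ℕ) :
    coef (fun _ => false) n g = pressSymbol n * coef (fun _ => false) n q := by
  obtain ⟨-, ψ, rfl, rfl, h⟩ := h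
  have h1 : ∀ i : Fin d, coef (fun _ => false) n (ψ i.castSucc)
      = (1 + freqSq n i) * coef (fun _ => false) n (ψ i.succ) := fun i => by
    obtain ⟨r, h2, h3⟩ := h i
    rw [h3, coef_sub, h2.coef_eq]
    ring
  rcases hd with rfl | rfl
  · rw [pressSymbol, Fin.prod_univ_two, mul_assoc]
    exact (h1 0).trans (congrArg _ (h1 1))
  · rw [pressSymbol, Fin.prod_univ_three, mul_assoc, mul_assoc]
    exact (h1 0).trans (congrArg _ ((h1 1).trans (congrArg _ (h1 2))))

/-- `v` is in the domain of the operator inverted in one velocity step. -/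
def IsStepRegular (τ : ℝ) (v : L2 d) : Prop :=
  ∃ g : L2 d, ∀ n, coef (fun _ => true) n g = stepSymbol τ n * coef (fun _ => true) n v

theorem HasB.isStepRegular (hd : d = 2 ∨ d = 3) {τ : ℝ} (hτ : τ ≠ 0) {v w l : L2 d}
    (h : HasB τ v w) (hl : HasLaplacian v l) : IsStepRegular τ v :=
  ⟨τ⁻¹ • v - (1 / 2 : ℝ) • l + (τ / 4) • w, fun n => by
    rw [coef_add, coef_sub, coef_smul, coef_smul, coef_smul, h.coef_eq hd hτ, hl.coef_eq h.1,
      stepSymbol_eq hτ]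
    ring⟩

theorem IsStepRegular.sub {τ : ℝ} {v w : L2 d} (hv : IsStepRegular τ v) (hw : IsStepRegular τ w) :
    IsStepRegular τ (v - w) := by
  obtain ⟨g, hg⟩ := hv
  obtain ⟨g', hg'⟩ := hw
  exact ⟨g - g', fun n => by rw [coef_sub, hg, hg', coef_sub]; ring⟩

/-- Solve the step equation for the new value: the Laplacian of the old one is in `L²`, because its
symbol is at most twice that of the step operator. -/
theorem IsStepRegular.of_step {τ : ℝ} (hτ : 0 < τ) {v v' F : L2 d} (hv : IsStepRegular τ v)
    (h : ∀ n, stepSymbol τ n * (coef (fun _ => true) n v' - coef (fun _ => true) n v)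
      + lapSymbol n * coef (fun _ => true) n v = coef (fun _ => true) n F) :
    IsStepRegular τ v' := by
  obtain ⟨g, hg⟩ := hv
  obtain ⟨M, hM⟩ := exists_multiplier (d := d) (fun _ => true) (fun _ => true)
    (m := fun n => lapSymbol n / stepSymbol τ n) (C := 2) (fun n => by
      have hs := stepSymbol_pos hτ n
      rw [abs_of_nonneg (div_nonneg (lapSymbol_nonneg n) hs.le), div_le_iff₀ hs]
      exact lapSymbol_le_stepSymbol hτ n) (fun _ _ _ _ => Or.inl rfl)
  refine ⟨g - M g + F, fun n => ?_⟩
  have hs := stepSymbol_pos hτ n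
  rw [coef_add, coef_sub, hM, hg, ← h n]
  field_simp
  ring

/-- All intermediate fields are eliminated on sine coefficients, which leaves the factorized form of
the step. Each intermediate field needs its zero trace only in the direction of its own second
derivative; the previous velocity needs it on further faces. -/
theorem VelocityUpdate.coef_eq (hd : d = 2 ∨ d = 3) {τ : ℝ} (hτ : 0 < τ) {F u u' : Fin d → L2 d}
    {ps : L2 d} (hu : ∀ j, MemH10 (u j)) (h : VelocityUpdate d τ F ps u u') (j : Fin d) :
    ∃ grad, HasWeakDeriv [j] ps grad ∧ ∀ n,
      stepSymbol τ n * (coef (fun _ => true) n (u' j) - coef (fun _ => true) n (u j))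
        + lapSymbol n * coef (fun _ => true) n (u j) = coef (fun _ => true) n (F j - grad) := by
  rcases hd with rfl | rfl
  · obtain ⟨uh, h⟩ := h
    obtain ⟨uhxx, uyy, uyy', grad, h1, h2, h3, h4, ⟨z0, hz0⟩, ⟨z1, hz1⟩, e1, e2⟩ := h j
    obtain ⟨z2, hz2⟩ := hu j 1
    refine ⟨grad, h4, fun n => ?_⟩
    have c1 := hz0.coef_second_eq h1 (σ := fun _ => true) rfl n
    have c2 := hz2.coef_second_eq h2 (σ := fun _ => true) rfl n
    have c3 := hz1.coef_second_eq h3 (σ := fun _ => true) rfl n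
    have e1 := congrArg (coef (fun _ => true) n) e1
    have e2 := congrArg (coef (fun _ => true) n) e2
    simp only [coef_add, coef_sub, coef_smul, c1, c2, c3] at e1 e2
    simp only [coef_sub, stepSymbol, lapSymbol, Fin.prod_univ_two, Fin.sum_univ_two, freqSq]
    rw [show (τ / 2)⁻¹ = 2 * τ⁻¹ by rw [inv_div]; ring] at e1 e2
    have hr := mul_inv_cancel₀ hτ.ne'
    set r := τ⁻¹
    set X := ((n 0 : ℝ) * Real.pi) ^ 2
    set Y := ((n 1 : ℝ) * Real.pi) ^ 2
    set U := coef (fun _ => true) n (u j)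
    set U' := coef (fun _ => true) n (u' j)
    -- The half-step velocity enters with factors `2r + X` and `X - 2r`, so these weights cancel it;
    -- the terms with `hr` replace `τ r` by one.
    linear_combination (τ / 4 * (2 * r - X)) * e1 + (τ / 4 * (2 * r + X)) * e2
      + (coef (fun _ => true) n (F j) - coef (fun _ => true) n grad - X * U - Y * U - r * U' + r * U
        + τ / 4 * X * Y * (U' - U)) * hr
  · obtain ⟨ξ, η, ζ, h⟩ := h
    obtain ⟨lap, grad, a, b, c, hl, h4, h1, h2, h3, ⟨z0, hz0⟩, ⟨z1, hz1⟩, ⟨z2, hz2⟩, e1, e2, e3, e4⟩ :=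
      h j
    obtain ⟨w0, hw0⟩ := hu j 0
    obtain ⟨w1, hw1⟩ := hu j 1
    obtain ⟨w2, hw2⟩ := hu j 2
    refine ⟨grad, h4, fun n => ?_⟩
    have c0 := hl.coef_eq (hu j) n
    have c1 := (hz0.sub hw0).coef_second_eq h1 (σ := fun _ => true) rfl n
    have c2 := (hz1.sub hw1).coef_second_eq h2 (σ := fun _ => true) rfl n
    have c3 := (hz2.sub hw2).coef_second_eq h3 (σ := fun _ => true) rfl n
    have e1 := congrArg (coef (fun _ => true) n) e1
    have e2 := congrArg (coef (fun _ => true) n) e2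
    have e3 := congrArg (coef (fun _ => true) n) e3
    have e4 := congrArg (coef (fun _ => true) n) e4
    rw [coef_sub] at c1 c2 c3
    simp only [coef_add, coef_sub, coef_smul, coef_zero, c0, c1, c2, c3] at e1 e2 e3 e4
    rw [coef_sub, stepSymbol, Fin.prod_univ_three, freqSq, freqSq, freqSq]
    have hr := mul_inv_cancel₀ hτ.ne'
    set r := τ⁻¹
    set X := ((n 0 : ℝ) * Real.pi) ^ 2
    set Y := ((n 1 : ℝ) * Real.pi) ^ 2
    set Z := ((n 2 : ℝ) * Real.pi) ^ 2
    set U := coef (fun _ => true) n (u j)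
    -- Each substep is weighted by the one-dimensional factors of the preceding directions, so the
    -- intermediate fields telescope.
    linear_combination e1 + e2 + (1 + τ / 2 * X) * e3 + (1 + τ / 2 * X) * (1 + τ / 2 * Y) * e4
      + ((1 + τ / 2 * X) * (1 + τ / 2 * Y) * (Z / 2) * (coef (fun _ => true) n (u' j) - U)
        + (1 + τ / 2 * X) * (Y / 2) * (coef (fun _ => true) n (ζ j) - U)
        + X / 2 * (coef (fun _ => true) n (η j) - U)) * hr

namespace SplitOperators

variable {τ : ℝ} (O : SplitOperators d τ)

theorem exists_lift (hτ : 0 < τ) {v : Fin d → L2 d} (hv : ∀ k, IsStepRegular τ (v k)) :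
    ∃ w : VelSpace d, ∀ k, O.ι w k = v k := by
  choose g hg using hv
  refine ⟨O.ι (WithLp.toLp 2 g), fun k => eq_of_coef_eq (σ := fun _ => true) fun n => ?_⟩
  have hs := stepSymbol_pos hτ n
  rw [O.coef_ι, O.coef_ι, ← mul_assoc, ← mul_inv, Real.mul_self_sqrt hs.le]
  change _ * coef _ n (g k) = _
  rw [hg, inv_mul_cancel_left₀ hs.ne']

/-- The scheme prescribes `u^{k+1}` only on the faces of the last direction. The zero trace on all
other faces is recovered here, from the sine expansion. -/
theorem _root_.DirSplit.IsStepRegular.memH10 (hτ : 0 < τ) {v : L2 d} (hv : IsStepRegular τ v) :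
    MemH10 v := fun i => by
  obtain ⟨O⟩ := SplitOperators.nonempty d hτ
  obtain ⟨w, hw⟩ := O.exists_lift hτ fun _ => hv
  exact ⟨_, hw i ▸ O.hasDerivZeroTrace w i i⟩

theorem coef_eq_mul_coef_ι (hτ : 0 < τ) (w : VelSpace d) (k : Fin d) (n : Fin d → ℕ) :
    coef (fun _ => true) n (w k) = √(stepSymbol τ n) * coef (fun _ => true) n (O.ι w k) := by
  rw [O.coef_ι, mul_inv_cancel_left₀ (Real.sqrt_pos.2 (stepSymbol_pos hτ n)).ne']

/-- By Parseval, with the pressure gradient integrated by parts against the zero trace of the test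
field. -/
theorem momentum_of_coef (hτ : 0 < τ) {e e' R : VelSpace d} {q : L2 d} {g : Fin d → L2 d}
    (hg : ∀ k, HasWeakDeriv [k] q (g k))
    (h : ∀ k n, stepSymbol τ n
        * (coef (fun _ => true) n (O.ι e' k) - coef (fun _ => true) n (O.ι e k))
      + lapSymbol n * coef (fun _ => true) n (O.ι e k)
      = coef (fun _ => true) n (R k) - coef (fun _ => true) n (g k)) (w : VelSpace d) :
    τ⁻¹ * inner ℝ (O.ι (e' - e)) (O.ι w) + 1 / 2 * inner ℝ (O.D (e' + e)) (O.D w)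
      + τ / 4 * inner ℝ (O.β (e' - e)) (O.β w) - inner ℝ q (O.dv w) = inner ℝ R (O.ι w) := by
  have h1 := (O.splitForms hτ).inner_eq (e' - e) w
  have h2 : O.D (e' + e) = O.D (e' - e) + (2 : ℝ) • O.D e := by
    rw [← map_smul, ← map_add]
    congr 1
    module
  have h3 : inner ℝ q (O.dv w) = -∑ k, inner ℝ (g k) (O.ι w k) := by
    rw [O.dv_apply, inner_sum, ← Finset.sum_neg_distrib]
    refine Finset.sum_congr rfl fun k _ => ?_
    have := (O.hasDerivZeroTrace w k k).inner_eq (hg k)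
    rw [real_inner_comm (O.ι w k) (g k), this, neg_neg, real_inner_comm]
  have h4 : inner ℝ (e' - e) w + inner ℝ (O.D e) (O.D w) + ∑ k, inner ℝ (g k) (O.ι w k)
      = inner ℝ R (O.ι w) := by
    simp only [PiLp.inner_apply]
    rw [Fintype.sum_prod_type, Finset.sum_comm, ← Finset.sum_add_distrib, ← Finset.sum_add_distrib]
    refine Finset.sum_congr rfl fun k _ => ?_
    have s1 := hasSum_coef_mul_coef (fun _ => true) ((e' - e) k) (w k)
    have s2 := hasSum_sum fun i (_ : i ∈ Finset.univ) =>
      hasSum_coef_mul_coef (Function.update (fun _ => true) i false) (O.D e (i, k)) (O.D w (i, k))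
    have s3 := hasSum_coef_mul_coef (fun _ => true) (g k) (O.ι w k)
    refine ((s1.add s2).add s3).unique
      ((hasSum_coef_mul_coef (fun _ => true) (R k) (O.ι w k)).congr_fun fun n => ?_)
    have e3 : ∑ i, coef (Function.update (fun _ => true) i false) n (O.D e (i, k))
          * coef (Function.update (fun _ => true) i false) n (O.D w (i, k))
        = lapSymbol n * (coef (fun _ => true) n (O.ι e k) * coef (fun _ => true) n (O.ι w k)) := by
      rw [lapSymbol, Finset.sum_mul]
      refine Finset.sum_congr rfl fun i _ => ?_
      rw [(O.hasDerivZeroTrace e i k).coef_eq rfl, (O.hasDerivZeroTrace w i k).coef_eq rfl, freqSq]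
      ring
    rw [e3, PiLp.sub_apply, coef_sub, O.coef_eq_mul_coef_ι hτ e', O.coef_eq_mul_coef_ι hτ e,
      O.coef_eq_mul_coef_ι hτ w]
    have hsq : √(stepSymbol τ n) * √(stepSymbol τ n) = stepSymbol τ n :=
      Real.mul_self_sqrt (stepSymbol_pos hτ n).le
    have h5 := h k n
    rw [← hsq] at h5
    linear_combination coef (fun _ => true) n (O.ι w k) * h5
  rw [h2, inner_add_left, inner_smul_left, h3, ← h4, h1]
  simp only [conj_trivial]
  ring

theorem hasWeakDiv (w : VelSpace d) : HasWeakDiv (fun k => O.ι w k) (O.dv w) := by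
  rw [O.dv_apply]
  exact HasWeakDeriv.hasWeakDiv fun i => (O.hasDerivZeroTrace w i i).hasWeakDeriv

theorem inner_j_left (ψ θ : L2 d) : inner ℝ (O.j ψ) θ = inner ℝ ψ (O.j θ) :=
  (hasSum_coef_mul_coef (fun _ => false) (O.j ψ) θ).unique
    ((hasSum_coef_mul_coef (fun _ => false) ψ (O.j θ)).congr_fun fun n => by
      rw [O.coef_j, O.coef_j]; ring)

theorem j_j_of_hasA (hd : d = 2 ∨ d = 3) {q g : L2 d} (h : HasA q g) : O.j (O.j g) = q :=
  eq_of_coef_eq (σ := fun _ => false) fun n => by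
    have hs := pressSymbol_pos n
    rw [O.coef_j, O.coef_j, ← mul_assoc, ← mul_inv, Real.mul_self_sqrt hs.le, h.coef_eq hd,
      inv_mul_cancel_left₀ hs.ne']

/-- Expand `∏ (1 + (nᵢ π)²)` over subsets `S` of directions. Each term is Parseval for the mixed
derivative along `S`, in the system with sines in `S` and cosines elsewhere. Thus the form norm of
`A` is the norm of `Y`, without boundary conditions. -/
theorem hasSum_pressSymbol {ψ : L2 d} {g : Finset (Fin d) → L2 d}
    (hg : ∀ S : Finset (Fin d), HasWeakDeriv S.toList ψ (g S)) :
    HasSum (fun n => pressSymbol n * coef (fun _ => false) n ψ ^ 2) (∑ S, ‖g S‖ ^ 2) := by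
  refine (hasSum_sum fun S (_ : S ∈ Finset.univ) =>
    hasSum_coef_sq (fun i => decide (i ∈ S)) (g S)).congr_fun fun n => ?_
  rw [pressSymbol, Finset.prod_one_add, Finset.sum_mul, Finset.powerset_univ]
  refine Finset.sum_congr rfl fun S _ => ?_
  rw [(hg S).coef_eq S.nodup_toList (by simp)]
  have e : (fun i => if i ∈ S.toList then false else decide (i ∈ S)) = fun _ => false := by
    funext i
    by_cases hi : i ∈ S <;> simp [hi]
  rw [e, Finset.toList_toFinset, mul_pow, mul_pow, ← pow_mul, mul_comm _ 2, pow_mul,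
    ← Finset.prod_pow]
  simp [freqSq]

theorem exists_press_lift {ψ : L2 d} {g : Finset (Fin d) → L2 d}
    (hg : ∀ S : Finset (Fin d), HasWeakDeriv S.toList ψ (g S)) : ∃ y, O.j y = ψ := by
  obtain ⟨y, hy⟩ := exists_coef_eq (d := d) (fun _ => false)
    (a := fun n => √(pressSymbol n) * coef (fun _ => false) n ψ)
    ((hasSum_pressSymbol hg).summable.congr fun n => by
      rw [mul_pow, Real.sq_sqrt (pressSymbol_pos n).le]) (fun n i h => by simp at h)
  refine ⟨y, eq_of_coef_eq (σ := fun _ => false) fun n => ?_⟩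
  rw [O.coef_j, hy, inv_mul_cancel_left₀ (Real.sqrt_pos.2 (pressSymbol_pos n)).ne']

theorem norm_press_lift_le {y : L2 d} {g : Finset (Fin d) → L2 d}
    (hg : ∀ S : Finset (Fin d), HasWeakDeriv S.toList (O.j y) (g S)) : ‖y‖ ≤ ∑ S, ‖g S‖ := by
  refine abs_le_of_sq_le_sq' ?_ (Finset.sum_nonneg fun _ _ => norm_nonneg _) |>.2
  have h1 : ‖y‖ ^ 2 = ∑ S, ‖g S‖ ^ 2 :=
    (hasSum_coef_sq (fun _ => false) y).unique ((hasSum_pressSymbol hg).congr_fun fun n => by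
      have hs := pressSymbol_pos n
      rw [O.coef_j, mul_pow, inv_pow, Real.sq_sqrt hs.le, mul_inv_cancel_left₀ hs.ne'])
  rw [h1]
  exact Finset.sum_sq_le_sq_sum_of_nonneg fun _ _ => norm_nonneg _

end SplitOperators

end Lifts

end DirSplit

namespace DirSplit

/-! ### Time regularity and consistency -/

section TimeRegularity

variable {d : ℕ} {T : ℝ}

/-- `w` is Lipschitz on `[0,T]` with constant `C`. -/
def LipBound {E : Type*} [NormedAddCommGroup E] (T C : ℝ) (w : ℝ → E) : Prop :=
  ∀ s ∈ Icc 0 T, ∀ t ∈ Icc 0 T, ‖w t - w s‖ ≤ C * |t - s|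

/-- The centered second differences of `w` in `[0,T]` with step `h` are bounded by `C h²`. -/
def SecondDiffBound {E : Type*} [NormedAddCommGroup E] [NormedSpace ℝ E] (T C : ℝ) (w : ℝ → E) :
    Prop :=
  ∀ m h, 0 ≤ h → 0 ≤ m - h → m + h ≤ T → ‖w (m + h) + w (m - h) - (2 : ℝ) • w m‖ ≤ C * h ^ 2

theorem uIcc_subset_of_mem_Icc {s t : ℝ} (hs : s ∈ Icc 0 T) (ht : t ∈ Icc 0 T) :
    uIcc s t ⊆ Icc 0 T := by
  have hT : 0 ≤ T := hs.1.trans hs.2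
  rw [← uIcc_of_le hT] at hs ht ⊢
  exact uIcc_subset_uIcc hs ht

theorem TimeSobolev.lipBound {w : ℝ → L2 d} (h : TimeSobolev T 1 w) :
    ∃ C, 0 ≤ C ∧ LipBound T C w := by
  obtain ⟨w', hw', h⟩ := h
  change MemLp w' ⊤ (volume.restrict (Ioo 0 T)) at hw'
  have hae : ∀ᵐ x ∂volume.restrict (Ioo 0 T), ‖w' x‖ ≤ (eLpNorm w' ⊤
      (volume.restrict (Ioo 0 T))).toReal := by
    filter_upwards [ae_le_eLpNormEssSup (f := w') (μ := volume.restrict (Ioo 0 T))] with x hx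
    rw [eLpNorm_exponent_top]
    have h2 : eLpNormEssSup w' (volume.restrict (Ioo 0 T)) ≠ ⊤ := by
      have := hw'.2.ne
      rwa [eLpNorm_exponent_top] at this
    have h3 := ENNReal.toReal_mono h2 hx
    rwa [toReal_enorm] at h3
  rw [Measure.restrict_congr_set Ioo_ae_eq_Ioc, ae_restrict_iff' measurableSet_Ioc] at hae
  have hint : ∀ t ∈ Icc 0 T, IntervalIntegrable w' volume 0 t := fun t ht => by
    rw [intervalIntegrable_iff_integrableOn_Ioc_of_le ht.1]
    have h1 : IntegrableOn w' (Ioo 0 T) := hw'.integrable le_top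
    rw [← integrableOn_Ioc_iff_integrableOn_Ioo] at h1
    exact h1.mono_set (Ioc_subset_Ioc_right ht.2)
  refine ⟨(eLpNorm w' ⊤ (volume.restrict (Ioc 0 T))).toReal, ENNReal.toReal_nonneg,
    fun s hs t ht => ?_⟩
  rw [h t ht, h s hs, add_sub_add_left_eq_sub,
    intervalIntegral.integral_interval_sub_left (hint t ht) (hint s hs)]
  refine intervalIntegral.norm_integral_le_of_norm_le_const_ae ?_
  filter_upwards [hae] with x hx hx'
  refine hx ⟨?_, ?_⟩
  · exact (le_min hs.1 ht.1).trans_lt hx'.1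
  · exact hx'.2.trans (max_le hs.2 ht.2)

theorem LipBound.continuousOn {E : Type*} [NormedAddCommGroup E] {C : ℝ} {w : ℝ → E} (hC : 0 ≤ C)
    (h : LipBound T C w) : ContinuousOn w (Icc 0 T) := by
  have : LipschitzOnWith ⟨C, hC⟩ w (Icc 0 T) := LipschitzOnWith.of_dist_le_mul fun t ht s hs => by
    rw [dist_eq_norm, Real.dist_eq]
    exact h s hs t ht
  exact this.continuousOn

theorem TimeSobolev.exists_taylor {w : ℝ → L2 d} (h : TimeSobolev T 2 w) :
    ∃ (g : ℝ → L2 d) (L M : ℝ), 0 ≤ L ∧ 0 ≤ M ∧ (∀ s ∈ Icc 0 T, ‖g s‖ ≤ M) ∧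
      ∀ s ∈ Icc 0 T, ∀ t ∈ Icc 0 T, ‖w t - w s - (t - s) • g s‖ ≤ L * |t - s| ^ 2 := by
  obtain ⟨g, hg, h⟩ := h
  obtain ⟨L, hL, hLip⟩ := TimeSobolev.lipBound hg
  have hc := hLip.continuousOn hL
  obtain ⟨M, hM⟩ := isCompact_Icc.exists_bound_of_continuousOn hc
  refine ⟨g, L, max M 0, hL, le_max_right _ _, fun s hs => (hM s hs).trans (le_max_left _ _),
    fun s hs t ht => ?_⟩
  have h0 : (0 : ℝ) ∈ Icc 0 T := ⟨le_rfl, hs.1.trans hs.2⟩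
  have hint : ∀ a ∈ Icc 0 T, ∀ b ∈ Icc 0 T, IntervalIntegrable g volume a b := fun a ha b hb =>
    (hc.mono (uIcc_subset_of_mem_Icc ha hb)).intervalIntegrable
  have e : w t - w s - (t - s) • g s = ∫ r in s..t, (g r - g s) := by
    rw [intervalIntegral.integral_sub (hint s hs t ht) intervalIntegrable_const,
      intervalIntegral.integral_const, h t ht, h s hs, add_sub_add_left_eq_sub,
      intervalIntegral.integral_interval_sub_left (hint 0 h0 t ht) (hint 0 h0 s hs)]
  rw [e, sq, ← mul_assoc]
  refine intervalIntegral.norm_integral_le_of_norm_le_const fun r hr => ?_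
  have hr' := uIoc_subset_uIcc hr
  refine (hLip s hs r (uIcc_subset_of_mem_Icc hs ht hr')).trans
    (mul_le_mul_of_nonneg_left ?_ hL)
  exact abs_sub_left_of_mem_uIcc hr'

theorem TimeSobolev.lipBound_two {w : ℝ → L2 d} (h : TimeSobolev T 2 w) :
    ∃ C, 0 ≤ C ∧ LipBound T C w := by
  obtain ⟨g, L, M, hL, hM, hb, ht⟩ := h.exists_taylor
  refine ⟨M + L * |T|, by positivity, fun s hs t ht' => ?_⟩
  have h1 := ht s hs t ht'
  have h2 : ‖(t - s) • g s‖ ≤ |t - s| * M := by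
    rw [norm_smul, Real.norm_eq_abs]
    exact mul_le_mul_of_nonneg_left (hb s hs) (abs_nonneg _)
  have h3 : |t - s| ≤ |T| := by
    rw [abs_of_nonneg (hs.1.trans hs.2), abs_le]
    constructor <;> linarith [hs.1, hs.2, ht'.1, ht'.2]
  have h4 : L * |t - s| ^ 2 ≤ L * |T| * |t - s| := by
    rw [sq, ← mul_assoc]
    gcongr
  calc ‖w t - w s‖ = ‖(w t - w s - (t - s) • g s) + (t - s) • g s‖ := by rw [sub_add_cancel]
    _ ≤ _ := norm_add_le _ _
    _ ≤ _ := by linarith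

theorem TimeSobolev.secondDiffBound {w : ℝ → L2 d} (h : TimeSobolev T 2 w) :
    ∃ C, 0 ≤ C ∧ SecondDiffBound T C w := by
  obtain ⟨g, L, M, hL, hM, hb, ht⟩ := h.exists_taylor
  refine ⟨2 * L, by positivity, fun m h hh h1 h2 => ?_⟩
  have m0 : m ∈ Icc 0 T := ⟨by linarith, by linarith⟩
  have t1 := ht m m0 (m + h) ⟨by linarith, h2⟩
  have t2 := ht m m0 (m - h) ⟨h1, by linarith⟩
  rw [add_sub_cancel_left, sq_abs] at t1
  rw [sub_sub_cancel_left, sq_abs, neg_sq] at t2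
  have e : w (m + h) + w (m - h) - (2 : ℝ) • w m
      = (w (m + h) - w m - h • g m) + (w (m - h) - w m - (-h) • g m) := by module
  rw [e]
  refine (norm_add_le _ _).trans ?_
  linarith

section

variable {E : Type*} [NormedAddCommGroup E] [NormedSpace ℝ E] {C C' : ℝ} {w w' : ℝ → E}

theorem SecondDiffBound.add (h : SecondDiffBound T C w) (h' : SecondDiffBound T C' w') :
    SecondDiffBound T (C + C') fun t => w t + w' t := fun m s h0 h1 h2 => by
  have e : w (m + s) + w' (m + s) + (w (m - s) + w' (m - s)) - (2 : ℝ) • (w m + w' m)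
      = (w (m + s) + w (m - s) - (2 : ℝ) • w m)
        + (w' (m + s) + w' (m - s) - (2 : ℝ) • w' m) := by module
  rw [e, add_mul]
  exact (norm_add_le _ _).trans (add_le_add (h m s h0 h1 h2) (h' m s h0 h1 h2))

theorem SecondDiffBound.neg (h : SecondDiffBound T C w) : SecondDiffBound T C fun t => -w t :=
  fun m s h0 h1 h2 => by
    have e : -w (m + s) + -w (m - s) - (2 : ℝ) • -w m
        = -(w (m + s) + w (m - s) - (2 : ℝ) • w m) := by module
    rw [e, norm_neg]
    exact h m s h0 h1 h2

theorem SecondDiffBound.sum {ι : Type*} {s : Finset ι} {C : ι → ℝ} {w : ι → ℝ → E}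
    (h : ∀ i ∈ s, SecondDiffBound T (C i) (w i)) :
    SecondDiffBound T (∑ i ∈ s, C i) fun t => ∑ i ∈ s, w i t := by
  classical
  induction s using Finset.induction_on with
  | empty => intro m h _ _ _; simp
  | insert i s hi ih =>
    simp only [Finset.sum_insert hi]
    exact (h i (Finset.mem_insert_self i s)).add
      (ih fun k hk => h k (Finset.mem_insert_of_mem hk))

/-- Differentiate in `h`: the derivative is the centered second difference of `w'`, so `w'` itself
need not be differentiable. -/
theorem norm_midpoint_sub_le (hu : ContinuousOn w (Icc 0 T))
    (hw : ∀ t ∈ Ioo 0 T, HasDerivAt w (w' t) t) (hC : 0 ≤ C) (hw' : SecondDiffBound T C w')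
    {m h : ℝ} (hh : 0 ≤ h) (h1 : 0 ≤ m - h) (h2 : m + h ≤ T) :
    ‖w (m + h) - w (m - h) - (2 * h) • w' m‖ ≤ C * h ^ 3 := by
  have key := norm_image_sub_le_of_norm_deriv_right_le_segment (a := 0) (b := h) (C := C * h ^ 2)
    (f := fun s => w (m + s) - w (m - s) - (2 * s) • w' m)
    (f' := fun s => w' (m + s) + w' (m - s) - (2 : ℝ) • w' m) ?_ ?_ ?_ h ⟨hh, le_rfl⟩
  · simp only [add_zero, sub_zero, sub_self, mul_zero, zero_smul] at key
    refine key.trans (le_of_eq ?_)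
    ring
  · refine ContinuousOn.sub (ContinuousOn.sub ?_ ?_) (by fun_prop)
    · refine hu.comp (by fun_prop) fun s hs => ⟨?_, ?_⟩ <;> linarith [hs.1, hs.2]
    · refine hu.comp (by fun_prop) fun s hs => ⟨?_, ?_⟩ <;> linarith [hs.1, hs.2]
  · intro s hs
    have d1 : HasDerivAt (fun s => w (m + s)) (w' (m + s)) s :=
      (hw (m + s) ⟨by linarith [hs.1, hs.2], by linarith [hs.1, hs.2]⟩).comp_const_add m s
    have d2 : HasDerivAt (fun s => w (m - s)) (-w' (m - s)) s :=
      (hw (m - s) ⟨by linarith [hs.1, hs.2], by linarith [hs.1, hs.2]⟩).comp_const_sub m s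
    have d3 : HasDerivAt (fun s : ℝ => (2 * s) • w' m) ((2 * 1 : ℝ) • w' m) s :=
      ((hasDerivAt_id s).const_mul 2).smul_const _
    have := ((d1.sub d2).sub d3).hasDerivWithinAt (s := Ici s)
    rw [sub_neg_eq_add, mul_one] at this
    exact this
  · intro s hs
    refine (hw' m s hs.1 (by linarith [hs.2]) (by linarith [hs.2])).trans ?_
    have := hs.1
    have := hs.2.le
    gcongr

end

/-- The regularity assumption gives constants that may depend on `τ`. Since the operator is affine
in `τ`, the values `τ = 1` and `τ = 2` yield one constant for all steps up to `T`. -/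
theorem splitSymbol_affine (hd : d = 2 ∨ d = 3) {τ : ℝ} (hτ : τ ≠ 0) (n : Fin d → ℕ) :
    splitSymbol τ n = (2 - τ) * splitSymbol 1 n + (τ - 1) * splitSymbol 2 n := by
  rcases hd with rfl | rfl
  · rw [splitSymbol_two hτ, splitSymbol_two one_ne_zero, splitSymbol_two two_ne_zero]
    ring
  · rw [splitSymbol_three hτ, splitSymbol_three one_ne_zero, splitSymbol_three two_ne_zero]
    ring

theorem exists_splitB_lipBound (hd : d = 2 ∨ d = 3) {v : ℝ → L2 d}
    (hv : ∀ τ > 0, TimeDB T 1 τ v) :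
    ∃ (B : ℝ → ℝ → L2 d) (C : ℝ), 0 ≤ C ∧
      (∀ τ, τ ≠ 0 → ∀ t ∈ Icc 0 T, ∀ n,
        coef (fun _ => true) n (B τ t) = splitSymbol τ n * coef (fun _ => true) n (v t)) ∧
      ∀ τ ∈ Icc 0 T, LipBound T C (B τ) := by
  obtain ⟨-, w₁, h₁, hw₁⟩ := hv 1 one_pos
  obtain ⟨-, w₂, h₂, hw₂⟩ := hv 2 two_pos
  obtain ⟨C₁, hC₁, hL₁⟩ := hw₁.lipBound
  obtain ⟨C₂, hC₂, hL₂⟩ := hw₂.lipBound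
  refine ⟨fun τ t => (2 - τ) • w₁ t + (τ - 1) • w₂ t, (2 + |T|) * C₁ + (1 + |T|) * C₂,
    by positivity, fun τ hτ t ht n => ?_, fun τ hτ s hs t ht => ?_⟩
  · rw [coef_add, coef_smul, coef_smul, (h₁ t ht).coef_eq hd one_ne_zero,
      (h₂ t ht).coef_eq hd two_ne_zero, splitSymbol_affine hd hτ]
    ring
  · have e : (2 - τ) • w₁ t + (τ - 1) • w₂ t - ((2 - τ) • w₁ s + (τ - 1) • w₂ s)
        = (2 - τ) • (w₁ t - w₁ s) + (τ - 1) • (w₂ t - w₂ s) := by module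
    have hT : |T| = T := abs_of_nonneg (hτ.1.trans hτ.2)
    have a1 : |2 - τ| ≤ 2 + |T| := by
      rw [hT, abs_le]; constructor <;> linarith [hτ.1, hτ.2]
    have a2 : |τ - 1| ≤ 1 + |T| := by
      rw [hT, abs_le]; constructor <;> linarith [hτ.1, hτ.2]
    rw [e, add_mul, mul_assoc, mul_assoc]
    refine (norm_add_le _ _).trans (add_le_add ?_ ?_)
    · rw [norm_smul, Real.norm_eq_abs]
      exact mul_le_mul a1 (hL₁ s hs t ht) (norm_nonneg _) (by positivity)
    · rw [norm_smul, Real.norm_eq_abs]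
      exact mul_le_mul a2 (hL₂ s hs t ht) (norm_nonneg _) (by positivity)

/-- The truncation error of the velocity step. -/
theorem exists_truncation_bound (hd : d = 2 ∨ d = 3) {f u : ℝ → Fin d → L2 d} {p : ℝ → L2 d}
    (hf : ∀ j, TimeSobolev T 2 fun t => f t j) (hsol : IsStokesSolution T f u p)
    (hu : ∀ j, TimeH2 T 2 fun t => u t j) (huB : ∀ τ > 0, ∀ j, TimeDB T 1 τ fun t => u t j)
    (hp : TimeY T 2 p) (j : Fin d) :
    ∃ (lap grad : ℝ → L2 d) (B : ℝ → ℝ → L2 d) (C : ℝ), 0 ≤ C ∧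
      (∀ t ∈ Icc 0 T, HasLaplacian (u t j) (lap t)) ∧
      (∀ t ∈ Icc 0 T, HasWeakDeriv [j] (p t) (grad t)) ∧
      (∀ τ, τ ≠ 0 → ∀ t ∈ Icc 0 T, ∀ n,
        coef (fun _ => true) n (B τ t) = splitSymbol τ n * coef (fun _ => true) n (u t j)) ∧
      ∀ τ > 0, ∀ t, 0 ≤ t → t + τ ≤ T →
        ‖τ⁻¹ • (u (t + τ) j - u t j) - (1 / 2 : ℝ) • (lap (t + τ) + lap t)
          + (τ / 4) • (B τ (t + τ) - B τ t) + grad (t + τ / 2) - f (t + τ / 2) j‖ ≤ C * τ ^ 2 := by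
  choose D2 hD2 hD2T using fun i : Fin d => hu j [i, i] (by simp)
  obtain ⟨grad, hgrad, hgradT⟩ := hp.1 [j] (by simp)
  obtain ⟨B, CB, hCB, hB, hBL⟩ := exists_splitB_lipBound hd fun τ hτ => huB τ hτ j
  choose C2 hC2 hS2 using fun i => (hD2T i).secondDiffBound
  obtain ⟨Cg, hCg, hSg⟩ := hgradT.secondDiffBound
  obtain ⟨Cf, hCf, hSf⟩ := (hf j).secondDiffBound
  obtain ⟨Cu, hCu, hLu⟩ := (huB 1 one_pos j).1.lipBound
  have hSl : SecondDiffBound T (∑ i, C2 i) fun t => ∑ i, D2 i t :=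
    SecondDiffBound.sum fun i _ => hS2 i
  have hCl : 0 ≤ ∑ i, C2 i := Finset.sum_nonneg fun i _ => hC2 i
  have hlap : ∀ t ∈ Icc 0 T, HasLaplacian (u t j) (∑ i, D2 i t) := fun t ht =>
    ⟨fun i => D2 i t, fun i => hD2 i t ht, rfl⟩
  -- The momentum equation expresses the time derivative through `f`, `Δu` and `∇p`, all with
  -- bounded second differences. This provides the third order in time that the midpoint rule needs.
  have hder : ∀ t ∈ Ioo 0 T, HasDerivAt (fun s => u s j) (f t j + ∑ i, D2 i t + -grad t) t := by
    intro t ht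
    obtain ⟨l, g, ⟨h, hh, rfl⟩, hg, hd⟩ := hsol.momentum t ⟨ht.1, ht.2.le⟩ j
    have ht' : t ∈ Icc 0 T := ⟨ht.1.le, ht.2.le⟩
    have e1 : ∀ i, h i = D2 i t := fun i => (hh i).unique (hD2 i t ht')
    rw [hg.unique (hgrad t ht'), Finset.sum_congr rfl fun i _ => e1 i, sub_eq_add_neg] at hd
    exact hd.hasDerivAt (Icc_mem_nhds ht.1 ht.2)
  have hSF := (hSf.add hSl).add hSg.neg
  have hCF : 0 ≤ Cf + ∑ i, C2 i + Cg := by positivity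
  refine ⟨fun t => ∑ i, D2 i t, grad, B, (Cf + ∑ i, C2 i + Cg) + ∑ i, C2 i + CB, by positivity,
    hlap, hgrad, hB, fun τ hτ t h0 h1 => ?_⟩
  have hm := norm_midpoint_sub_le (hLu.continuousOn hCu) hder hCF hSF (m := t + τ / 2)
    (h := τ / 2) (by positivity) (by linarith) (by linarith)
  have hl := hSl (t + τ / 2) (τ / 2) (by positivity) (by linarith) (by linarith)
  rw [show t + τ / 2 + τ / 2 = t + τ by ring, show t + τ / 2 - τ / 2 = t by ring] at hm hl
  have hb := hBL τ ⟨hτ.le, by linarith⟩ t ⟨h0, by linarith⟩ (t + τ) ⟨by linarith, h1⟩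
  rw [add_sub_cancel_left, abs_of_pos hτ] at hb
  set F := f (t + τ / 2) j + ∑ i, D2 i (t + τ / 2) + -grad (t + τ / 2) with hF
  -- With the momentum equation at the midpoint inserted, the truncation error is the defect of the
  -- midpoint difference, the trapezoidal defect of the Laplacian and the increment of the splitting
  -- term. The last already carries a factor `τ`, so a Lipschitz bound is enough for it.
  have e : τ⁻¹ • (u (t + τ) j - u t j) - (1 / 2 : ℝ) • (∑ i, D2 i (t + τ) + ∑ i, D2 i t)
          + (τ / 4) • (B τ (t + τ) - B τ t) + grad (t + τ / 2) - f (t + τ / 2) j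
      = τ⁻¹ • (u (t + τ) j - u t j - (2 * (τ / 2)) • F)
        - (1 / 2 : ℝ) • (∑ i, D2 i (t + τ) + ∑ i, D2 i t - (2 : ℝ) • ∑ i, D2 i (t + τ / 2))
        + (τ / 4) • (B τ (t + τ) - B τ t) := by
    have h3 : τ⁻¹ • (2 * (τ / 2)) • F = F := by
      rw [smul_smul, show τ⁻¹ * (2 * (τ / 2)) = 1 by field_simp, one_smul]
    rw [smul_sub τ⁻¹ (_ - _) _, h3, hF]
    module
  rw [e]
  refine (norm_add_le _ _).trans ?_
  refine (add_le_add_left (norm_sub_le _ _) _).trans ?_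
  rw [norm_smul, norm_smul, norm_smul, Real.norm_of_nonneg (by positivity : 0 ≤ τ⁻¹),
    Real.norm_of_nonneg (by positivity : 0 ≤ τ / 4), Real.norm_of_nonneg (by positivity)]
  have b1 : τ⁻¹ * ‖u (t + τ) j - u t j - (2 * (τ / 2)) • F‖
      ≤ (Cf + ∑ i, C2 i + Cg) * τ ^ 2 := by
    rw [inv_mul_le_iff₀ hτ]
    refine hm.trans ?_
    have : 0 ≤ (Cf + ∑ i, C2 i + Cg) * τ ^ 3 := by positivity
    nlinarith
  have b2 : 1 / 2 * ‖∑ i, D2 i (t + τ) + ∑ i, D2 i t - (2 : ℝ) • ∑ i, D2 i (t + τ / 2)‖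
      ≤ (∑ i, C2 i) * τ ^ 2 := by
    have : 0 ≤ (∑ i, C2 i) * τ ^ 2 := by positivity
    nlinarith
  have b3 : τ / 4 * ‖B τ (t + τ) - B τ t‖ ≤ CB * τ ^ 2 := by
    have : 0 ≤ CB * τ ^ 2 := by positivity
    nlinarith
  linarith

/-- The exact pressure, lifted to the space of pressure corrections. -/
theorem exists_pressure_lift {p : ℝ → L2 d} (hp : TimeY T 2 p) :
    ∃ C, 0 ≤ C ∧ ∀ (τ : ℝ) (O : SplitOperators d τ), ∃ Q : ℝ → L2 d,
      (∀ t ∈ Icc 0 T, O.j (Q t) = p t) ∧ LipBound T C Q ∧ SecondDiffBound T C Q := by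
  choose g hg hgT using fun S : Finset (Fin d) => hp.1 S.toList S.nodup_toList
  choose C₁ hC₁ hL using fun S => (hgT S).lipBound_two
  choose C₂ hC₂ hS using fun S => (hgT S).secondDiffBound
  refine ⟨∑ S, (C₁ S + C₂ S), Finset.sum_nonneg fun S _ => add_nonneg (hC₁ S) (hC₂ S),
    fun τ O => ?_⟩
  have hQ : ∀ t, ∃ y, t ∈ Icc 0 T → O.j y = p t := fun t => by
    by_cases ht : t ∈ Icc 0 T
    · obtain ⟨y, hy⟩ := O.exists_press_lift fun S => hg S t ht
      exact ⟨y, fun _ => hy⟩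
    · exact ⟨0, fun h => absurd h ht⟩
  choose Q hQ using hQ
  refine ⟨Q, hQ, fun s hs t ht => ?_, fun m h h0 h1 h2 => ?_⟩
  · have h1 : ∀ S : Finset (Fin d), HasWeakDeriv S.toList (O.j (Q t - Q s)) (g S t - g S s) :=
      fun S => by
        rw [map_sub, hQ t ht, hQ s hs]
        exact (hg S t ht).sub (hg S s hs)
    refine (O.norm_press_lift_le h1).trans ?_
    rw [Finset.sum_mul]
    refine Finset.sum_le_sum fun S _ => (hL S s hs t ht).trans ?_
    exact mul_le_mul_of_nonneg_right (le_add_of_nonneg_right (hC₂ S)) (abs_nonneg _)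
  · have m1 : m ∈ Icc 0 T := ⟨by linarith, by linarith⟩
    have m2 : m + h ∈ Icc 0 T := ⟨by linarith, by linarith⟩
    have m3 : m - h ∈ Icc 0 T := ⟨by linarith, by linarith⟩
    have e : ∀ q : ℝ → L2 d, q (m + h) + q (m - h) - (2 : ℝ) • q m
        = (q (m + h) - q m) - (q m - q (m - h)) := fun q => by module
    have h1 : ∀ S : Finset (Fin d), HasWeakDeriv S.toList
        (O.j (Q (m + h) + Q (m - h) - (2 : ℝ) • Q m))
        (g S (m + h) + g S (m - h) - (2 : ℝ) • g S m) := fun S => by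
      rw [e, e, map_sub, map_sub, map_sub, hQ _ m1, hQ _ m2, hQ _ m3]
      exact ((hg S _ m2).sub (hg S _ m1)).sub ((hg S _ m1).sub (hg S _ m3))
    refine (O.norm_press_lift_le h1).trans ?_
    rw [Finset.sum_mul]
    refine Finset.sum_le_sum fun S _ => (hS S m h h0 (by linarith) h2).trans ?_
    exact mul_le_mul_of_nonneg_right (le_add_of_nonneg_left (hC₁ S)) (sq_nonneg _)

end TimeRegularity

end DirSplit

namespace DirSplit

/-! ### The scheme as an instance of the error equations -/

section Convergence

variable {d : ℕ} {T τ χ : ℝ}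

theorem SplitOperators.eq_zero_of_ι_eq_zero (O : SplitOperators d τ) (hτ : 0 < τ) {w : VelSpace d}
    (h : ∀ k, O.ι w k = 0) : w = 0 :=
  PiLp.ext fun k => eq_zero_of_coef_eq_zero (σ := fun _ => true) fun n => by
    rw [O.coef_eq_mul_coef_ι hτ, h, coef_zero, mul_zero]

theorem norm_piLp_le_sum {ι : Type*} [Fintype ι] {E : ι → Type*}
    [∀ i, NormedAddCommGroup (E i)] (v : PiLp 2 E) : ‖v‖ ≤ ∑ i, ‖v i‖ := by
  refine abs_le_of_sq_le_sq' ?_ (Finset.sum_nonneg fun _ _ => norm_nonneg _) |>.2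
  rw [PiLp.norm_sq_eq_of_L2]
  exact Finset.sum_sq_le_sq_sum_of_nonneg fun _ _ => norm_nonneg _

/-- Induction is essential: the step equation for `u^{k+1}` is diagonal in sines only once `u^k` is
known to vanish on all faces. -/
theorem IsScheme.isStepRegular (hd : d = 2 ∨ d = 3) (hτ : 0 < τ) {f : ℝ → Fin d → L2 d}
    {u₀ : Fin d → L2 d} {p₀ φs : L2 d} {u : ℕ → Fin d → L2 d} {p φ : ℕ → L2 d}
    (h : IsScheme T τ χ f u₀ p₀ φs u p φ) (h₀ : ∀ j, IsStepRegular τ (u₀ j)) (k : ℕ)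
    (hk : k * τ ≤ T) (j : Fin d) : IsStepRegular τ (u k j) := by
  induction k generalizing j with
  | zero => rw [h.init_u]; exact h₀ j
  | succ k ih =>
    rw [Nat.cast_add_one] at hk
    have hr := ih (by linarith)
    obtain ⟨g, -, hg⟩ := (h.velocity k hk).coef_eq hd hτ (fun i => (hr i).memH10 hτ) j
    exact (hr j).of_step hτ hg

/-- The increments of a sequence, frozen from the index `M` on. -/
def frozenIncrements {E : Type*} [Sub E] (M : ℕ) (q : ℕ → E) (k : ℕ) : E :=
  q (min k M) - q (min k M - 1)

/-- For a fixed `k`, the differences between exact and discrete solution form an abstract error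
system with `k + 1` steps; the gradient bound at its last level is the claim. -/
theorem IsScheme.h10NormLE (hd : d = 2 ∨ d = 3) (hτ : 0 < τ) (hχ : 0 < χ) (hχ' : χ ≤ 1)
    (O : SplitOperators d τ) {f ue : ℝ → Fin d → L2 d} {pe : ℝ → L2 d} {φs : L2 d}
    {u : ℕ → Fin d → L2 d} {p φ : ℕ → L2 d}
    (h : IsScheme T τ χ f (ue 0) (pe 0) φs u p φ)
    (hreg : ∀ t ∈ Icc 0 T, ∀ j, IsStepRegular τ (ue t j))
    (hdiv : ∀ t ∈ Icc 0 T, HasWeakDiv (ue t) 0)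
    {Q : ℝ → L2 d} {Cd : ℝ} (hCd : 0 ≤ Cd) (hQ : ∀ t ∈ Icc 0 T, O.j (Q t) = pe t)
    (hQ1 : LipBound T Cd Q) (hQ2 : SecondDiffBound T Cd Q)
    {lap grad : Fin d → ℝ → L2 d} {B : Fin d → ℝ → ℝ → L2 d} {CR : Fin d → ℝ}
    (hlap : ∀ j, ∀ t ∈ Icc 0 T, HasLaplacian (ue t j) (lap j t))
    (hgrad : ∀ j, ∀ t ∈ Icc 0 T, HasWeakDeriv [j] (pe t) (grad j t))
    (hB : ∀ j, ∀ t ∈ Icc 0 T, ∀ n, coef (fun _ => true) n (B j τ t)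
      = splitSymbol τ n * coef (fun _ => true) n (ue t j))
    (hR : ∀ j t, 0 ≤ t → t + τ ≤ T →
        ‖τ⁻¹ • (ue (t + τ) j - ue t j) - (1 / 2 : ℝ) • (lap j (t + τ) + lap j t)
          + (τ / 4) • (B j τ (t + τ) - B j τ t) + grad j (t + τ / 2) - f (t + τ / 2) j‖
        ≤ CR j * τ ^ 2)
    {C₀ : ℝ} (h₀ : ‖pe (τ / 2) - (pe 0 + φs)‖ ≤ C₀ * τ) {k : ℕ} (hk : (k + 1) * τ ≤ T) :
    H10NormLE (avg (fun n => ue (n * τ)) k - avg u k)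
      ((√(errorConst T (∑ j, CR j) (2 * Cd)) + 5 * C₀ / χ) * τ) := by
  have hT0 : 0 ≤ T := (by positivity : (0 : ℝ) ≤ (k + 1) * τ).trans hk
  have htime : ∀ i ≤ k + 1, (i : ℝ) * τ ∈ Icc 0 T := fun i hi => by
    refine ⟨by positivity, le_trans ?_ hk⟩
    have : (i : ℝ) ≤ k + 1 := by exact_mod_cast hi
    gcongr
  have hmid : ∀ i ≤ k, (i : ℝ) * τ + τ / 2 ∈ Icc 0 T := fun i hi => by
    refine ⟨by positivity, le_trans ?_ hk⟩
    have : (i : ℝ) ≤ k := by exact_mod_cast hi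
    nlinarith
  have hstep : ∀ i ≤ k, ((i : ℝ) + 1) * τ ≤ T := fun i hi => by
    have := (htime (i + 1) (by omega)).2
    rwa [Nat.cast_add_one] at this
  have hru : ∀ i ≤ k + 1, ∀ j, IsStepRegular τ (u i j) := fun i hi =>
    h.isStepRegular hd hτ (hreg 0 ⟨le_rfl, hT0⟩) i (htime i hi).2
  -- the velocity error
  have he : ∀ i : ℕ, ∃ w : VelSpace d, i ≤ k + 1 → ∀ j, O.ι w j = ue (i * τ) j - u i j := by
    intro i
    by_cases hi : i ≤ k + 1
    · obtain ⟨w, hw⟩ := O.exists_lift hτ fun j => (hreg _ (htime i hi) j).sub (hru i hi j)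
      exact ⟨w, fun _ => hw⟩
    · exact ⟨0, fun hi' => absurd hi' hi⟩
  choose e he using he
  have hdve : ∀ i ≤ k + 1, HasWeakDiv (u i) (-O.dv (e i)) := by
    intro i hi
    have h1 := (hdiv _ (htime i hi)).sub (O.hasWeakDiv (e i))
    have h2 : ue (i * τ) - (fun j => O.ι (e i) j) = u i := funext fun j => by
      rw [Pi.sub_apply, he i hi, sub_sub_cancel]
    rwa [h2, zero_sub] at h1
  -- the pressure corrections
  have hφ : ∀ i : ℕ, ∃ y : L2 d, (i = 0 → y = 0) ∧ ∀ l, i = l + 1 → l ≤ k →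
      O.j y = φ (l + 1) ∧ ∀ ψ, inner ℝ (O.dv (e (l + 1))) (O.j ψ) = τ * inner ℝ y ψ := by
    rintro (_ | i)
    · exact ⟨0, fun _ => rfl, fun l hl => by omega⟩
    by_cases hi : i ≤ k
    · obtain ⟨D, hD, hA⟩ := h.penalty i (hstep i hi)
      refine ⟨O.j (-(1 / τ) • D), fun h => by omega, fun l hl _ => ?_⟩
      obtain rfl : i = l := by omega
      refine ⟨O.j_j_of_hasA hd hA, fun ψ => ?_⟩
      rw [O.inner_j_left, hD.unique (hdve (i + 1) (by omega)), inner_smul_left, inner_neg_left]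
      simp only [conj_trivial]
      field_simp
    · exact ⟨0, fun _ => rfl, fun l hl hl' => by omega⟩
  choose φ' hφ0 hφ using hφ
  -- The discrete pressure `p i`, which stands for `p^{i-1/2}`, is compared with the exact one a
  -- whole step later, at `t_i + τ/2`, since this is what the predictor extrapolates to. The first
  -- value is taken at time zero instead, to make the pressure error start from zero.
  let q : ℕ → L2 d := fun i => if i = 0 then Q 0 else Q (i * τ + τ / 2)
  let P : ℕ → L2 d := fun i => if i = 0 then pe 0 else pe (i * τ + τ / 2)
  have hqP : ∀ i ≤ k, O.j (q i) = P i := fun i hi => by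
    by_cases h0 : i = 0
    · simp only [q, P, if_pos h0]; exact hQ 0 ⟨le_rfl, hT0⟩
    · simp only [q, P, if_neg h0]; exact hQ _ (hmid i hi)
  -- Freezing keeps the bounds valid at all indices without evaluating the pressure beyond `T`.
  -- Truncated subtraction makes `δ 0 = 0`, and the frozen `δ (k + 1)` enters only `η (k + 1)`,
  -- which no momentum equation up to level `k + 1` contains.
  let δ : ℕ → L2 d := frozenIncrements k q
  let η : ℕ → L2 d := fun i => Nat.rec 0 (fun i y => y + δ (i + 1) - φ' (i + 1)) i
  let S : ℕ → L2 d := fun i => Nat.rec 0 (fun i y => y + (1 / 2 : ℝ) • O.dv (e (i + 1) + e i)) i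
  let Z : ℕ → L2 d := fun i => if i = 0 then pe (τ / 2) - (pe 0 + φs) else 0
  let R : ℕ → VelSpace d := fun i => WithLp.toLp 2 fun j =>
    τ⁻¹ • (ue (i * τ + τ) j - ue (i * τ) j) - (1 / 2 : ℝ) • (lap j (i * τ + τ) + lap j (i * τ))
      + (τ / 4) • (B j τ (i * τ + τ) - B j τ (i * τ)) + grad j (i * τ + τ / 2)
      - f (i * τ + τ / 2) j
  have hη : ∀ i, η (i + 1) = η i + δ (i + 1) - φ' (i + 1) := fun i => rfl
  have hS : ∀ i, S (i + 1) = S i + (1 / 2 : ℝ) • O.dv (e (i + 1) + e i) := fun i => rfl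
  -- the pressure error
  have hpress : ∀ i ≤ k, P i - p i = O.j (η i) - χ • S i := by
    intro i hi
    induction i with
    | zero =>
      have : η 0 = 0 := rfl
      have : S 0 = 0 := rfl
      simp [P, h.init_p, *]
    | succ i ih =>
      obtain ⟨D, hD, hp⟩ := h.pressure i (hstep i (by omega))
      have hδ : δ (i + 1) = q (i + 1) - q i := by
        simp only [δ, frozenIncrements, min_eq_left hi, Nat.add_sub_cancel]
      have hdvD : (1 / 2 : ℝ) • O.dv (e (i + 1) + e i) = -D := by
        rw [hD.unique ((hdve (i + 1) (by omega)).midpoint (hdve i (by omega))), map_add]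
        module
      rw [hp, hη, hS, map_sub, map_add, hδ, map_sub, hqP _ hi, hqP i (by omega),
        (hφ (i + 1) i rfl (by omega)).1, hdvD]
      have := ih (by omega)
      rw [sub_eq_iff_eq_add] at this
      rw [this]
      module
  -- The argument of the pressure gradient in the error equation is the error of the predictor. At
  -- the first step `η`, `φ'` and `S` vanish, and `Z 0` is the whole of it.
  have hq : ∀ i ≤ k, O.j (η i - φ' i) - χ • S i + Z i
      = pe (i * τ + τ / 2) - (p i + φ i) := by
    rintro (_ | i) hi
    · have h1 : η 0 = 0 := rfl
      have h2 : S 0 = 0 := rfl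
      simp [h1, h2, hφ0 0 rfl, Z, h.init_p, h.init_φ]
    · have h1 := hpress (i + 1) hi
      simp only [P, if_neg (Nat.succ_ne_zero i)] at h1
      simp only [Z, if_neg (Nat.succ_ne_zero i), add_zero]
      rw [map_sub, (hφ (i + 1) i rfl (by omega)).1, sub_right_comm, ← h1]
      abel
  have hsys : IsErrorSystem τ χ O.ι O.D O.β O.dv O.j (k + 1) e φ' η δ S Z R := by
    refine ⟨?_, hφ0 0 rfl, rfl, rfl, fun i _ => hη i, fun i _ => hS i, fun i hi w => ?_,
      fun i hi => (hφ (i + 1) i rfl (by omega)).2⟩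
    · refine O.eq_zero_of_ι_eq_zero hτ fun j => ?_
      rw [he 0 (by omega), h.init_u]
      simp
    · have hi' : i ≤ k := by omega
      choose gs hgs hgs' using fun j => (h.velocity i (hstep i hi')).coef_eq hd hτ
        (fun j => (hru i (by omega) j).memH10 hτ) j
      refine O.momentum_of_coef hτ (g := fun j => grad j (i * τ + τ / 2) - gs j) (fun j => ?_)
        (fun j n => ?_) w
      · rw [hq i hi']
        exact (hgrad j _ (hmid i hi')).sub (hgs j)
      · have ht : (i : ℝ) * τ ∈ Icc 0 T := htime i (by omega)
        have ht' : (i : ℝ) * τ + τ ∈ Icc 0 T := by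
          have := htime (i + 1) (by omega)
          rwa [Nat.cast_add_one, add_one_mul] at this
        have h1 := hgs' j n
        rw [show ((i : ℝ) + 1 / 2) * τ = i * τ + τ / 2 by ring] at h1
        rw [he i (by omega), he (i + 1) (by omega), Nat.cast_add_one, add_one_mul]
        simp only [R, coef_sub, coef_add, coef_smul, hB j _ ht, hB j _ ht',
          (hlap j _ ht).coef_eq ((hreg _ ht j).memH10 hτ),
          (hlap j _ ht').coef_eq ((hreg _ ht' j).memH10 hτ)] at h1 ⊢
        rw [stepSymbol_eq hτ.ne'] at h1 ⊢
        linear_combination -h1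
  have hRb : ∀ i < k + 1, ‖R i‖ ≤ (∑ j, CR j) * τ ^ 2 := fun i hi => by
    refine (norm_piLp_le_sum _).trans ?_
    rw [Finset.sum_mul]
    refine Finset.sum_le_sum fun j _ => hR j (i * τ) (by positivity) ?_
    rw [← add_one_mul]
    exact hstep i (by omega)
  -- The first increment spans the time `3τ/2`, from zero to `τ + τ/2`; hence the factor `2`.
  have hd1 : ∀ i, ‖δ i‖ ≤ 2 * Cd * τ := fun i => by
    simp only [δ, frozenIncrements]
    have hi : min i k ≤ k := min_le_right _ _
    generalize min i k = i at hi
    rcases i with _ | _ | i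
    · simp only [Nat.zero_sub, sub_self, norm_zero]; positivity
    · have h1 := hQ1 0 ⟨le_rfl, hT0⟩ _ (hmid 1 hi)
      simp only [q]
      simp only [Nat.cast_one, one_mul, sub_zero] at h1
      rw [abs_of_nonneg (by positivity)] at h1
      simp only [zero_add, one_ne_zero, if_false, Nat.sub_self, if_true, Nat.cast_one, one_mul]
      refine h1.trans ?_
      nlinarith [mul_nonneg hCd hτ.le]
    · have h1 := hQ1 _ (hmid (i + 1) (by omega)) _ (hmid (i + 2) hi)
      have e1 : q (i + 1 + 1) = Q (((i + 2 : ℕ) : ℝ) * τ + τ / 2) := if_neg (by omega)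
      have e2 : q (i + 1 + 1 - 1) = Q (((i + 1 : ℕ) : ℝ) * τ + τ / 2) := if_neg (by omega)
      rw [e1, e2]
      refine h1.trans ?_
      push_cast
      rw [show ((i : ℝ) + 2) * τ + τ / 2 - ((i + 1) * τ + τ / 2) = τ by ring, abs_of_pos hτ]
      nlinarith [mul_nonneg hCd hτ.le]
  have hd2 : ∀ i, ‖δ (i + 3) - δ (i + 2)‖ ≤ 2 * Cd * τ ^ 2 := fun i => by
    simp only [δ, frozenIncrements]
    by_cases hi : i + 3 ≤ k
    · rw [min_eq_left hi, min_eq_left (by omega : i + 2 ≤ k)]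
      have h1 := hQ2 (((i + 2 : ℕ) : ℝ) * τ + τ / 2) τ hτ.le
        (by push_cast; nlinarith [mul_nonneg (Nat.cast_nonneg (α := ℝ) i) hτ.le])
        (by
          have := (hmid (i + 3) hi).2
          push_cast at this ⊢
          linarith)
      simp only [q]
      simp only [Nat.add_eq_zero_iff, OfNat.ofNat_ne_zero, one_ne_zero, and_false, if_false,
        Nat.reduceSubDiff]
      push_cast at h1 ⊢
      rw [show ((i : ℝ) + 2) * τ + τ / 2 + τ = (i + 3) * τ + τ / 2 by ring,
        show ((i : ℝ) + 2) * τ + τ / 2 - τ = (i + 1) * τ + τ / 2 by ring] at h1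
      have h2 : ∀ a b c : L2 d, a - b - (b - c) = a + c - (2 : ℝ) • b := fun a b c => by module
      rw [h2]
      refine h1.trans ?_
      nlinarith [mul_nonneg hCd (sq_nonneg τ)]
    · rw [min_eq_right (by omega : k ≤ i + 3), min_eq_right (by omega : k ≤ i + 2), sub_self,
        norm_zero]
      positivity
  have key := hsys.norm_grad_le hτ hχ hχ' (O.splitForms hτ) (by exact_mod_cast hk) hRb
    (by simp [δ, frozenIncrements]) hd1 hd2 (fun i => by simp [Z])
    (by simpa [Z] using h₀) (Nat.lt_succ_self k)
  refine ⟨fun i j => O.D ((1 / 2 : ℝ) • (e (k + 1) + e k)) (i, j), fun i j => ?_, ?_⟩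
  · have h1 := O.hasDerivZeroTrace ((1 / 2 : ℝ) • (e (k + 1) + e k)) i j
    have h2 : O.ι ((1 / 2 : ℝ) • (e (k + 1) + e k)) j
        = (avg (fun n => ue (n * τ)) k - avg u k) j := by
      rw [map_smul, map_add, PiLp.smul_apply, PiLp.add_apply, he (k + 1) le_rfl,
        he k (by omega)]
      simp only [avg, Pi.sub_apply]
      module
    rwa [h2] at h1
  · refine le_trans (le_of_eq ?_) key
    rw [← Fintype.sum_prod_type (f := fun x : Fin d × Fin d =>
      ‖O.D ((1 / 2 : ℝ) • (e (k + 1) + e k)) x‖ ^ 2), ← PiLp.norm_sq_eq_of_L2,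
      Real.sqrt_sq (norm_nonneg _)]

end Convergence

end DirSplit

theorem mainTheorem6 (d : ℕ) (hd : d = 2 ∨ d = 3) (T : ℝ) (hT : 0 < T)
    (f : ℝ → Fin d → L2 d) (hf : ∀ j, TimeSobolev T 2 fun t => f t j)
    (ue : ℝ → Fin d → L2 d) (pe : ℝ → L2 d)
    (hsol : IsStokesSolution T f ue pe)
    (hu : ∀ j, TimeH2 T 2 fun t => ue t j)
    (huB : ∀ τ > 0, ∀ j, TimeDB T 1 τ fun t => ue t j)
    (hp : TimeY T 2 pe)
    (χ : ℝ) (hχ : 0 < χ) (hχ' : χ ≤ 1) (C₀ : ℝ) :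
    ∃ c : ℝ, ∀ τ > 0, ∀ (φs : L2 d) (u : ℕ → Fin d → L2 d) (p φ : ℕ → L2 d),
      ‖pe (τ / 2) - (pe 0 + φs)‖ ≤ C₀ * τ →
      IsScheme T τ χ f (ue 0) (pe 0) φs u p φ →
      ∀ k : ℕ, (k + 1) * τ ≤ T →
        H10NormLE (avg (fun n => ue (n * τ)) k - avg u k) (c * τ) := by
  choose lap grad B CR hCR hlap hgrad hB hR using
    exists_truncation_bound hd hf hsol hu huB hp
  obtain ⟨Cd, hCd, hlift⟩ := exists_pressure_lift hp
  refine ⟨√(errorConst T (∑ j, CR j) (2 * Cd)) + 5 * C₀ / χ,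
    fun τ hτ φs u p φ h₀ hs k hk => ?_⟩
  obtain ⟨O⟩ := SplitOperators.nonempty d hτ
  obtain ⟨Q, hQ, hQ1, hQ2⟩ := hlift τ O
  refine hs.h10NormLE hd hτ hχ hχ' O (fun t ht j => ?_) hsol.incompressible hCd hQ hQ1 hQ2 hlap
    hgrad (fun j => hB j τ hτ.ne') (fun j => hR j τ hτ) h₀ hk
  obtain ⟨-, w, hw, -⟩ := huB τ hτ j
  exact (hw t ht).isStepRegular hd hτ.ne' (hlap j t ht)
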